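/- **Setting.** Let $L\ge 1$, $0\le n\le L-1$ be integers, $\epsilon,\epsilon'\in\{+,-\}$, and let $p,q,\alpha,\beta,\gamma,\delta,s\in\mathbb C$ with $p,q\neq0$, $p\ne q$. Fix a value of $\sqrt{q/p}$ and put $\sqrt{p/q}=1/\sqrt{q/p}$, $\sqrt{pq}=p\sqrt{q/p}$. On $(\mathbb C^2)^{\otimes L}$, with basis indexed by occupation numbers $\tau_i\in\{0,1\}$, let $W=\widehat K_1+K_L+\sum_{j=1}^{L-1}w_{j,j+1}$, where (in the bases $0,1$ and $00,01,10,11$) $$\widehat K=\begin{pmatrix}-\alpha&\gamma e^{-s}\\ \alpha e^{s}&-\gamma\end{pmatrix},\quad K=\begin{pmatrix}-\delta&\beta\\ \delta&-\beta\end{pmatrix},\quad w=\begin{pmatrix}0&0&0&0\\0&-q&p&0\\0&q&-p&0\\0&0&0&0\end{pmatrix}.$$ Put $c_+(x,y)=y/x$, $c_-(x,y)=-1$, $\lambda_+(x,y)=0$, $\lambda_-(x,y)=-x-y$, and assume $\alpha\neq0$ if $\epsilon=+$, $\beta\ne0$ if $\epsilon'=+$, and $$c_\epsilon(\alpha,\gamma)\,c_{\epsilon'}(\beta,\delta)=e^s(p/q)^n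 ;$$ $W$ is then denoted $W^{\epsilon,\epsilon'}_{L-1-n}$. Let $[u]=\frac{1-u}{q-p}$, $\Lambda(z)=\sqrt{pq}\,(z+1/z)-p-q$, and $$u_m=-\Big(\frac qp\Big)^{m-1}e^{-s}c_\epsilon(\alpha,\gamma),\qquad v_m=\Big(\frac qp\Big)^{m-1}v_1,\qquad v_1=\frac1{2\delta}\Big(\frac pq\Big)^{n-1}\Big(p-q+\delta-\beta\pm\sqrt{(\beta-\delta+q-p)^2+4\beta\delta}\Big)$$ (for either choice of the square root; the $v$'s and the assumptions on them are only needed for $n\ge1$). **States.** Let $\mathcal V$ be a complex vector space (of any dimension), $E,D$ endomorphisms of $\mathcal V$, $|V_2\rangle\rangle\in\mathcal V$ and $\langle\langle V_1|\in\mathcal V^*$ with $$qED-pDE=E+D,\quad (\beta D-\delta E+1)|V_2\rangle\rangle=0,\quad \langle\langle V_1|\big(\alpha e^s(E-[u_1])-\gamma e^{-s}(D-[1/u_1])+1\big)=0 .$$ Let $\omega(u)$ be the operator-valued column with entries $E-[u]$ (for $\tau=0$) and $uD+[u]$ (for $\tau=1$). For $0\le m\le n$ and $1\le x_{m+1}<\dots<x_n\le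 L$, let $|x_{m+1},\dots,x_n\rangle\in(\mathbb C^2)^{\otimes L}$ be $\sqrt{q/p}^{\;\sum_i(x_i-1)}$ times $\langle\langle V_1|\cdots|V_2\rangle\rangle$ applied to the tensor product, ordered from site $1$ to site $L$, of the columns $\omega(v_j)$ at site $x_j$ ($m<j\le n$), $\omega(u_{m+1})$ at the sites before $x_{m+1}$, $\omega(u_{j+1})$ at the sites strictly between $x_j$ and $x_{j+1}$, and $\omega(u_{n+1})$ at the sites after $x_n$ (all sites carry $\omega(u_{n+1})$ if $m=n$). **Amplitudes.** Let $BC_n$ be the group of signed permutations of $\{\pm1,\dots,\pm n\}$, generated by the sign change $r_1$ of $1$ and the transpositions $\sigma_j=(j\ j+1)$; let $BC_m\subset BC_n$ be generated by $r_1,\sigma_1,\dots,\sigma_{m-1}$ ($BC_0=1$), and $G_m$ any full set of representatives of $BC_n/BC_m$. Let $k_1,\dots,k_n\in\mathbb C$ and $k_{-j}=-k_j$. Put $$a(z_1,z_2)=\frac{i}{z_1z_2-1}\Big(\Big(\sqrt{\tfrac qp}+\sqrt{\tfrac pq}\Big)z_2-z_1z_2-1\Big),\qquad S(z_1,z_2)=-\frac{a(z_1,z_2)}{a(z_2,z_1)},$$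 $$V_1^{\pm}(z)=\Lambda(z)+(\lambda_\mp(\alpha,\gamma)+\gamma)\Big(1-\tfrac1z\sqrt{\tfrac pq}\Big)+(\lambda_\mp(\alpha,\gamma)+\alpha)\Big(1-\tfrac1z\sqrt{\tfrac qp}\Big),$$ $$V_L^{\pm}(z)=\Lambda(z)+(\lambda_\mp(\beta,\delta)+\beta)\Big(1-\tfrac1z\sqrt{\tfrac qp}\Big)+(\lambda_\mp(\beta,\delta)+\delta)\Big(1-\tfrac1z\sqrt{\tfrac pq}\Big),$$ $$p_1(z)=z+\frac1{\sqrt{pq}}\frac{pu_2-qv_1}{v_1-u_2},\qquad D_1^{(m-1)}=\frac{v_m}{v_m-u_{m+1}}\Big(\alpha e^sv_m+\gamma-\alpha+p-q-\frac{\gamma}{e^sv_m}\Big),$$ $$T^{(m)}(z_1,\dots,z_m)=\frac{D_1^{(m-1)}}{p_1(z_m)V_1^\epsilon(z_m)}\,\frac{z_m^2-1}{\prod_{j=1}^{m-1}a(z_m,z_j)\,a(z_j,1/z_m)} .$$ Assume that these expressions are non-degenerate at the momenta: if $n\ge1$, then $\delta\neq0$, $v_1\ne0$, $v_1\neq u_2$,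 $D_1^{(0)}\neq0$; for every $z=e^{\pm ik_j}$, $z^2\ne1$ and $p_1(z),V_1^\epsilon(z),V_L^{\epsilon'}(z)\neq0$; for $j\ne l$, $z=e^{\pm ik_j}$, $z'=e^{\pm ik_l}$ (all signs), $zz'\neq1$ and $a(z,z')\neq0$. Let $A_g^{(m)}\in\mathbb C$ ($0\le m\le n$, $g\in BC_n$) depend only on the coset $g\,BC_m$ and satisfy, for all $g\in BC_n$, $$A^{(0)}_{g\sigma_j}=S(e^{ik_{gj}},e^{ik_{g(j+1)}})\,A^{(0)}_g\ \ (1\le j<n),\qquad A^{(m)}_g=T^{(m)}(e^{ik_{g1}},\dots,e^{ik_{gm}})\,A^{(m-1)}_g\ \ (1\le m\le n),$$ and let the $k_j$ satisfy the Bethe equations, for $1\le j\le n$, $$\prod_{\ell\ne j}S(e^{ik_\ell},e^{ik_j})\,S(e^{-ik_j},e^{ik_\ell})=e^{2iLk_j}\,\frac{V_1^\epsilon(e^{ik_j})V_L^{\epsilon'}(e^{ik_j})}{V_1^\epsilon(e^{-ik_j})V_L^{\epsilon'}(e^{-ik_j})} .$$ **Theorem.** The vector $$|\Phi_n\rangle=\sum_{m=0}^n\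 \sum_{1\le x_{m+1}<\dots<x_n\le L}\ \sum_{g\in G_m}A_g^{(m)}\,e^{i(k_{g(m+1)}x_{m+1}+\dots+k_{g(n)}x_n)}\,|x_{m+1},\dots,x_n\rangle$$ satisfies $W^{\epsilon,\epsilon'}_{L-1-n}|\Phi_n\rangle=\mathcal E\,|\Phi_n\rangle$ with $$\mathcal E=\lambda_{-\epsilon}(\alpha,\gamma)+\lambda_{-\epsilon'}(\beta,\delta)+\sum_{j=1}^n\Lambda(e^{ik_j}) ;$$ in particular, if $|\Phi_n\rangle\neq0$, it is an eigenvector of $W^{\epsilon,\epsilon'}_{L-1-n}$ with eigenvalue $\mathcal E$. -/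

import Mathlib

open scoped Matrix

namespace MCBA

noncomputable section

/-! ## The open ASEP matrix -/

/-- The data of the model. `p, q` are the bulk rates, `α, β, γ, δ` the boundary rates, `s` the
current-counting parameter.  `r` is the chosen value of `√(q/p)` and `d` the chosen value of
`√((β-δ+q-p)² + 4βδ)`; that they are square roots is a hypothesis of the theorem. -/
structure Params where
  p : ℂ
  q : ℂ
  α : ℂ
  β : ℂ
  γ : ℂ
  δ : ℂ
  s : ℂ
  r : ℂ
  d : ℂ

/-- Configurations of a lattice of `L` sites: occupation numbers `τ_i ∈ {0,1}`.  The site numbered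
`i` in the text (`1 ≤ i ≤ L`) is the element `i - 1` of `Fin L`. -/
abbrev Conf (L : ℕ) : Type := Fin L → Fin 2

/-- The physical space of dimension `2 ^ L`. -/
abbrev Phys (L : ℕ) : Type := Conf L → ℂ

/-- A `2 × 2` matrix acting on site `i`. -/
def onSite {L : ℕ} (M : Matrix (Fin 2) (Fin 2) ℂ) (i : Fin L) : Matrix (Conf L) (Conf L) ℂ :=
  Matrix.of fun τ τ' => if ∀ l, l ≠ i → τ l = τ' l then M (τ i) (τ' i) else 0

/-- A `4 × 4` matrix acting on the sites `i, j` (basis ordered `00, 01, 10, 11`). -/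
def onBond {L : ℕ} (M : Matrix (Fin 4) (Fin 4) ℂ) (i j : Fin L) : Matrix (Conf L) (Conf L) ℂ :=
  Matrix.of fun τ τ' =>
    if ∀ l, l ≠ i → l ≠ j → τ l = τ' l then
      M (finProdFinEquiv (τ i, τ j)) (finProdFinEquiv (τ' i, τ' j))
    else 0

namespace Params

variable (P : Params)

/-- The bulk matrix `w`. -/
def w : Matrix (Fin 4) (Fin 4) ℂ :=
  !![0, 0, 0, 0; 0, -P.q, P.p, 0; 0, P.q, -P.p, 0; 0, 0, 0, 0]

/-- The left boundary matrix `K̂`. -/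
def Khat : Matrix (Fin 2) (Fin 2) ℂ :=
  !![-P.α, P.γ * Complex.exp (-P.s); P.α * Complex.exp P.s, -P.γ]

/-- The right boundary matrix `K`. -/
def K : Matrix (Fin 2) (Fin 2) ℂ := !![-P.δ, P.β; P.δ, -P.β]

/-- The matrix `W = K̂₁ + K_L + ∑_{j=1}^{L-1} w_{j,j+1}`. -/
def W (L : ℕ) : Matrix (Conf L) (Conf L) ℂ :=
  (∑ i : Fin L, if (i : ℕ) = 0 then onSite P.Khat i else 0)
    + (∑ i : Fin L, if (i : ℕ) + 1 = L then onSite P.K i else 0)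
    + ∑ i : Fin L, ∑ j : Fin L, if (j : ℕ) = i + 1 then onBond P.w i j else 0

end Params

/-- `c_+(x,y) = y/x`, `c_-(x,y) = -1`; the sign `ε` is an element of `ℤˣ = {1,-1}`. -/
def c (ε : ℤˣ) (x y : ℂ) : ℂ := if ε = 1 then y / x else -1

/-- `λ_+(x,y) = 0`, `λ_-(x,y) = -x-y`. -/
def lam (ε : ℤˣ) (x y : ℂ) : ℂ := if ε = 1 then 0 else -x - y

/-! ## Pseudo-excitations -/

namespace Params

variable (P : Params)

/-- `[u] = (1-u)/(q-p)`. -/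
def br (u : ℂ) : ℂ := (1 - u) / (P.q - P.p)

/-- `√(pq)`, in the branch compatible with `r = √(q/p)`. -/
def sqrtpq : ℂ := P.p * P.r

/-- `u_m`: `u_1 = -e^{-s} c_ε(α,γ)` and `u_{m+1} = (q/p) u_m`. -/
def u (ε : ℤˣ) (m : ℕ) : ℂ :=
  (P.q / P.p) ^ ((m : ℤ) - 1) * (-Complex.exp (-P.s) * c ε P.α P.γ)

/-- `v_1 = (p/q)^{n-1} (p-q+δ-β+d) / (2δ)`. -/
def v₁ (n : ℕ) : ℂ :=
  1 / (2 * P.δ) * (P.p / P.q) ^ ((n : ℤ) - 1) * (P.p - P.q + P.δ - P.β + P.d)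

/-- `v_m`: `v_{m+1} = (q/p) v_m`. -/
def v (n m : ℕ) : ℂ := (P.q / P.p) ^ ((m : ℤ) - 1) * P.v₁ n

variable {V : Type*} [AddCommGroup V] [Module ℂ V]

/-- The column `|ω(u)⟩ = (E - [u], uD + [u])` with entries in the endomorphisms of `V`. -/
def omega (E D : Module.End ℂ V) (u : ℂ) : Fin 2 → Module.End ℂ V :=
  ![E - P.br u • 1, u • D + P.br u • 1]

end Params

/-- The labels `m+1, …, n`; a label `i` of the text is the element `i - 1` of `Fin n`. -/
abbrev Lab (n m : ℕ) : Type := {i : Fin n // m ≤ (i : ℕ)}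

namespace Params

variable (P : Params) {V : Type*} [AddCommGroup V] [Module ℂ V]

/-- For positions `x_{m+1} < … < x_n`, the column placed on site `l`: with `h` the label
`m + 1 + #{i | x_i < l}`, it is `|ω(v_h)⟩` if `l` is one of the positions (then `l = x_h`), and
`|ω(u_h)⟩` otherwise. -/
def siteColumn (ε : ℤˣ) {L n m : ℕ} (E D : Module.End ℂ V) (x : Lab n m → Fin L) (l : Fin L) :
    Fin 2 → Module.End ℂ V :=
  open Classical in
  let h : ℕ := m + 1 + (Finset.univ.filter fun i => x i < l).card
  if ∃ i, x i = l then P.omega E D (P.v n h) else P.omega E D (P.u ε h)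

/-- The vector `|x_{m+1}, …, x_n⟩` of the physical space.  Its component on the configuration `τ`
is `√(q/p)^{∑ (x_i - 1)}` times `⟨⟨V₁| X₁ X₂ ⋯ X_L |V₂⟩⟩`, where `X_l` is the entry number `τ_l` of
the column on site `l`. -/
def ket (ε : ℤˣ) {L n m : ℕ} (E D : Module.End ℂ V) (V₁ : Module.Dual ℂ V) (V₂ : V)
    (x : Lab n m → Fin L) : Phys L := fun τ =>
  P.r ^ (∑ i, (x i : ℕ)) *
    V₁ ((List.ofFn fun l : Fin L => P.siteColumn ε E D x l (τ l)).prod V₂)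

end Params

/-! ## The Weyl group -/

/-- The Weyl group `BC_n` of signed permutations: `(1,i)` stands for the letter `i` and `(-1,i)`
for `-i`; the elements are the permutations `g` of the letters with `g(-a) = -g(a)`. -/
def BC (n : ℕ) : Subgroup (Equiv.Perm (ℤˣ × Fin n)) where
  carrier := {g | ∀ a, g (-a.1, a.2) = (-(g a).1, (g a).2)}
  one_mem' := fun _ => rfl
  mul_mem' := by
    intro g h hg hh a
    simp only [Set.mem_ofPred_eq, Equiv.Perm.coe_mul, Function.comp_apply] at *
    rw [hh a]
    exact hg (h a)
  inv_mem' := by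
    intro g hg a
    simp only [Set.mem_ofPred_eq] at *
    rw [Equiv.Perm.inv_eq_iff_eq, hg (g⁻¹ a)]
    simp

/-- The transposition of the letters `i` and `j` (and of `-i` and `-j`); for `j = i + 1` this is
the generator `σ_i`. -/
def transp {n : ℕ} (i j : Fin n) : BC n :=
  ⟨Equiv.prodCongr (Equiv.refl ℤˣ) (Equiv.swap i j), fun _ => rfl⟩

/-- The reflection of the letter `i`, exchanging `i` and `-i`; for the first letter this is the
generator `r_1`. -/
def reflect {n : ℕ} (i : Fin n) : BC n :=
  ⟨Equiv.swap (1, i) (-1, i), by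
    rintro ⟨s, j⟩
    by_cases hj : j = i
    · subst hj
      rcases Int.units_eq_one_or s with rfl | rfl <;> simp
    · rw [Equiv.swap_apply_of_ne_of_ne, Equiv.swap_apply_of_ne_of_ne] <;> simp [hj]⟩

/-- The subgroup `BC_m` of `BC_n`, generated by `r_1, σ_1, …, σ_{m-1}` (trivial for `m = 0`). -/
def BCsub (n m : ℕ) : Subgroup (BC n) :=
  Subgroup.closure
    ({g | ∃ i : Fin n, (i : ℕ) = 0 ∧ (i : ℕ) < m ∧ g = reflect i} ∪
      {g | ∃ i j : Fin n, (j : ℕ) = i + 1 ∧ (j : ℕ) < m ∧ g = transp i j})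

/-- The exponential `e^{i k_a}` of a letter `a`, with `k_{-j} = -k_j`. -/
def ev {n : ℕ} (k : Fin n → ℂ) (a : ℤˣ × Fin n) : ℂ :=
  Complex.exp (Complex.I * (((a.1 : ℤ) : ℂ) * k a.2))

/-- `e^{i k_{g j}}`. -/
def zg {n : ℕ} (k : Fin n → ℂ) (g : BC n) (j : Fin n) : ℂ := ev k (g.1 (1, j))

/-! ## Scattering and boundary functions -/

namespace Params

variable (P : Params)

/-- `Λ(z) = √(pq) (z + 1/z) - p - q`. -/
def Lam (z : ℂ) : ℂ := P.sqrtpq * (z + 1 / z) - P.p - P.q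

/-- `a(z₁,z₂)`. -/
def a (z₁ z₂ : ℂ) : ℂ :=
  Complex.I / (z₁ * z₂ - 1) * ((P.r + 1 / P.r) * z₂ - z₁ * z₂ - 1)

/-- The scattering matrix `S(z₁,z₂)`. -/
def S (z₁ z₂ : ℂ) : ℂ := -(P.a z₁ z₂ / P.a z₂ z₁)

/-- `V_1^ε(z)`. -/
def Vone (ε : ℤˣ) (z : ℂ) : ℂ :=
  P.Lam z + (lam (-ε) P.α P.γ + P.γ) * (1 - 1 / z * (1 / P.r))
    + (lam (-ε) P.α P.γ + P.α) * (1 - 1 / z * P.r)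

/-- `V_L^ε(z)`. -/
def VL (ε : ℤˣ) (z : ℂ) : ℂ :=
  P.Lam z + (lam (-ε) P.β P.δ + P.β) * (1 - 1 / z * P.r)
    + (lam (-ε) P.β P.δ + P.δ) * (1 - 1 / z * (1 / P.r))

/-- `p_1(z)`. -/
def p₁ (ε : ℤˣ) (n : ℕ) (z : ℂ) : ℂ :=
  z + 1 / P.sqrtpq * ((P.p * P.u ε 2 - P.q * P.v n 1) / (P.v n 1 - P.u ε 2))

/-- `D_1^{(m)}`, involving `v_{m+1}` and `u_{m+2}`. -/
def D₁ (ε : ℤˣ) (n m : ℕ) : ℂ :=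
  P.v n (m + 1) / (P.v n (m + 1) - P.u ε (m + 2)) *
    (P.α * Complex.exp P.s * P.v n (m + 1) + P.γ - P.α + P.p - P.q
      - P.γ / (Complex.exp P.s * P.v n (m + 1)))

/-- `T^{(m)}(z_1, …, z_m)`, where `t` is the label `m` (so that `t = m - 1` in `Fin n`); only the
values of `z` at the labels up to `m` are used. -/
def T (ε : ℤˣ) {n : ℕ} (t : Fin n) (z : Fin n → ℂ) : ℂ :=
  P.D₁ ε n t / (P.p₁ ε n (z t) * P.Vone ε (z t)) *
    ((z t ^ 2 - 1) / ∏ j ∈ Finset.Iio t, P.a (z t) (z j) * P.a (z j) (1 / z t))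

/-! ## The Ansatz -/

variable {V : Type*} [AddCommGroup V] [Module ℂ V]

/-- The matrix coordinate Bethe Ansatz vector
`|Φ_n⟩ = ∑_m ∑_{x_{m+1} < … < x_n} ∑_{g ∈ G_m} A_g^{(m)} e^{i k_g · x} |x_{m+1}, …, x_n⟩`. -/
def Phi (ε : ℤˣ) {L n : ℕ} (E D : Module.End ℂ V) (V₁ : Module.Dual ℂ V) (V₂ : V)
    (k : Fin n → ℂ) (G : ℕ → Finset (BC n)) (A : ℕ → BC n → ℂ) : Phys L :=
  open Classical in
  ∑ m ∈ Finset.range (n + 1), ∑ x : Lab n m → Fin L with StrictMono x, ∑ g ∈ G m,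
    (A m g * ∏ i : Lab n m, zg k g i ^ ((x i : ℕ) + 1)) • P.ket ε E D V₁ V₂ x

/-- The eigenvalue. -/
def energy (ε ε' : ℤˣ) {n : ℕ} (k : Fin n → ℂ) : ℂ :=
  lam (-ε) P.α P.γ + lam (-ε') P.β P.δ + ∑ j, P.Lam (Complex.exp (Complex.I * k j))

end Params

end

end MCBA

/-!
The matrix `W` maps the ansatz vectors to each other in a simple way. The columns `ω(u)` and `ω(v)`
are chosen such that on two neighbouring sites the bulk matrix acts as a hop of a pseudo-excitation,
plus terms in which one column is exchanged with an auxiliary column (`Params.bulk_uv` and its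
companions). These last terms telescope along the lattice and are absorbed by the boundary
relations. At the right boundary the columns are stable, because `u_{n+1}` and `v_n` are roots of
the relevant quadratics; at the left boundary the column of an excitation may be turned into the
column of an empty site and conversely. Hence `W` acts on the ansatz vectors, indexed by the set
`X` of occupied sites, as a hopping matrix for `|X| ≤ n` particles with creation and annihilation on
the first site only (`Params.W_mulVec_siteKet`), and the theorem is an eigenvalue equation for the
coefficients (`Params.W_mulVec_sum_siteKet`), which are averages over `BC_n` of plane waves
(`Params.coef`, `Params.Phi_eq`).

On a plane wave, the hopping produces the energy of the excitations in the lattice, up to contact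
terms between neighbours and to terms at the two ends (`Params.sum_hop_planeWave`).
* The contact terms cancel between `g` and `g σ_j`, by the choice of `S` (`Params.sum_contact`).
* The right boundary terms cancel between `g` and the reflection of its last letter
  (`Params.right_cancel`). That reflection is a product of scatterings, of the reflection `r_1` and
  of scatterings again (`Params.amp_reflect`), and its factor is given by the Bethe equations. The
  remaining boundary factor is supplied by a factorization of `V_L` (`Params.mul_VL_eq`).
* The left boundary mixes `A^{(m)}` and `A^{(m+1)}`. Averaging over the `2(m+1)` cosets of `BC_m` in
  `BC_{m+1}`, that is over the letter which crosses the boundary, the recursion by `T` reduces the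
  two equations to identities between rational functions of the momenta (`Params.sum_leftWeight`).
  They are sums over the nodes `z_i, 1/z_i` of a polynomial times `∏ a(z,z_j) a(z_j,1/z)`. After a
  translation, this product is essentially `q(-y) / q'(y)` for the polynomial `q` with the nodes as
  roots, so the sums are evaluated by Lagrange interpolation of `q(-y) - q(y)`
  (`sum_quartic_reflect`, `sum_crossing`, `sum_boundary`).
-/

namespace MCBA

noncomputable section

/-! ### Matrix product vectors and the action of local matrices -/

section TensorCalculus

variable {L : ℕ} {V : Type*} [AddCommGroup V] [Module ℂ V]

theorem onSite_mulVec_apply (M : Matrix (Fin 2) (Fin 2) ℂ) (i : Fin L) (f : Phys L) (τ : Conf L) :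
    (onSite M i *ᵥ f) τ = ∑ b, M (τ i) b * f (Function.update τ i b) := by
  classical
  have hinj : Function.Injective (Function.update τ i) := Function.update_injective τ i
  have : ∀ τ' : Conf L, onSite M i τ τ' * f τ' =
      if τ' ∈ Finset.univ.image (Function.update τ i) then M (τ i) (τ' i) * f τ' else 0 := by
    intro τ'
    have hiff : (∀ l, l ≠ i → τ l = τ' l) ↔ τ' ∈ Finset.univ.image (Function.update τ i) := by
      simp only [Finset.mem_image, Finset.mem_univ, true_and]
      constructor
      · intro h
        refine ⟨τ' i, ?_⟩
        funext l
        by_cases hl : l = i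
        · subst hl; simp
        · simp [hl, h l hl]
      · rintro ⟨b, rfl⟩ l hl
        simp [hl]
    simp only [onSite, Matrix.of_apply, hiff, ite_mul, zero_mul]
  simp only [Matrix.mulVec, dotProduct, this]
  rw [← Finset.sum_filter, Finset.filter_mem_eq_inter, Finset.univ_inter,
    Finset.sum_image (fun _ _ _ _ h => hinj h)]
  simp

theorem onBond_mulVec_apply (M : Matrix (Fin 4) (Fin 4) ℂ) {i j : Fin L} (hij : i ≠ j)
    (f : Phys L) (τ : Conf L) :
    (onBond M i j *ᵥ f) τ = ∑ x : Fin 2 × Fin 2,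
      M (finProdFinEquiv (τ i, τ j)) (finProdFinEquiv x) *
        f (Function.update (Function.update τ i x.1) j x.2) := by
  classical
  let F : Fin 2 × Fin 2 → Conf L := fun x => Function.update (Function.update τ i x.1) j x.2
  have hFi : ∀ x, F x i = x.1 := fun x => by simp [F, hij]
  have hFj : ∀ x, F x j = x.2 := fun x => by simp [F]
  have hinj : Function.Injective F := fun x y h => by
    ext1
    · rw [← hFi x, h, hFi y]
    · rw [← hFj x, h, hFj y]
  have : ∀ τ' : Conf L, onBond M i j τ τ' * f τ' =
      if τ' ∈ Finset.univ.image F then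
        M (finProdFinEquiv (τ i, τ j)) (finProdFinEquiv (τ' i, τ' j)) * f τ' else 0 := by
    intro τ'
    have hiff : (∀ l, l ≠ i → l ≠ j → τ l = τ' l) ↔ τ' ∈ Finset.univ.image F := by
      simp only [Finset.mem_image, Finset.mem_univ, true_and]
      constructor
      · intro h
        refine ⟨(τ' i, τ' j), ?_⟩
        funext l
        by_cases hl : l = j
        · subst hl; simp [F]
        · by_cases hl' : l = i
          · subst hl'; simp [F, hij]
          · simp [F, hl, hl', h l hl' hl]
      · rintro ⟨b, rfl⟩ l hl hl'
        simp [F, hl, hl']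
    simp only [onBond, Matrix.of_apply, hiff, ite_mul, zero_mul]
  simp only [Matrix.mulVec, dotProduct, this]
  rw [← Finset.sum_filter, Finset.filter_mem_eq_inter, Finset.univ_inter,
    Finset.sum_image (fun _ _ _ _ h => hinj h)]
  simp only [hFi, hFj, Prod.mk.eta, F]

theorem ofFn_update {α : Type*} (f : Fin L → α) (i : Fin L) (x : α) :
    List.ofFn (Function.update f i x) = (List.ofFn f).set i x := by
  apply List.ext_getElem
  · simp
  · intro k h1 h2
    simp only [List.getElem_ofFn, List.getElem_set, Function.update_apply, Fin.ext_iff]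
    by_cases h : (i : ℕ) = k
    · simp [h]
    · simp [h, Ne.symm h]

theorem prod_ofFn_update {R : Type*} [Monoid R] (f : Fin L → R) (i : Fin L) (x : R) :
    (List.ofFn (Function.update f i x)).prod =
      ((List.ofFn f).take i).prod * x * ((List.ofFn f).drop (i + 1)).prod := by
  rw [ofFn_update, List.prod_set]
  simp

theorem prod_ofFn_update_update {R : Type*} [Monoid R] (f : Fin L → R) {i j : Fin L}
    (hij : (j : ℕ) = i + 1) (x y : R) :
    (List.ofFn (Function.update (Function.update f i x) j y)).prod =
      ((List.ofFn f).take i).prod * (x * y) * ((List.ofFn f).drop (j + 1)).prod := by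
  rw [prod_ofFn_update, ofFn_update, hij, List.drop_set_of_lt (by omega), List.take_add_one]
  simp [List.take_set_of_le, mul_assoc]

/-- The matrix product vector of a family of columns, contracted with `V₁` and `V₂`. -/
def mpVec (V₁ : Module.Dual ℂ V) (V₂ : V) (c : Fin L → Fin 2 → Module.End ℂ V) : Phys L :=
  fun τ => V₁ ((List.ofFn fun l => c l (τ l)).prod V₂)

variable (V₁ : Module.Dual ℂ V) (V₂ : V) (c : Fin L → Fin 2 → Module.End ℂ V)

theorem mpVec_update_apply (i : Fin L) (d : Fin 2 → Module.End ℂ V) (τ : Conf L) :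
    mpVec V₁ V₂ (Function.update c i d) τ =
      V₁ ((((List.ofFn fun l => c l (τ l)).take i).prod * d (τ i) *
        ((List.ofFn fun l => c l (τ l)).drop (i + 1)).prod) V₂) := by
  rw [← prod_ofFn_update, mpVec]
  congr 4
  funext l
  by_cases h : l = i
  · subst h; simp
  · simp [h]

theorem mpVec_update_update_apply {i j : Fin L} (hij : (j : ℕ) = i + 1)
    (d e : Fin 2 → Module.End ℂ V) (τ : Conf L) :
    mpVec V₁ V₂ (Function.update (Function.update c i d) j e) τ =
      V₁ ((((List.ofFn fun l => c l (τ l)).take i).prod * (d (τ i) * e (τ j)) *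
        ((List.ofFn fun l => c l (τ l)).drop (j + 1)).prod) V₂) := by
  rw [← prod_ofFn_update_update _ hij, mpVec]
  congr 4
  funext l
  by_cases h : l = j
  · subst h; simp
  · by_cases h' : l = i
    · subst h'; simp [h]
    · simp [h, h']

theorem mpVec_apply_update (i : Fin L) (b : Fin 2) (τ : Conf L) :
    mpVec V₁ V₂ c (Function.update τ i b) =
      V₁ ((((List.ofFn fun l => c l (τ l)).take i).prod * c i b *
        ((List.ofFn fun l => c l (τ l)).drop (i + 1)).prod) V₂) := by
  rw [← prod_ofFn_update, mpVec]
  congr 4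
  funext l
  by_cases h : l = i
  · subst h; simp
  · simp [h]

theorem mpVec_apply_update_update {i j : Fin L} (hij : (j : ℕ) = i + 1) (a b : Fin 2)
    (τ : Conf L) :
    mpVec V₁ V₂ c (Function.update (Function.update τ i a) j b) =
      V₁ ((((List.ofFn fun l => c l (τ l)).take i).prod * (c i a * c j b) *
        ((List.ofFn fun l => c l (τ l)).drop (j + 1)).prod) V₂) := by
  rw [← prod_ofFn_update_update _ hij, mpVec]
  congr 4
  funext l
  by_cases h : l = j
  · subst h; simp
  · by_cases h' : l = i
    · subst h'; simp [h]
    · simp [h, h']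

theorem mpVec_update_add (i : Fin L) (d e : Fin 2 → Module.End ℂ V) :
    mpVec V₁ V₂ (Function.update c i (d + e)) =
      mpVec V₁ V₂ (Function.update c i d) + mpVec V₁ V₂ (Function.update c i e) := by
  funext τ
  simp only [Pi.add_apply, mpVec_update_apply, mul_add, add_mul, LinearMap.add_apply, map_add]

theorem mpVec_update_smul (i : Fin L) (k : ℂ) (d : Fin 2 → Module.End ℂ V) :
    mpVec V₁ V₂ (Function.update c i (k • d)) = k • mpVec V₁ V₂ (Function.update c i d) := by
  funext τ
  simp only [Pi.smul_apply, mpVec_update_apply, mul_smul_comm, smul_mul_assoc,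
    LinearMap.smul_apply, map_smul]

theorem onSite_mulVec_mpVec (M : Matrix (Fin 2) (Fin 2) ℂ) (i : Fin L) :
    onSite M i *ᵥ mpVec V₁ V₂ c =
      mpVec V₁ V₂ (Function.update c i fun a => ∑ b, M a b • c i b) := by
  funext τ
  rw [onSite_mulVec_apply, mpVec_update_apply]
  simp only [mpVec_apply_update, Finset.mul_sum, Finset.sum_mul, LinearMap.sum_apply, map_sum,
    mul_smul_comm, smul_mul_assoc, LinearMap.smul_apply, map_smul, smul_eq_mul]

/-- A left boundary operator that agrees under `⟨⟨V₁|` may be exchanged on the first site. -/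
theorem mpVec_update_congr_left {i : Fin L} (hi : (i : ℕ) = 0) (d e : Fin 2 → Module.End ℂ V)
    (h : ∀ a, V₁ ∘ₗ d a = V₁ ∘ₗ e a) :
    mpVec V₁ V₂ (Function.update c i d) = mpVec V₁ V₂ (Function.update c i e) := by
  funext τ
  rw [mpVec_update_apply, mpVec_update_apply, hi]
  simpa using LinearMap.congr_fun (h (τ i)) _

/-- A right boundary operator that agrees on `|V₂⟩⟩` may be exchanged on the last site. -/
theorem mpVec_update_congr_right {i : Fin L} (hi : (i : ℕ) + 1 = L)
    (d e : Fin 2 → Module.End ℂ V) (h : ∀ a, d a V₂ = e a V₂) :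
    mpVec V₁ V₂ (Function.update c i d) = mpVec V₁ V₂ (Function.update c i e) := by
  funext τ
  rw [mpVec_update_apply, mpVec_update_apply, hi, List.drop_of_length_le (by simp)]
  simp [h (τ i)]

/-- A quadratic relation for the columns of two neighbouring sites gives the action of the bond
matrix: a combination of vectors with both columns exchanged, plus two boundary terms. -/
theorem onBond_mulVec_mpVec (M : Matrix (Fin 4) (Fin 4) ℂ) {i j : Fin L}
    (hij : (j : ℕ) = i + 1) (κ : ℂ) (d e g g' : Fin 2 → Module.End ℂ V)
    (h : ∀ a b, ∑ x : Fin 2 × Fin 2, M (finProdFinEquiv (a, b)) (finProdFinEquiv x) •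
        (c i x.1 * c j x.2) =
      κ • (d a * e b) - κ • (c i a * c j b) + c i a * g' b - g a * c j b) :
    onBond M i j *ᵥ mpVec V₁ V₂ c =
      κ • mpVec V₁ V₂ (Function.update (Function.update c i d) j e) - κ • mpVec V₁ V₂ c
        + mpVec V₁ V₂ (Function.update c j g') - mpVec V₁ V₂ (Function.update c i g) := by
  have hne : i ≠ j := by
    rintro rfl
    omega
  have h1 : Function.update c j g' = Function.update (Function.update c i (c i)) j g' := by simp
  have h2 : Function.update c i g = Function.update (Function.update c i g) j (c j) := by
    rw [Function.update_comm hne]; simp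
  have h3 : mpVec V₁ V₂ c = mpVec V₁ V₂ (Function.update (Function.update c i (c i)) j (c j)) := by
    simp
  funext τ
  rw [onBond_mulVec_apply M hne]
  rw [h1, h2]
  simp only [mpVec_apply_update_update V₁ V₂ c hij]
  rw [h3]
  simp only [Pi.add_apply, Pi.sub_apply, Pi.smul_apply, mpVec_update_update_apply V₁ V₂ _ hij]
  have := congrArg (fun X => V₁ ((((List.ofFn fun l => c l (τ l)).take i).prod * X *
        ((List.ofFn fun l => c l (τ l)).drop (j + 1)).prod) V₂)) (h (τ i) (τ j))
  simpa only [Finset.mul_sum, Finset.sum_mul, LinearMap.sum_apply, map_sum,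
    mul_smul_comm, smul_mul_assoc, LinearMap.smul_apply, map_smul, smul_eq_mul, mul_add, add_mul,
    mul_sub, sub_mul, LinearMap.add_apply, LinearMap.sub_apply, map_add, map_sub] using this

end TensorCalculus

/-! ### Quadratic and boundary relations for the columns -/

namespace Params

section LocalRelations

variable {P : Params} {V : Type*} [AddCommGroup V] [Module ℂ V] {E D : Module.End ℂ V}

/-- The auxiliary column associated with `ω(u)`. The bulk matrix acts on two columns as a hop, plus
the exchange of one of them with its auxiliary column, and the latter terms telescope along the
lattice. -/
def gaugeU (V : Type*) [AddCommGroup V] [Module ℂ V] (u : ℂ) : Fin 2 → Module.End ℂ V :=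
  ![u • 1, -1]

/-- The auxiliary column associated with the column `ω(v)` of a pseudo-excitation. -/
def gaugeV (P : Params) (D : Module.End ℂ V) (v : ℂ) : Fin 2 → Module.End ℂ V :=
  ![0, (P.p - P.q) • (v • D + P.br v • 1)]

theorem finProdFinEquiv_two_two :
    finProdFinEquiv ((0, 0) : Fin 2 × Fin 2) = (0 : Fin 4) ∧
    finProdFinEquiv ((0, 1) : Fin 2 × Fin 2) = (1 : Fin 4) ∧
    finProdFinEquiv ((1, 0) : Fin 2 × Fin 2) = (2 : Fin 4) ∧
    finProdFinEquiv ((1, 1) : Fin 2 × Fin 2) = (3 : Fin 4) := by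
  decide

theorem sum_w_smul (P : Params) (c c' : Fin 2 → Module.End ℂ V) (a b : Fin 2) :
    ∑ x : Fin 2 × Fin 2, P.w (finProdFinEquiv (a, b)) (finProdFinEquiv x) • (c x.1 * c' x.2) =
      (![![0, P.p • (c 1 * c' 0) - P.q • (c 0 * c' 1)],
        ![P.q • (c 0 * c' 1) - P.p • (c 1 * c' 0), 0]] : Fin 2 → Fin 2 → Module.End ℂ V) a b := by
  obtain ⟨h0, h1, h2, h3⟩ := finProdFinEquiv_two_two
  rw [Fintype.sum_prod_type]
  simp only [Fin.sum_univ_two, h0, h1, h2, h3]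
  fin_cases a <;> fin_cases b <;>
    simp [h0, h1, h2, h3, w] <;> module

section Bulk

theorem mul_of_bulk (hp : P.p ≠ 0) (hbulk : P.q • (E * D) - P.p • (D * E) = E + D) :
    D * E = P.p⁻¹ • (P.q • (E * D) - E - D) := by
  have : P.p • (D * E) = P.q • (E * D) - E - D := by
    rw [sub_sub, ← hbulk]; abel
  rw [← this, smul_smul, inv_mul_cancel₀ hp, one_smul]

/-- Two empty sites: the bulk matrix only produces auxiliary columns. -/
theorem bulk_uu (hp : P.p ≠ 0) (hpq : P.p ≠ P.q)
    (hbulk : P.q • (E * D) - P.p • (D * E) = E + D) (u : ℂ) (a b : Fin 2) :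
    ∑ x : Fin 2 × Fin 2, P.w (finProdFinEquiv (a, b)) (finProdFinEquiv x) •
        (P.omega E D u x.1 * P.omega E D u x.2) =
      (0 : ℂ) • (P.omega E D u a * P.omega E D u b) - (0 : ℂ) • (P.omega E D u a * P.omega E D u b)
        + P.omega E D u a * gaugeU V u b - gaugeU V u a * P.omega E D u b := by
  have hqp : P.q - P.p ≠ 0 := sub_ne_zero.mpr hpq.symm
  have hDE := mul_of_bulk hp hbulk
  rw [sum_w_smul]
  fin_cases a <;> fin_cases b <;>
    simp [omega, gaugeU, mul_add, add_mul, mul_sub, sub_mul, br, hDE] <;>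
    match_scalars <;> field_simp <;> ring

/-- An excitation on the right hops to the left with rate `p`. The column of the empty site is
then on its right, and its parameter is multiplied by `q / p`. -/
theorem bulk_uv (hp : P.p ≠ 0) (hpq : P.p ≠ P.q)
    (hbulk : P.q • (E * D) - P.p • (D * E) = E + D) (u v : ℂ) (a b : Fin 2) :
    ∑ x : Fin 2 × Fin 2, P.w (finProdFinEquiv (a, b)) (finProdFinEquiv x) •
        (P.omega E D u x.1 * P.omega E D v x.2) =
      P.p • (P.omega E D v a * P.omega E D (P.q / P.p * u) b)
        - P.p • (P.omega E D u a * P.omega E D v b)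
        + P.omega E D u a * gaugeV P D v b - gaugeU V u a * P.omega E D v b := by
  have hqp : P.q - P.p ≠ 0 := sub_ne_zero.mpr hpq.symm
  have hDE := mul_of_bulk hp hbulk
  rw [sum_w_smul]
  fin_cases a <;> fin_cases b <;>
    simp [omega, gaugeU, gaugeV, mul_add, add_mul, mul_sub, sub_mul, br, hDE] <;>
    match_scalars <;> field_simp <;> ring

/-- An excitation on the left hops to the right with rate `q`. -/
theorem bulk_vu (hp : P.p ≠ 0) (hpq : P.p ≠ P.q)
    (hbulk : P.q • (E * D) - P.p • (D * E) = E + D) (u v : ℂ) (a b : Fin 2) :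
    ∑ x : Fin 2 × Fin 2, P.w (finProdFinEquiv (a, b)) (finProdFinEquiv x) •
        (P.omega E D v x.1 * P.omega E D (P.q / P.p * u) x.2) =
      P.q • (P.omega E D u a * P.omega E D v b)
        - P.q • (P.omega E D v a * P.omega E D (P.q / P.p * u) b)
        + P.omega E D v a * gaugeU V (P.q / P.p * u) b
        - gaugeV P D v a * P.omega E D (P.q / P.p * u) b := by
  have hqp : P.q - P.p ≠ 0 := sub_ne_zero.mpr hpq.symm
  have hDE := mul_of_bulk hp hbulk
  rw [sum_w_smul]
  fin_cases a <;> fin_cases b <;>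
    simp [omega, gaugeU, gaugeV, mul_add, add_mul, mul_sub, sub_mul, br, hDE] <;>
    match_scalars <;> field_simp <;> ring

/-- Two neighbouring excitations, whose parameters differ by the factor `q / p`: the bulk matrix
only produces auxiliary columns. -/
theorem bulk_vv (hp : P.p ≠ 0) (hpq : P.p ≠ P.q)
    (hbulk : P.q • (E * D) - P.p • (D * E) = E + D) (v : ℂ) (a b : Fin 2) :
    ∑ x : Fin 2 × Fin 2, P.w (finProdFinEquiv (a, b)) (finProdFinEquiv x) •
        (P.omega E D v x.1 * P.omega E D (P.q / P.p * v) x.2) =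
      (0 : ℂ) • (P.omega E D v a * P.omega E D v b)
        - (0 : ℂ) • (P.omega E D v a * P.omega E D (P.q / P.p * v) b)
        + P.omega E D v a * gaugeV P D (P.q / P.p * v) b
        - gaugeV P D v a * P.omega E D (P.q / P.p * v) b := by
  have hqp : P.q - P.p ≠ 0 := sub_ne_zero.mpr hpq.symm
  have hDE := mul_of_bulk hp hbulk
  rw [sum_w_smul]
  fin_cases a <;> fin_cases b <;>
    simp [omega, gaugeV, mul_add, add_mul, mul_sub, sub_mul, br, hDE] <;>
    match_scalars <;> field_simp <;> ring

end Bulk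

section Boundary

/-- As `u₁` is a root of the left boundary quadratic, the condition on `⟨⟨V₁|` no longer depends on
which root it is. -/
theorem left_relation {V₁ : Module.Dual ℂ V} {A G u₁ : ℂ} (hpq : P.p ≠ P.q) (hu₁ : u₁ ≠ 0)
    (hroot : A * u₁ ^ 2 + (P.γ - P.α) * u₁ - G = 0)
    (hleft : V₁ ∘ₗ (A • (E - P.br u₁ • (1 : Module.End ℂ V))
        - G • (D - P.br (1 / u₁) • (1 : Module.End ℂ V)) + 1) = 0) (x : V) :
    A * V₁ (E x) - G * V₁ (D x) + (1 + (P.α + G - A - P.γ) / (P.q - P.p)) * V₁ x = 0 := by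
  have hqp : P.q - P.p ≠ 0 := sub_ne_zero.mpr hpq.symm
  have h := LinearMap.congr_fun hleft x
  simp only [LinearMap.comp_apply, LinearMap.add_apply, LinearMap.sub_apply, LinearMap.smul_apply,
    map_add, map_sub, map_smul, smul_eq_mul, Module.End.one_apply, LinearMap.zero_apply] at h
  have hb : -(A * P.br u₁) + G * P.br (1 / u₁) = (P.α + G - A - P.γ) / (P.q - P.p) := by
    rw [br, br]
    field_simp
    linear_combination hroot
  linear_combination h - V₁ x * hb

/-- On the left boundary, `ω(u)` is turned into a combination of itself and of any `ω(v)`. -/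
theorem left_u {V₁ : Module.Dual ℂ V} {u v cu cv : ℂ}
    (hrel : ∀ x, P.α * Complex.exp P.s * V₁ (E x) - P.γ * Complex.exp (-P.s) * V₁ (D x)
      + (1 + (P.α + P.γ * Complex.exp (-P.s) - P.α * Complex.exp P.s - P.γ) / (P.q - P.p)) * V₁ x
        = 0)
    (hcv : cv * (v - u) = -(P.α * Complex.exp P.s * u ^ 2 + (P.γ - P.α) * u
      - P.γ * Complex.exp (-P.s)))
    (hcu : cu = P.α * Complex.exp P.s * u - P.α - cv) (a : Fin 2) :
    V₁ ∘ₗ (∑ b, P.Khat a b • P.omega E D u b) =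
      V₁ ∘ₗ (cu • P.omega E D u + cv • P.omega E D v + gaugeU V u) a := by
  ext x
  have h := hrel x
  subst hcu
  fin_cases a
  · simp [Fin.sum_univ_two, Khat, omega, gaugeU, br]
    linear_combination (-u) * h - V₁ x / (P.q - P.p) * hcv
  · simp [Fin.sum_univ_two, Khat, omega, gaugeU, br]
    linear_combination h - (V₁ (D x) - V₁ x / (P.q - P.p)) * hcv

/-- On the left boundary, `ω(v)` is turned into a combination of itself and of any `ω(u)`. The
linear coefficient of the quadratic in `hcu` is shifted by `p - q` because the auxiliary columns of
`ω(u)` and `ω(v)` differ. -/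
theorem left_v {V₁ : Module.Dual ℂ V} {u v cu cv : ℂ} (hpq : P.p ≠ P.q)
    (hrel : ∀ x, P.α * Complex.exp P.s * V₁ (E x) - P.γ * Complex.exp (-P.s) * V₁ (D x)
      + (1 + (P.α + P.γ * Complex.exp (-P.s) - P.α * Complex.exp P.s - P.γ) / (P.q - P.p)) * V₁ x
        = 0)
    (hcu : cu * (v - u) = P.α * Complex.exp P.s * v ^ 2 + (P.γ - P.α + P.p - P.q) * v
      - P.γ * Complex.exp (-P.s))
    (hcv : cv = P.α * Complex.exp P.s * v - P.α - cu) (a : Fin 2) :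
    V₁ ∘ₗ (∑ b, P.Khat a b • P.omega E D v b) =
      V₁ ∘ₗ (cv • P.omega E D v + cu • P.omega E D u + gaugeV P D v) a := by
  have hqp : P.q - P.p ≠ 0 := sub_ne_zero.mpr hpq.symm
  ext x
  have h := hrel x
  subst hcv
  have hi : (P.q - P.p) * (P.q - P.p)⁻¹ = 1 := mul_inv_cancel₀ hqp
  fin_cases a
  · simp [Fin.sum_univ_two, Khat, omega, gaugeV, br]
    linear_combination (-v) * h + V₁ x / (P.q - P.p) * hcu - v * V₁ x * hi
  · simp [Fin.sum_univ_two, Khat, omega, gaugeV, br]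
    linear_combination h + (V₁ (D x) - V₁ x / (P.q - P.p)) * hcu + V₁ x * hi

/-- The column `ω(u)` is stable on the right boundary if `u` is a root of the boundary quadratic. -/
theorem right_u {V₂ : V} {u : ℂ} (hright : (P.β • D - P.δ • E + 1) V₂ = 0)
    (hroot : (1 - u) * (P.β + P.δ * u) = 0) (a : Fin 2) :
    (∑ b, P.K a b • P.omega E D u b) V₂ =
      ((P.δ * (u - 1)) • P.omega E D u - gaugeU V u) a V₂ := by
  simp only [LinearMap.add_apply, LinearMap.sub_apply, LinearMap.smul_apply,
    Module.End.one_apply] at hright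
  fin_cases a
  · simp [Fin.sum_univ_two, K, omega, gaugeU, br]
    linear_combination (norm := module) u • hright + (hroot * (P.q - P.p)⁻¹) • (V₂ : V)
  · simp [Fin.sum_univ_two, K, omega, gaugeU, br]
    linear_combination (norm := module) (-1 : ℂ) • hright + hroot • (D V₂) -
      (hroot * (P.q - P.p)⁻¹) • (V₂ : V)

/-- The column `ω(v)` of an excitation is stable on the right boundary only if `v` is one of the
two roots in the definition of `v₁`. -/
theorem right_v {V₂ : V} {v : ℂ} (hpq : P.p ≠ P.q) (hright : (P.β • D - P.δ • E + 1) V₂ = 0)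
    (hroot : P.δ * v ^ 2 + (P.β - P.δ + P.q - P.p) * v - P.β = 0) (a : Fin 2) :
    (∑ b, P.K a b • P.omega E D v b) V₂ =
      ((P.δ * (v - 1)) • P.omega E D v - gaugeV P D v) a V₂ := by
  simp only [LinearMap.add_apply, LinearMap.sub_apply, LinearMap.smul_apply,
    Module.End.one_apply] at hright
  have hqp : P.q - P.p ≠ 0 := sub_ne_zero.mpr hpq.symm
  have hi : (P.q - P.p) * (P.q - P.p)⁻¹ = 1 := mul_inv_cancel₀ hqp
  fin_cases a
  · simp [Fin.sum_univ_two, K, omega, gaugeV, br]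
    linear_combination (norm := module) v • hright - (hroot * (P.q - P.p)⁻¹) • (V₂ : V)
      + (v * hi) • V₂
  · simp [Fin.sum_univ_two, K, omega, gaugeV, br]
    linear_combination (norm := module) (-1 : ℂ) • hright - hroot • (D V₂) +
      (hroot * (P.q - P.p)⁻¹) • (V₂ : V) - hi • V₂

end Boundary

end LocalRelations

end Params

/-! ### Occupied sets, hops and labels -/

section Sites

variable {L : ℕ}

/-- The label, counted from `0`, carried by the site `l` when the pseudo-excitations occupy the
set `X`: the excitations in `X` have the labels `n - |X|, …, n - 1` from left to right, and an
empty site has the label of the next excitation on its right. -/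
def lab (n : ℕ) (X : Finset (Fin L)) (l : Fin L) : ℕ :=
  n - X.card + (X.filter (· < l)).card

/-- Exchange of the occupations of two sites. -/
def hop (i j : Fin L) (X : Finset (Fin L)) : Finset (Fin L) :=
  X.map (Equiv.swap i j).toEmbedding

/-- Change of the occupation of one site, by creation or annihilation of an excitation. -/
def flip (i : Fin L) (X : Finset (Fin L)) : Finset (Fin L) :=
  if i ∈ X then X.erase i else insert i X

theorem mem_hop {i j l : Fin L} {X : Finset (Fin L)} :
    l ∈ hop i j X ↔ Equiv.swap i j l ∈ X := by
  simp [hop, Finset.mem_map_equiv]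

theorem card_hop (i j : Fin L) (X : Finset (Fin L)) : (hop i j X).card = X.card := by
  simp [hop]

theorem hop_hop (i j : Fin L) (X : Finset (Fin L)) : hop i j (hop i j X) = X := by
  ext l
  simp [mem_hop]

theorem flip_flip (i : Fin L) (X : Finset (Fin L)) : flip i (flip i X) = X := by
  unfold flip
  split_ifs with h h' h'
  · simp at h'
  · simp [h]
  · simp [h]
  · simp at h'

theorem mem_flip_self {i : Fin L} {X : Finset (Fin L)} : i ∈ flip i X ↔ i ∉ X := by
  unfold flip
  split_ifs with h <;> simp [h]

theorem mem_flip_of_ne {i l : Fin L} {X : Finset (Fin L)} (h : l ≠ i) : l ∈ flip i X ↔ l ∈ X := by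
  unfold flip
  split_ifs <;> simp [h]

theorem lab_succ (n : ℕ) (X : Finset (Fin L)) {i j : Fin L} (hij : (j : ℕ) = i + 1) :
    lab n X j = lab n X i + if i ∈ X then 1 else 0 := by
  unfold lab
  rw [add_assoc]
  congr 1
  split_ifs with h
  · rw [← Finset.card_insert_of_notMem (s := X.filter (· < i)) (a := i) (by simp)]
    congr 1
    ext l
    simp only [Finset.mem_filter, Finset.mem_insert, Fin.lt_def, Fin.ext_iff]
    constructor
    · rintro ⟨h1, h2⟩
      by_cases h3 : (l : ℕ) = i
      · exact Or.inl h3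
      · exact Or.inr ⟨h1, by omega⟩
    · rintro (h1 | ⟨h1, h2⟩)
      · exact ⟨by rwa [Fin.ext h1], by omega⟩
      · exact ⟨h1, by omega⟩
  · rw [add_zero]
    congr 1
    ext l
    simp only [Finset.mem_filter, Fin.lt_def]
    constructor
    · rintro ⟨h1, h2⟩
      refine ⟨h1, ?_⟩
      have : (l : ℕ) ≠ i := fun h3 => h (by rwa [← Fin.ext h3])
      omega
    · rintro ⟨h1, h2⟩
      exact ⟨h1, by omega⟩

/-- A hop across the bond `i, j` moves one excitation without changing its label, and changes the
label of no site but `j`. -/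
theorem lab_hop (n : ℕ) (X : Finset (Fin L)) {i j l : Fin L} (hij : (j : ℕ) = i + 1)
    (hl : l ≠ j) : lab n (hop i j X) l = lab n X l := by
  unfold lab
  rw [card_hop, hop, Finset.filter_map, Finset.card_map]
  congr 2
  ext x
  simp only [Finset.mem_filter, Function.comp_apply, Equiv.coe_toEmbedding]
  refine and_congr_right fun _ => ?_
  have hl' : (l : ℕ) ≠ j := fun h => hl (Fin.ext h)
  rw [Equiv.swap_apply_def]
  split_ifs with h1 h2
  · subst h1
    simp only [Fin.lt_def]; omega
  · subst h2
    simp only [Fin.lt_def]; omega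
  · rfl

theorem lab_of_val_eq_zero (n : ℕ) (X : Finset (Fin L)) {i : Fin L} (hi : (i : ℕ) = 0) :
    lab n X i = n - X.card := by
  unfold lab
  rw [Finset.filter_false_of_mem (by intro x _; simp [Fin.lt_def, hi])]
  simp

theorem lab_of_last {n : ℕ} {X : Finset (Fin L)} (hX : X.card ≤ n) {i : Fin L}
    (hi : (i : ℕ) + 1 = L) : lab n X i = if i ∈ X then n - 1 else n := by
  unfold lab
  split_ifs with h
  · have : X.filter (· < i) = X.erase i := by
      ext x
      simp only [Finset.mem_filter, Finset.mem_erase, Fin.lt_def, Fin.ext_iff, ne_eq]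
      constructor
      · rintro ⟨h1, h2⟩; exact ⟨by omega, h1⟩
      · rintro ⟨h1, h2⟩; exact ⟨h2, by have := x.2; omega⟩
    rw [this, Finset.card_erase_of_mem h]
    have := Finset.card_pos.mpr ⟨i, h⟩
    omega
  · have : X.filter (· < i) = X := by
      ext x
      simp only [Finset.mem_filter, Fin.lt_def, and_iff_left_iff_imp]
      intro hx
      have h2 : (x : ℕ) ≠ i := fun h3 => h (by rwa [← Fin.ext h3])
      have := x.2
      omega
    rw [this]
    omega

theorem card_flip_of_mem {i : Fin L} {X : Finset (Fin L)} (h : i ∈ X) :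
    (flip i X).card + 1 = X.card := by
  rw [flip, if_pos h, Finset.card_erase_add_one h]

theorem card_flip_of_notMem {i : Fin L} {X : Finset (Fin L)} (h : i ∉ X) :
    (flip i X).card = X.card + 1 := by
  rw [flip, if_neg h, Finset.card_insert_of_notMem h]

theorem lab_flip {n : ℕ} {X : Finset (Fin L)} (hX : X.card ≤ n) {i l : Fin L}
    (hX' : (flip i X).card ≤ n) (hi : (i : ℕ) = 0) (hl : l ≠ i) :
    lab n (flip i X) l = lab n X l := by
  have hil : i < l := by
    have : (l : ℕ) ≠ i := fun h => hl (Fin.ext h)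
    rw [Fin.lt_def]; omega
  unfold lab
  by_cases h : i ∈ X
  · have h1 := card_flip_of_mem h
    have h2 : (flip i X).filter (· < l) = (X.filter (· < l)).erase i := by
      rw [flip, if_pos h, Finset.filter_erase]
    have h3 := Finset.card_erase_add_one (s := X.filter (· < l)) (a := i) (by simp [h, hil])
    rw [h2]
    omega
  · have h1 := card_flip_of_notMem h
    have h2 : (flip i X).filter (· < l) = insert i (X.filter (· < l)) := by
      rw [flip, if_neg h, Finset.filter_insert, if_pos hil]
    have h3 := Finset.card_insert_of_notMem (s := X.filter (· < l)) (a := i) (by simp [h])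
    rw [h2]
    omega

theorem lab_lt {n : ℕ} {X : Finset (Fin L)} (hX : X.card ≤ n) {l : Fin L} (hl : l ∈ X) :
    lab n X l < n := by
  unfold lab
  have : X.filter (· < l) ⊂ X := Finset.filter_ssubset.mpr ⟨l, hl, lt_irrefl l⟩
  have := Finset.card_lt_card this
  omega

theorem le_lab (n : ℕ) (X : Finset (Fin L)) (l : Fin L) : n - X.card ≤ lab n X l :=
  Nat.le_add_right _ _

theorem lab_strictMonoOn (n : ℕ) (X : Finset (Fin L)) : StrictMonoOn (lab n X) X := by
  intro x hx y _ hxy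
  refine Nat.add_lt_add_left (Finset.card_lt_card ?_) _
  refine Finset.ssubset_iff_of_subset ?_ |>.mpr ⟨x, ?_, by simp⟩
  · intro z hz
    simp only [Finset.mem_filter] at hz ⊢
    exact ⟨hz.1, hz.2.trans hxy⟩
  · simpa [hxy] using hx

end Sites

namespace Params

/-! ### The action of the ASEP matrix on the ansatz vectors -/

section Action

variable (P : Params) {L : ℕ} {V : Type*} [AddCommGroup V] [Module ℂ V]

theorem u_succ_succ (hp : P.p ≠ 0) (hq : P.q ≠ 0) (ε : ℤˣ) (m : ℕ) :
    P.u ε (m + 1 + 1) = P.q / P.p * P.u ε (m + 1) := by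
  have h : P.q / P.p ≠ 0 := div_ne_zero hq hp
  rw [u, u, ← mul_assoc (P.q / P.p), ← zpow_one_add₀ h]
  congr 2
  push_cast
  ring

theorem v_succ_succ (hp : P.p ≠ 0) (hq : P.q ≠ 0) (n m : ℕ) :
    P.v n (m + 1 + 1) = P.q / P.p * P.v n (m + 1) := by
  have h : P.q / P.p ≠ 0 := div_ne_zero hq hp
  rw [v, v, ← mul_assoc, ← zpow_one_add₀ h]
  congr 2
  push_cast
  ring

/-- The columns of the ansatz vector whose pseudo-excitations occupy the set `X`. -/
def col (ε : ℤˣ) (n : ℕ) (E D : Module.End ℂ V) (X : Finset (Fin L)) (l : Fin L) :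
    Fin 2 → Module.End ℂ V :=
  if l ∈ X then P.omega E D (P.v n (lab n X l + 1)) else P.omega E D (P.u ε (lab n X l + 1))

/-- The auxiliary columns that make the bond relations telescope. -/
def gauge (ε : ℤˣ) (n : ℕ) (D : Module.End ℂ V) (X : Finset (Fin L)) (l : Fin L) :
    Fin 2 → Module.End ℂ V :=
  if l ∈ X then gaugeV P D (P.v n (lab n X l + 1)) else gaugeU V (P.u ε (lab n X l + 1))

/-- The ansatz vector, without its power of `√(q/p)`, whose pseudo-excitations occupy `X`. -/
def siteKet (ε : ℤˣ) (n : ℕ) (E D : Module.End ℂ V) (V₁ : Module.Dual ℂ V) (V₂ : V)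
    (X : Finset (Fin L)) : Phys L :=
  mpVec V₁ V₂ (P.col ε n E D X)

/-- The rate at which the bond `i, j` exchanges its occupations. -/
def hopRate (i j : Fin L) (X : Finset (Fin L)) : ℂ :=
  if i ∈ X then (if j ∈ X then 0 else P.q) else (if j ∈ X then P.p else 0)

variable {E D : Module.End ℂ V} (V₁ : Module.Dual ℂ V) (V₂ : V)

theorem onBond_mulVec_siteKet (ε : ℤˣ) (n : ℕ) (hp : P.p ≠ 0) (hq : P.q ≠ 0) (hpq : P.p ≠ P.q)
    (hbulk : P.q • (E * D) - P.p • (D * E) = E + D) (X : Finset (Fin L)) {i j : Fin L}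
    (hij : (j : ℕ) = i + 1) :
    onBond P.w i j *ᵥ P.siteKet ε n E D V₁ V₂ X =
      P.hopRate i j X • P.siteKet ε n E D V₁ V₂ (hop i j X)
        - P.hopRate i j X • P.siteKet ε n E D V₁ V₂ X
        + mpVec V₁ V₂ (Function.update (P.col ε n E D X) j (P.gauge ε n D X j))
        - mpVec V₁ V₂ (Function.update (P.col ε n E D X) i (P.gauge ε n D X i)) := by
  have hne : i ≠ j := by
    rintro rfl
    omega
  have hcol : P.col ε n E D (hop i j X) =
      Function.update (Function.update (P.col ε n E D X) i (P.col ε n E D (hop i j X) i)) j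
        (P.col ε n E D (hop i j X) j) := by
    funext l
    by_cases hl : l = j
    · subst hl; simp
    · by_cases hl' : l = i
      · subst hl'; simp [hl]
      · have h1 : l ∈ hop i j X ↔ l ∈ X := by
          rw [mem_hop, Equiv.swap_apply_of_ne_of_ne hl' hl]
        simp only [Function.update_of_ne hl, Function.update_of_ne hl', col, h1,
          lab_hop n X hij hl]
  have hlabj := lab_succ n X hij
  have hlabj' := lab_succ n (hop i j X) hij
  have hlabi : lab n (hop i j X) i = lab n X i := lab_hop n X hij hne
  have hmi : i ∈ hop i j X ↔ j ∈ X := by rw [mem_hop, Equiv.swap_apply_left]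
  have hmj : j ∈ hop i j X ↔ i ∈ X := by rw [mem_hop, Equiv.swap_apply_right]
  rw [hlabi] at hlabj'
  by_cases hi : i ∈ X <;> by_cases hj : j ∈ X
  · have hr : P.hopRate i j X = 0 := by simp [hopRate, hi, hj]
    have := onBond_mulVec_mpVec V₁ V₂ (P.col ε n E D X) P.w hij 0
      (P.omega E D (P.v n (lab n X i + 1))) (P.omega E D (P.v n (lab n X i + 1)))
      (P.gauge ε n D X i) (P.gauge ε n D X j) (by
        intro a b
        simp only [col, gauge, hi, hj, if_true, hlabj, v_succ_succ P hp hq]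
        exact bulk_vv hp hpq hbulk _ a b)
    rw [siteKet, this, hr]
    simp
  · have hr : P.hopRate i j X = P.q := by simp [hopRate, hi, hj]
    have := onBond_mulVec_mpVec V₁ V₂ (P.col ε n E D X) P.w hij P.q
      (P.col ε n E D (hop i j X) i) (P.col ε n E D (hop i j X) j)
      (P.gauge ε n D X i) (P.gauge ε n D X j) (by
        intro a b
        simp only [col, gauge, hi, hj, hmi, hmj, if_true, if_false, hlabj, hlabj', hlabi,
          u_succ_succ P hp hq, add_zero]
        exact bulk_vu hp hpq hbulk _ _ a b)
    rw [siteKet, this, hr, siteKet, ← hcol]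
  · have hr : P.hopRate i j X = P.p := by simp [hopRate, hi, hj]
    have := onBond_mulVec_mpVec V₁ V₂ (P.col ε n E D X) P.w hij P.p
      (P.col ε n E D (hop i j X) i) (P.col ε n E D (hop i j X) j)
      (P.gauge ε n D X i) (P.gauge ε n D X j) (by
        intro a b
        simp only [col, gauge, hi, hj, hmi, hmj, if_true, if_false, hlabj, hlabj', hlabi,
          u_succ_succ P hp hq, add_zero]
        exact bulk_uv hp hpq hbulk _ _ a b)
    rw [siteKet, this, hr, siteKet, ← hcol]
  · have hr : P.hopRate i j X = 0 := by simp [hopRate, hi, hj]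
    have := onBond_mulVec_mpVec V₁ V₂ (P.col ε n E D X) P.w hij 0
      (P.omega E D (P.u ε (lab n X i + 1))) (P.omega E D (P.u ε (lab n X i + 1)))
      (P.gauge ε n D X i) (P.gauge ε n D X j) (by
        intro a b
        simp only [col, gauge, hi, hj, if_false, hlabj, add_zero]
        exact bulk_uu hp hpq hbulk _ a b)
    rw [siteKet, this, hr]
    simp

/-- The bond terms that are not hops cancel, except at the two ends of the lattice. -/
theorem sum_bond_telescope {M : Type*} [AddCommGroup M] (f : Fin L → M) :
    ∑ i : Fin L, ∑ j : Fin L, (if (j : ℕ) = i + 1 then f j - f i else 0) =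
      (∑ i : Fin L, if (i : ℕ) + 1 = L then f i else 0)
        - ∑ i : Fin L, if (i : ℕ) = 0 then f i else 0 := by
  have h1 : ∑ i : Fin L, ∑ j : Fin L, (if (j : ℕ) = i + 1 then f j else 0) =
      ∑ j : Fin L, (f j - if (j : ℕ) = 0 then f j else 0) := by
    rw [Finset.sum_comm]
    refine Finset.sum_congr rfl fun j _ => ?_
    by_cases hj : (j : ℕ) = 0
    · rw [if_pos hj, sub_self]
      exact Finset.sum_eq_zero fun i _ => if_neg (by omega)
    · rw [if_neg hj, sub_zero, Finset.sum_eq_single ⟨j - 1, by omega⟩]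
      · rw [if_pos (by simp; omega)]
      · intro i _ hi
        exact if_neg fun h => hi (Fin.ext (by simp; omega))
      · simp
  have h2 : ∑ i : Fin L, ∑ j : Fin L, (if (j : ℕ) = i + 1 then f i else 0) =
      ∑ i : Fin L, (f i - if (i : ℕ) + 1 = L then f i else 0) := by
    refine Finset.sum_congr rfl fun i _ => ?_
    by_cases hi : (i : ℕ) + 1 = L
    · rw [if_pos hi, sub_self]
      exact Finset.sum_eq_zero fun j _ => if_neg (by omega)
    · rw [if_neg hi, sub_zero, Finset.sum_eq_single ⟨i + 1, by omega⟩]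
      · rw [if_pos rfl]
      · intro j _ hj
        exact if_neg fun h => hj (Fin.ext h)
      · simp
  have h3 : ∀ i j : Fin L, (if (j : ℕ) = i + 1 then f j - f i else 0) =
      (if (j : ℕ) = i + 1 then f j else 0) - (if (j : ℕ) = i + 1 then f i else 0) := by
    intro i j
    split_ifs <;> simp
  simp only [h3, Finset.sum_sub_distrib, h1, h2]
  abel

end Action

end Params

namespace Params

/-! ### Creation and annihilation on the first site -/

section BoundaryAction

variable (P : Params) {L : ℕ} {V : Type*} [AddCommGroup V] [Module ℂ V]

theorem u_succ (hp : P.p ≠ 0) (hq : P.q ≠ 0) (ε : ℤˣ) (m : ℕ) :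
    P.u ε (m + 1) = (P.q / P.p) ^ m * P.u ε 1 := by
  induction m with
  | zero => simp
  | succ m ih => rw [u_succ_succ P hp hq, ih, pow_succ]; ring

theorem v_succ (hp : P.p ≠ 0) (hq : P.q ≠ 0) (n m : ℕ) :
    P.v n (m + 1) = (P.q / P.p) ^ m * P.v n 1 := by
  induction m with
  | zero => simp
  | succ m ih => rw [v_succ_succ P hp hq, ih, pow_succ]; ring

theorem v_ne_u (hp : P.p ≠ 0) (hq : P.q ≠ 0) {ε : ℤˣ} {n : ℕ} (h : P.v n 1 ≠ P.u ε 2) (m : ℕ) :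
    P.v n (m + 1) ≠ P.u ε (m + 1 + 1) := by
  rw [P.v_succ hp hq, P.u_succ hp hq, pow_succ, mul_assoc]
  intro h'
  apply h
  rw [mul_left_cancel₀ (pow_ne_zero m (div_ne_zero hq hp)) h', P.u_succ hp hq ε 1, pow_one]

theorem v_ne_zero (hp : P.p ≠ 0) (hq : P.q ≠ 0) {n : ℕ} (h : P.v n 1 ≠ 0) (m : ℕ) :
    P.v n (m + 1) ≠ 0 := by
  rw [P.v_succ hp hq]
  exact mul_ne_zero (pow_ne_zero m (div_ne_zero hq hp)) h

/-- The amplitude with which the left boundary lets a pseudo-excitation enter on an empty first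
site, when `m` excitations are outside the lattice. It is set to `0` for `m = 0`,
where no excitation is left to enter. -/
def entry (ε : ℤˣ) (n m : ℕ) : ℂ :=
  if m = 0 then 0 else
    -(P.α * Complex.exp P.s * P.u ε (m + 1) ^ 2 + (P.γ - P.α) * P.u ε (m + 1)
      - P.γ * Complex.exp (-P.s)) / (P.v n m - P.u ε (m + 1))

/-- The diagonal coefficient of the left boundary for an empty first site. -/
def leftEmpty (ε : ℤˣ) (n m : ℕ) : ℂ :=
  P.α * Complex.exp P.s * P.u ε (m + 1) - P.α - P.entry ε n m

/-- The diagonal coefficient of the left boundary for an occupied first site. -/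
def leftFull (ε : ℤˣ) (n m : ℕ) : ℂ :=
  P.α * Complex.exp P.s * P.v n (m + 1) - P.α - P.D₁ ε n m

/-- The diagonal coefficient of the left boundary. -/
def leftDiag (ε : ℤˣ) (n : ℕ) (i : Fin L) (X : Finset (Fin L)) : ℂ :=
  if i ∈ X then P.leftFull ε n (n - X.card) else P.leftEmpty ε n (n - X.card)

/-- The amplitude with which the left boundary changes the occupation of the first site. -/
def flipRate (ε : ℤˣ) (n : ℕ) (i : Fin L) (X : Finset (Fin L)) : ℂ :=
  if i ∈ X then P.D₁ ε n (n - X.card) else P.entry ε n (n - X.card)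

/-- The diagonal coefficient of the right boundary. -/
def rightDiag (ε : ℤˣ) (n : ℕ) (i : Fin L) (X : Finset (Fin L)) : ℂ :=
  if i ∈ X then P.δ * (P.v n n - 1) else P.δ * (P.u ε (n + 1) - 1)

theorem u_one (ε : ℤˣ) : P.u ε 1 = -(Complex.exp (-P.s) * c ε P.α P.γ) := by
  simp [u]

/-- `u₁` is a root of the left boundary quadratic, so that the formula for `entry` gives `0` for
`m = 0` too. -/
theorem u_one_root {ε : ℤˣ} (hα : ε = 1 → P.α ≠ 0) :
    P.α * Complex.exp P.s * P.u ε 1 ^ 2 + (P.γ - P.α) * P.u ε 1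
      - P.γ * Complex.exp (-P.s) = 0 := by
  have he : Complex.exp P.s * Complex.exp (-P.s) = 1 := by rw [← Complex.exp_add]; simp
  rw [u_one, c]
  split_ifs with h
  · have := hα h
    field_simp
    linear_combination Complex.exp (-P.s) * P.γ ^ 2 * he
  · linear_combination P.α * Complex.exp (-P.s) * he

variable {P}
variable {E D : Module.End ℂ V} {V₁ : Module.Dual ℂ V} {V₂ : V}

theorem leftBoundary_siteKet {ε : ℤˣ} {n : ℕ} (hp : P.p ≠ 0) (hq : P.q ≠ 0) (hpq : P.p ≠ P.q)
    (hα : ε = 1 → P.α ≠ 0) (hu : P.u ε 1 ≠ 0)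
    (hleft : V₁ ∘ₗ ((P.α * Complex.exp P.s) • (E - P.br (P.u ε 1) • (1 : Module.End ℂ V))
        - (P.γ * Complex.exp (-P.s)) • (D - P.br (1 / P.u ε 1) • (1 : Module.End ℂ V)) + 1) = 0)
    (hv : 0 < n → P.v n 1 ≠ 0 ∧ P.v n 1 ≠ P.u ε 2)
    {X : Finset (Fin L)} (hX : X.card ≤ n) {i : Fin L} (hi : (i : ℕ) = 0) :
    onSite P.Khat i *ᵥ P.siteKet ε n E D V₁ V₂ X
        - mpVec V₁ V₂ (Function.update (P.col ε n E D X) i (P.gauge ε n D X i)) =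
      P.leftDiag ε n i X • P.siteKet ε n E D V₁ V₂ X
        + P.flipRate ε n i X • P.siteKet ε n E D V₁ V₂ (flip i X) := by
  have hroot := P.u_one_root hα
  have hrel := left_relation hpq hu hroot hleft
  have hflip : (flip i X).card ≤ n → P.siteKet ε n E D V₁ V₂ (flip i X) =
      mpVec V₁ V₂ (Function.update (P.col ε n E D X) i (P.col ε n E D (flip i X) i)) := by
    intro hX'
    rw [siteKet]
    congr 1
    funext l
    by_cases hl : l = i
    · subst hl; simp
    · simp only [Function.update_of_ne hl, col, mem_flip_of_ne hl, lab_flip hX hX' hi hl]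
  have hself : P.siteKet ε n E D V₁ V₂ X =
      mpVec V₁ V₂ (Function.update (P.col ε n E D X) i (P.col ε n E D X i)) := by
    rw [siteKet, Function.update_eq_self]
  have hlab := lab_of_val_eq_zero n X hi
  have hlab' := lab_of_val_eq_zero n (flip i X) hi
  have hmem : i ∈ flip i X ↔ i ∉ X := mem_flip_self
  rw [sub_eq_iff_eq_add]
  conv_lhs => rw [siteKet, onSite_mulVec_mpVec]
  by_cases h : i ∈ X
  · have hc := card_flip_of_mem h
    have hn : 0 < n := by omega
    obtain ⟨hv0, hvu⟩ := hv hn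
    rw [hflip (by omega), hself]
    simp only [leftDiag, flipRate, h, if_true, ← mpVec_update_smul, ← mpVec_update_add]
    refine mpVec_update_congr_left _ _ _ hi _ _ fun a => ?_
    have e1 : n - (flip i X).card = n - X.card + 1 := by omega
    simp only [col, gauge, h, hmem, not_true, if_true, if_false, hlab, hlab', e1]
    refine left_v hpq hrel ?_ rfl a
    have h1 := P.v_ne_zero hp hq hv0 (n - X.card)
    have h2 := sub_ne_zero.mpr (P.v_ne_u hp hq hvu (n - X.card))
    have he : Complex.exp P.s * Complex.exp (-P.s) = 1 := by rw [← Complex.exp_add]; simp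
    have he' : P.γ / Complex.exp P.s = P.γ * Complex.exp (-P.s) := by
      rw [Complex.exp_neg, div_eq_mul_inv]
    rw [D₁, ← div_div, he']
    field_simp
    ring
  · have hc := card_flip_of_notMem h
    have hcu : leftEmpty P ε n (n - X.card) =
        P.α * Complex.exp P.s * P.u ε (n - X.card + 1) - P.α - P.entry ε n (n - X.card) := rfl
    by_cases hm : n - X.card = 0
    · have he : P.entry ε n (n - X.card) = 0 := by simp [entry, hm]
      rw [hself]
      simp only [leftDiag, flipRate, h, if_false, he, zero_smul, add_zero]
      rw [← mpVec_update_smul, ← mpVec_update_add]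
      refine mpVec_update_congr_left _ _ _ hi _ _ fun a => ?_
      -- With `m = 0` the coefficient of `ω(v)` vanishes for every `v`, here `u₁ + 1`.
      have := left_u (v := P.u ε 1 + 1) (cv := 0) (u := P.u ε 1) hrel
        (by rw [hroot]; ring) rfl a
      rw [zero_smul, add_zero] at this
      simp only [col, gauge, h, if_false, hlab, hm, leftEmpty, zero_add]
      rw [this]
      simp [entry]
    · have hn : 0 < n := by omega
      obtain ⟨hv0, hvu⟩ := hv hn
      rw [hflip (by omega), hself]
      simp only [leftDiag, flipRate, h, if_false, ← mpVec_update_smul, ← mpVec_update_add]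
      refine mpVec_update_congr_left _ _ _ hi _ _ fun a => ?_
      have e1 : n - (flip i X).card + 1 = n - X.card := by omega
      simp only [col, gauge, h, hmem, not_false_eq_true, if_true, if_false, hlab, hlab', e1]
      refine left_u hrel ?_ rfl a
      obtain ⟨m, hm'⟩ := Nat.exists_eq_succ_of_ne_zero hm
      have h2 := sub_ne_zero.mpr (P.v_ne_u hp hq hvu m)
      rw [entry, if_neg hm, hm', Nat.succ_eq_add_one]
      field_simp

theorem rightBoundary_siteKet {ε : ℤˣ} {n : ℕ} (hpq : P.p ≠ P.q)
    (hright : (P.β • D - P.δ • E + 1) V₂ = 0)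
    (hu : (1 - P.u ε (n + 1)) * (P.β + P.δ * P.u ε (n + 1)) = 0)
    (hv : 0 < n → P.δ * P.v n n ^ 2 + (P.β - P.δ + P.q - P.p) * P.v n n - P.β = 0)
    {X : Finset (Fin L)} (hX : X.card ≤ n) {i : Fin L} (hi : (i : ℕ) + 1 = L) :
    onSite P.K i *ᵥ P.siteKet ε n E D V₁ V₂ X
        + mpVec V₁ V₂ (Function.update (P.col ε n E D X) i (P.gauge ε n D X i)) =
      P.rightDiag ε n i X • P.siteKet ε n E D V₁ V₂ X := by
  have hself : P.siteKet ε n E D V₁ V₂ X =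
      mpVec V₁ V₂ (Function.update (P.col ε n E D X) i (P.col ε n E D X i)) := by
    rw [siteKet, Function.update_eq_self]
  have hlab := lab_of_last hX hi
  conv_lhs => rw [siteKet, onSite_mulVec_mpVec]
  rw [hself, ← mpVec_update_add, ← mpVec_update_smul]
  refine mpVec_update_congr_right _ _ _ hi _ _ fun a => ?_
  by_cases h : i ∈ X
  · have hn : 0 < n := lt_of_lt_of_le (Finset.card_pos.mpr ⟨i, h⟩) hX
    have e1 : n - 1 + 1 = n := by omega
    have := right_v hpq hright (hv hn) a
    simp only [h, if_true] at hlab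
    simp only [col, gauge, rightDiag, h, if_true, hlab, e1]
    rw [Pi.add_apply, LinearMap.add_apply, this, Pi.sub_apply, LinearMap.sub_apply,
      sub_add_cancel]
  · have := right_u hright hu a
    simp only [h, if_false] at hlab
    simp only [col, gauge, rightDiag, h, if_false, hlab]
    rw [Pi.add_apply, LinearMap.add_apply, this, Pi.sub_apply, LinearMap.sub_apply,
      sub_add_cancel]

/-- The ASEP matrix acts on the ansatz vectors as a hopping matrix with nearest neighbour hops and
creation and annihilation on the first site only. -/
theorem W_mulVec_siteKet {ε : ℤˣ} {n : ℕ} (hp : P.p ≠ 0) (hq : P.q ≠ 0) (hpq : P.p ≠ P.q)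
    (hbulk : P.q • (E * D) - P.p • (D * E) = E + D)
    (hα : ε = 1 → P.α ≠ 0) (hu₁ : P.u ε 1 ≠ 0)
    (hleft : V₁ ∘ₗ ((P.α * Complex.exp P.s) • (E - P.br (P.u ε 1) • (1 : Module.End ℂ V))
        - (P.γ * Complex.exp (-P.s)) • (D - P.br (1 / P.u ε 1) • (1 : Module.End ℂ V)) + 1) = 0)
    (hvu : 0 < n → P.v n 1 ≠ 0 ∧ P.v n 1 ≠ P.u ε 2)
    (hright : (P.β • D - P.δ • E + 1) V₂ = 0)
    (hu : (1 - P.u ε (n + 1)) * (P.β + P.δ * P.u ε (n + 1)) = 0)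
    (hv : 0 < n → P.δ * P.v n n ^ 2 + (P.β - P.δ + P.q - P.p) * P.v n n - P.β = 0)
    {X : Finset (Fin L)} (hX : X.card ≤ n) {i₀ i₁ : Fin L} (hi₀ : (i₀ : ℕ) = 0)
    (hi₁ : (i₁ : ℕ) + 1 = L) :
    P.W L *ᵥ P.siteKet ε n E D V₁ V₂ X =
      (P.leftDiag ε n i₀ X + P.rightDiag ε n i₁ X) • P.siteKet ε n E D V₁ V₂ X
        + P.flipRate ε n i₀ X • P.siteKet ε n E D V₁ V₂ (flip i₀ X)
        + ∑ i : Fin L, ∑ j : Fin L, if (j : ℕ) = i + 1 then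
            P.hopRate i j X • (P.siteKet ε n E D V₁ V₂ (hop i j X) - P.siteKet ε n E D V₁ V₂ X)
          else 0 := by
  have h0 : ∀ {M : Type} [AddCommMonoid M] (f : Fin L → M),
      (∑ i : Fin L, if (i : ℕ) = 0 then f i else 0) = f i₀ := by
    intro M _ f
    rw [Finset.sum_eq_single i₀]
    · rw [if_pos hi₀]
    · exact fun i _ hi => if_neg fun h => hi (Fin.ext (h.trans hi₀.symm))
    · simp
  have h1 : ∀ {M : Type} [AddCommMonoid M] (f : Fin L → M),
      (∑ i : Fin L, if (i : ℕ) + 1 = L then f i else 0) = f i₁ := by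
    intro M _ f
    rw [Finset.sum_eq_single i₁]
    · rw [if_pos hi₁]
    · exact fun i _ hi => if_neg fun h => hi (Fin.ext (by omega))
    · simp
  set g : Fin L → Phys L := fun i =>
    mpVec V₁ V₂ (Function.update (P.col ε n E D X) i (P.gauge ε n D X i)) with hg
  have hbond : (∑ i : Fin L, ∑ j : Fin L, if (j : ℕ) = i + 1 then onBond P.w i j else 0)
      *ᵥ P.siteKet ε n E D V₁ V₂ X =
      (∑ i : Fin L, ∑ j : Fin L, if (j : ℕ) = i + 1 then
            P.hopRate i j X • (P.siteKet ε n E D V₁ V₂ (hop i j X) - P.siteKet ε n E D V₁ V₂ X)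
          else 0) + (g i₁ - g i₀) := by
    rw [← h1 g, ← h0 g, ← sum_bond_telescope, ← Finset.sum_add_distrib, Matrix.sum_mulVec]
    refine Finset.sum_congr rfl fun i _ => ?_
    rw [Matrix.sum_mulVec, ← Finset.sum_add_distrib]
    refine Finset.sum_congr rfl fun j _ => ?_
    split_ifs with hij
    · rw [P.onBond_mulVec_siteKet V₁ V₂ ε n hp hq hpq hbulk X hij]
      module
    · simp
  rw [W, Matrix.add_mulVec, Matrix.add_mulVec, hbond, h0, h1]
  have hl := leftBoundary_siteKet (V₂ := V₂) hp hq hpq hα hu₁ hleft hvu hX hi₀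
  have hr := rightBoundary_siteKet (V₁ := V₁) hpq hright hu hv hX hi₁
  rw [sub_eq_iff_eq_add] at hl
  rw [← eq_sub_iff_add_eq] at hr
  rw [hl, hr]
  simp only [hg]
  module

/-- Coefficient form of the eigenvalue equation. The span of the ansatz vectors with at most `n`
excitations is stable since the rate of creation of one more excitation is `entry ε n 0 = 0`. -/
theorem W_mulVec_sum_siteKet {ε : ℤˣ} {n : ℕ} (hp : P.p ≠ 0) (hq : P.q ≠ 0) (hpq : P.p ≠ P.q)
    (hbulk : P.q • (E * D) - P.p • (D * E) = E + D)
    (hα : ε = 1 → P.α ≠ 0) (hu₁ : P.u ε 1 ≠ 0)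
    (hleft : V₁ ∘ₗ ((P.α * Complex.exp P.s) • (E - P.br (P.u ε 1) • (1 : Module.End ℂ V))
        - (P.γ * Complex.exp (-P.s)) • (D - P.br (1 / P.u ε 1) • (1 : Module.End ℂ V)) + 1) = 0)
    (hvu : 0 < n → P.v n 1 ≠ 0 ∧ P.v n 1 ≠ P.u ε 2)
    (hright : (P.β • D - P.δ • E + 1) V₂ = 0)
    (hu : (1 - P.u ε (n + 1)) * (P.β + P.δ * P.u ε (n + 1)) = 0)
    (hv : 0 < n → P.δ * P.v n n ^ 2 + (P.β - P.δ + P.q - P.p) * P.v n n - P.β = 0)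
    {i₀ i₁ : Fin L} (hi₀ : (i₀ : ℕ) = 0) (hi₁ : (i₁ : ℕ) + 1 = L)
    (φ : Finset (Fin L) → ℂ) (e : ℂ)
    (hφ : ∀ X : Finset (Fin L), X.card ≤ n →
      (P.leftDiag ε n i₀ X + P.rightDiag ε n i₁ X) * φ X
        + (if (flip i₀ X).card ≤ n then P.flipRate ε n i₀ (flip i₀ X) * φ (flip i₀ X) else 0)
        + (∑ i : Fin L, ∑ j : Fin L, if (j : ℕ) = i + 1 then
            P.hopRate i j (hop i j X) * φ (hop i j X) - P.hopRate i j X * φ X else 0)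
      = e * φ X) :
    P.W L *ᵥ (∑ X : Finset (Fin L) with X.card ≤ n, φ X • P.siteKet ε n E D V₁ V₂ X) =
      e • ∑ X : Finset (Fin L) with X.card ≤ n, φ X • P.siteKet ε n E D V₁ V₂ X := by
  classical
  set K := P.siteKet ε n E D V₁ V₂ (L := L) with hK
  have hhop : ∀ i j : Fin L,
      ∑ X : Finset (Fin L) with X.card ≤ n, (P.hopRate i j X * φ X) • K (hop i j X) =
      ∑ X : Finset (Fin L) with X.card ≤ n,
        (P.hopRate i j (hop i j X) * φ (hop i j X)) • K X := by
    intro i j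
    refine Finset.sum_nbij' (hop i j) (hop i j) ?_ ?_ ?_ ?_ ?_
    · intro X hX; simpa [card_hop] using hX
    · intro X hX; simpa [card_hop] using hX
    · intro X _; exact hop_hop i j X
    · intro X _; exact hop_hop i j X
    · intro X _; rw [hop_hop]
  have hflip :
      ∑ X : Finset (Fin L) with X.card ≤ n, (P.flipRate ε n i₀ X * φ X) • K (flip i₀ X) =
      ∑ X : Finset (Fin L) with X.card ≤ n,
        (if (flip i₀ X).card ≤ n then P.flipRate ε n i₀ (flip i₀ X) * φ (flip i₀ X) else 0)
          • K X := by
    have h1 : ∀ X : Finset (Fin L), X.card ≤ n →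
        (P.flipRate ε n i₀ X * φ X) • K (flip i₀ X) =
        if (flip i₀ X).card ≤ n then (P.flipRate ε n i₀ X * φ X) • K (flip i₀ X) else 0 := by
      intro X hX
      split_ifs with h
      · rfl
      · have hm : i₀ ∉ X := fun hm => h (by have := card_flip_of_mem hm; omega)
        have hc := card_flip_of_notMem hm
        have : n - X.card = 0 := by omega
        rw [flipRate, if_neg hm, this]
        simp [entry]
    simp only [ite_smul, zero_smul]
    rw [Finset.sum_congr rfl fun X hX => h1 X (by simpa using hX), ← Finset.sum_filter,
      ← Finset.sum_filter]
    refine Finset.sum_nbij' (flip i₀) (flip i₀) ?_ ?_ ?_ ?_ ?_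
    · intro X hX; simpa [flip_flip, and_comm] using hX
    · intro X hX; simpa [flip_flip, and_comm] using hX
    · intro X _; exact flip_flip i₀ X
    · intro X _; exact flip_flip i₀ X
    · intro X _; rw [flip_flip]
  rw [Matrix.mulVec_sum, Finset.smul_sum]
  have h2 : ∀ X ∈ (Finset.univ.filter fun X : Finset (Fin L) => X.card ≤ n),
      P.W L *ᵥ (φ X • K X) =
      ((P.leftDiag ε n i₀ X + P.rightDiag ε n i₁ X) * φ X) • K X
        + (P.flipRate ε n i₀ X * φ X) • K (flip i₀ X)
        + ∑ i : Fin L, ∑ j : Fin L, if (j : ℕ) = i + 1 then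
            (P.hopRate i j X * φ X) • K (hop i j X) - (P.hopRate i j X * φ X) • K X else 0 := by
    intro X hX
    rw [Matrix.mulVec_smul, hK, W_mulVec_siteKet hp hq hpq hbulk hα hu₁ hleft hvu hright hu hv
      (by simpa using hX) hi₀ hi₁, smul_add, smul_add, Finset.smul_sum]
    congr 1
    · module
    · refine Finset.sum_congr rfl fun i _ => ?_
      rw [Finset.smul_sum]
      refine Finset.sum_congr rfl fun j _ => ?_
      split_ifs
      · module
      · simp
  rw [Finset.sum_congr rfl h2, Finset.sum_add_distrib, Finset.sum_add_distrib, hflip]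
  have h3 : (∑ X : Finset (Fin L) with X.card ≤ n, ∑ i : Fin L, ∑ j : Fin L,
        if (j : ℕ) = i + 1 then
            (P.hopRate i j X * φ X) • K (hop i j X) - (P.hopRate i j X * φ X) • K X else 0) =
      ∑ X : Finset (Fin L) with X.card ≤ n, (∑ i : Fin L, ∑ j : Fin L, if (j : ℕ) = i + 1 then
            P.hopRate i j (hop i j X) * φ (hop i j X) - P.hopRate i j X * φ X else 0) • K X := by
    simp only [Finset.sum_smul]
    rw [Finset.sum_comm, Finset.sum_comm (s := Finset.univ.filter _)]
    refine Finset.sum_congr rfl fun i _ => ?_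
    rw [Finset.sum_comm, Finset.sum_comm (s := Finset.univ.filter _)]
    refine Finset.sum_congr rfl fun j _ => ?_
    split_ifs
    · simp only [sub_smul, Finset.sum_sub_distrib, hhop]
    · simp
  rw [h3, ← Finset.sum_add_distrib, ← Finset.sum_add_distrib]
  refine Finset.sum_congr rfl fun X hX => ?_
  rw [← add_smul, ← add_smul, hφ X (by simpa using hX), mul_smul]

end BoundaryAction

end Params

/-! ### Sums over the nodes of a polynomial and of its reflection -/

section PartialFractions

open Polynomial

theorem coeff_comp_neg_X {R : Type*} [CommRing R] (p : R[X]) (k : ℕ) :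
    (p.comp (-X)).coeff k = (-1) ^ k * p.coeff k := by
  have : (-X : R[X]) = C (-1) * X := by simp
  rw [this, comp_C_mul_X_coeff, mul_comm]

variable {F : Type*} [Field F] {ι : Type*}

/-- The polynomials `q(-X)` and `q(X)` have the same leading term, so `q(-X) - q(X)` is its own
Lagrange interpolation at the roots of `q`. -/
theorem degree_reflect_sub_lt {s : Finset ι} (y : ι → F) (hs : Even s.card) :
    ((Lagrange.nodal s y).comp (-X) - Lagrange.nodal s y).degree < s.card := by
  set q := Lagrange.nodal s y with hq
  have hdeg : q.natDegree = s.card := Lagrange.natDegree_nodal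
  rw [degree_lt_iff_coeff_zero]
  intro k hk
  rw [coeff_sub, coeff_comp_neg_X]
  rcases hk.eq_or_lt with h | h
  · rw [← h, hs.neg_one_pow, one_mul, sub_self]
  · rw [coeff_eq_zero_of_natDegree_lt (by omega)]; simp

theorem eval_reflect_sub_node {s : Finset ι} (y : ι → F) {i : ι} (hi : i ∈ s) :
    ((Lagrange.nodal s y).comp (-X) - Lagrange.nodal s y).eval (y i) =
      (Lagrange.nodal s y).eval (-y i) := by
  simp [Lagrange.eval_nodal_at_node hi]

/-- Partial fractions of `q(-a)/q(a)`, where `q = ∏ (X - y_i)` has even degree. -/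
theorem sum_reflect_div_sub [DecidableEq ι] {s : Finset ι} {y : ι → F} (hy : Set.InjOn y s)
    (hs : Even s.card)
    {a : F} (ha : ∀ i ∈ s, a ≠ y i) :
    ∑ i ∈ s, (Lagrange.nodal s y).eval (-y i) / (∏ j ∈ s.erase i, (y i - y j)) / (y i - a) =
      1 - (Lagrange.nodal s y).eval (-a) / (Lagrange.nodal s y).eval a := by
  set q := Lagrange.nodal s y with hq
  have hqa : q.eval a ≠ 0 := by
    rw [hq]; exact Lagrange.eval_nodal_not_at_node ha
  have h := Lagrange.eq_interpolate_of_eval_eq (fun i => q.eval (-y i)) hy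
    (degree_reflect_sub_lt y hs) (fun i hi => eval_reflect_sub_node y hi)
  have h2 := congrArg (eval a) h
  rw [Lagrange.eval_interpolate_not_at_node _ ha, ← hq] at h2
  simp only [eval_sub, eval_comp, eval_neg, eval_X] at h2
  have h3 : ∑ i ∈ s, Lagrange.nodalWeight s y i * (a - y i)⁻¹ * q.eval (-y i) =
      -∑ i ∈ s, q.eval (-y i) / (∏ j ∈ s.erase i, (y i - y j)) / (y i - a) := by
    rw [← Finset.sum_neg_distrib]
    refine Finset.sum_congr rfl fun i _ => ?_
    rw [Lagrange.nodalWeight, Finset.prod_inv_distrib, ← neg_sub (y i) a, inv_neg]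
    ring
  rw [h3] at h2
  generalize ∑ i ∈ s, q.eval (-y i) / (∏ j ∈ s.erase i, (y i - y j)) / (y i - a) = S at h2 ⊢
  field_simp
  linear_combination h2

/-- The leading coefficient of `q(-X) - q(X)`, expressed by Lagrange interpolation. -/
theorem sum_reflect [DecidableEq ι] {s : Finset ι} {y : ι → F} (hy : Set.InjOn y s)
    (hs : Even s.card) (hs0 : 0 < s.card) :
    ∑ i ∈ s, (Lagrange.nodal s y).eval (-y i) / (∏ j ∈ s.erase i, (y i - y j)) =
      2 * ∑ i ∈ s, y i := by
  have h := Lagrange.coeff_eq_sum hy (degree_reflect_sub_lt y hs)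
  rw [coeff_sub, coeff_comp_neg_X, Lagrange.nodal_eq, prod_X_sub_C_coeff_card_pred s y hs0,
    (Nat.Even.sub_odd hs0 hs odd_one).neg_one_pow, ← Lagrange.nodal_eq] at h
  rw [Finset.sum_congr rfl fun i hi => by rw [← eval_reflect_sub_node y hi], ← h]
  ring

/-- The leading coefficient of `X (q(-X) - q(X))` reduced modulo `q`, by Lagrange interpolation.
The subleading coefficient of `q(-X) - q(X)` vanishes for parity reasons. -/
theorem sum_mul_reflect [DecidableEq ι] {s : Finset ι} {y : ι → F} (hy : Set.InjOn y s)
    (hs : Even s.card) (hs0 : 0 < s.card) :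
    ∑ i ∈ s, y i * ((Lagrange.nodal s y).eval (-y i) / (∏ j ∈ s.erase i, (y i - y j))) =
      2 * (∑ i ∈ s, y i) ^ 2 := by
  set q := Lagrange.nodal s y with hq
  set R := q.comp (-X) - q with hR
  set e := ∑ i ∈ s, y i with he
  have hdeg : q.natDegree = s.card := Lagrange.natDegree_nodal
  have hpred : q.coeff (s.card - 1) = -e := by
    rw [hq, Lagrange.nodal_eq, prod_X_sub_C_coeff_card_pred s y hs0]
  have hlead : q.coeff s.card = 1 := by
    rw [← hdeg]; exact Lagrange.nodal_monic
  obtain ⟨N, hN⟩ : ∃ N, s.card = N + 2 := ⟨s.card - 2, by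
    obtain ⟨k, hk⟩ := hs; omega⟩
  have hNe : Even N := by
    rw [hN] at hs
    exact (Nat.even_add.mp hs).mpr even_two
  have hRdeg : R.degree < s.card := degree_reflect_sub_lt y hs
  have hR1 : R.coeff (N + 1) = 2 * e := by
    have h1 : q.coeff (N + 1) = -e := by
      rw [← hpred, hN]; rfl
    rw [hR, coeff_sub, coeff_comp_neg_X, hNe.add_one.neg_one_pow, h1]
    ring
  have hR0 : R.coeff N = 0 := by
    rw [hR, coeff_sub, coeff_comp_neg_X, hNe.neg_one_pow]; ring
  have hdeg2 : (X * R - C (2 * e) * q).degree < (s.card : WithBot ℕ) := by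
    rw [degree_lt_iff_coeff_zero]
    intro k hk
    obtain ⟨k', rfl⟩ : ∃ k', k = k' + 1 := ⟨k - 1, by omega⟩
    rw [coeff_sub, coeff_X_mul, coeff_C_mul]
    rcases hk.eq_or_lt with h | h
    · have : k' = N + 1 := by omega
      rw [this, hR1, show N + 1 + 1 = s.card by omega, hlead]; ring
    · rw [coeff_eq_zero_of_natDegree_lt (p := q) (by omega),
        (degree_lt_iff_coeff_zero _ _).mp hRdeg k' (by omega)]
      ring
  have h := Lagrange.coeff_eq_sum hy hdeg2
  have h1 : s.card - 1 = N + 1 := by omega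
  rw [h1, coeff_sub, coeff_X_mul, coeff_C_mul, hR0, ← h1, hpred] at h
  rw [Finset.sum_congr rfl fun i hi => by
    rw [show y i * (q.eval (-y i) / ∏ j ∈ s.erase i, (y i - y j)) =
      (X * R - C (2 * e) * q).eval (y i) / ∏ j ∈ s.erase i, (y i - y j) by
        rw [eval_sub, eval_mul, eval_mul, eval_X, hR, eval_reflect_sub_node y hi, hq,
          Lagrange.eval_nodal_at_node hi]
        ring], ← h]
  ring

/-- Values at the nodes of a quartic polynomial divided by `2 y (y - ρ) (y + ρ)`, summed with the
Lagrange weights of `q(-y)`: a decomposition into partial fractions leaves the three sums above. The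
value of `K` at `0` drops out because `q(-0) = q(0)`. -/
theorem sum_quartic_reflect [CharZero F] [DecidableEq ι] {s : Finset ι} {y : ι → F}
    (hy : Set.InjOn y s) (hs : Even s.card) (hs0 : 0 < s.card) {ρ : F} (hρ : ρ ≠ 0)
    (h0 : ∀ i ∈ s, y i ≠ 0) (h1 : ∀ i ∈ s, y i ≠ ρ) (h2 : ∀ i ∈ s, y i ≠ -ρ) {κ : F}
    (hκ : (Lagrange.nodal s y).eval (-ρ) = κ * (Lagrange.nodal s y).eval ρ) (K : F → F)
    (k₀ k₁ k₂ k₃ k₄ : F) (hK : ∀ t, K t = k₄ * t ^ 4 + k₃ * t ^ 3 + k₂ * t ^ 2 + k₁ * t + k₀) :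
    ∑ i ∈ s, K (y i) * ((Lagrange.nodal s y).eval (-y i) / (∏ j ∈ s.erase i, (y i - y j)))
        / (2 * (y i * (y i - ρ) * (y i + ρ))) =
      k₄ * (∑ i ∈ s, y i) ^ 2 + k₃ * (∑ i ∈ s, y i)
        - (K ρ * (κ - 1) + K (-ρ) * (κ⁻¹ - 1)) / (4 * ρ ^ 2) := by
  set q := Lagrange.nodal s y with hq
  set Q : ι → F := fun i => q.eval (-y i) / (∏ j ∈ s.erase i, (y i - y j)) with hQ
  have hq0 : q.eval 0 ≠ 0 := Lagrange.eval_nodal_not_at_node fun i hi => (h0 i hi).symm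
  have hq1 : q.eval ρ ≠ 0 := Lagrange.eval_nodal_not_at_node fun i hi => (h1 i hi).symm
  have hq2 : q.eval (-ρ) ≠ 0 := Lagrange.eval_nodal_not_at_node fun i hi => (h2 i hi).symm
  have hκ0 : κ ≠ 0 := by
    rintro rfl
    exact hq2 (by rw [hκ, zero_mul])
  have s0 : ∑ i ∈ s, Q i / (y i - 0) = 0 := by
    rw [hQ, sum_reflect_div_sub hy hs fun i hi => (h0 i hi).symm, neg_zero, div_self hq0, sub_self]
  have s1 : ∑ i ∈ s, Q i / (y i - ρ) = 1 - κ := by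
    rw [hQ, sum_reflect_div_sub hy hs fun i hi => (h1 i hi).symm, ← hq, hκ,
      mul_div_cancel_right₀ _ hq1]
  have s2 : ∑ i ∈ s, Q i / (y i - -ρ) = 1 - κ⁻¹ := by
    rw [hQ, sum_reflect_div_sub hy hs fun i hi => (h2 i hi).symm, ← hq, neg_neg, hκ]
    field_simp
  have m0 := sum_reflect hy hs hs0
  have m1 := sum_mul_reflect hy hs hs0
  rw [← hq] at m0 m1
  have key : ∀ i ∈ s, K (y i) * Q i / (2 * (y i * (y i - ρ) * (y i + ρ))) =
      k₄ / 2 * (y i * Q i) + k₃ / 2 * Q i + (-(K 0) / (2 * ρ ^ 2)) * (Q i / (y i - 0))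
        + K ρ / (4 * ρ ^ 2) * (Q i / (y i - ρ)) + K (-ρ) / (4 * ρ ^ 2) * (Q i / (y i - -ρ)) := by
    intro i hi
    have e0 := h0 i hi
    have e1 := sub_ne_zero.mpr (h1 i hi)
    have e2 : y i + ρ ≠ 0 := by
      rw [← sub_neg_eq_add]; exact sub_ne_zero.mpr (h2 i hi)
    rw [hK (y i), hK 0, hK ρ, hK (-ρ), sub_zero, sub_neg_eq_add]
    generalize y i = t at *
    generalize Q i = A
    field_simp
    ring
  rw [Finset.sum_congr rfl key]
  simp only [Finset.sum_add_distrib, ← Finset.mul_sum, s0, s1, s2]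
  rw [show ∑ i ∈ s, Q i = _ from m0, show ∑ i ∈ s, y i * Q i = _ from m1]
  field_simp
  ring

end PartialFractions

/-! ### Sums over the momenta and their inverses -/

section Nodes

/-- The product `a(z,w) a(w,1/z)`, see `Params.a_mul_a`; it only depends on `w + 1/w`. -/
def crossing (r z w : ℂ) : ℂ :=
  (z - (r + 1 / r) + w) * (z - (r + 1 / r) + 1 / w) / ((z - w) * (z - 1 / w))

/-- The numbers `z_i` and `1/z_i`, indexed by a sign and `i`. -/
def node {κ : Type*} (z : κ → ℂ) (x : ℤˣ × κ) : ℂ := z x.2 ^ (x.1 : ℤ)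

variable {κ : Type*}

theorem prod_nodes_erase [DecidableEq κ] (I : Finset κ) {x : ℤˣ × κ}
    (hx : x ∈ (Finset.univ : Finset ℤˣ) ×ˢ I)
    (f : ℤˣ × κ → ℂ) :
    ∏ x' ∈ ((Finset.univ : Finset ℤˣ) ×ˢ I).erase x, f x' =
      f (-x.1, x.2) * ∏ j ∈ I.erase x.2, f (1, j) * f (-1, j) := by
  have h : ((Finset.univ : Finset ℤˣ) ×ˢ I).erase x =
      insert (-x.1, x.2) ((Finset.univ : Finset ℤˣ) ×ˢ (I.erase x.2)) := by
    ext ⟨σ, j⟩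
    obtain ⟨τ, i⟩ := x
    simp only [Finset.mem_product, Finset.mem_univ, true_and] at hx
    simp only [Finset.mem_erase, Finset.mem_insert, Finset.mem_product, Finset.mem_univ, true_and,
      ne_eq, Prod.mk.injEq]
    by_cases hj : j = i
    · subst hj
      rcases Int.units_eq_one_or σ with rfl | rfl <;>
        rcases Int.units_eq_one_or τ with rfl | rfl <;> simp [hx]
    · simp [hj]
  rw [h, Finset.prod_insert (by simp), Finset.prod_product_right]
  congr 1
  refine Finset.prod_congr rfl fun j _ => ?_
  rw [UnitsInt.univ, Finset.prod_insert (by decide), Finset.prod_singleton]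

theorem prod_nodes (I : Finset κ) (f : ℤˣ × κ → ℂ) :
    ∏ x ∈ (Finset.univ : Finset ℤˣ) ×ˢ I, f x = ∏ j ∈ I, f (1, j) * f (-1, j) := by
  rw [Finset.prod_product_right]
  refine Finset.prod_congr rfl fun j _ => ?_
  rw [UnitsInt.univ, Finset.prod_insert (by decide), Finset.prod_singleton]

theorem sum_nodes (I : Finset κ) (f : ℤˣ × κ → ℂ) :
    ∑ x ∈ (Finset.univ : Finset ℤˣ) ×ˢ I, f x = ∑ j ∈ I, (f (1, j) + f (-1, j)) := by
  rw [Finset.sum_product_right]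
  refine Finset.sum_congr rfl fun j _ => ?_
  rw [UnitsInt.univ, Finset.sum_insert (by decide), Finset.sum_singleton]

theorem node_one (z : κ → ℂ) (j : κ) : node z (1, j) = z j := by simp [node]

theorem node_neg_one (z : κ → ℂ) (j : κ) : node z (-1, j) = 1 / z j := by simp [node]

theorem node_neg (z : κ → ℂ) (x : ℤˣ × κ) : node z (-x.1, x.2) = 1 / node z x := by
  simp [node]

/-- `sum_quartic_reflect` for the nodes `z_i`, `1/z_i`, shifted by `c = (r + 1/r) / 2`: the
reflection `y ↦ -y` of the shifted nodes is `z ↦ r + 1/r - z`, which exchanges `r` and `1/r` and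
turns the denominator of `crossing` into its numerator. None of the nodes may be one of `c`, `r` and
`1/r`. -/
theorem sum_crossing_of_generic [DecidableEq κ] {I : Finset κ} (hI : I.Nonempty) {z : κ → ℂ}
    (hz0 : ∀ i ∈ I, z i ≠ 0)
    (hz : Set.InjOn (node z) ((Finset.univ : Finset ℤˣ) ×ˢ I : Finset (ℤˣ × κ)))
    {r : ℂ} (hr0 : r ≠ 0) (hr1 : r ^ 2 ≠ 1)
    (h0 : ∀ x ∈ (Finset.univ : Finset ℤˣ) ×ˢ I, r ^ 2 - 2 * node z x * r + 1 ≠ 0)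
    (h1 : ∀ x ∈ (Finset.univ : Finset ℤˣ) ×ˢ I, node z x ≠ r)
    (h2 : ∀ x ∈ (Finset.univ : Finset ℤˣ) ×ˢ I, node z x ≠ 1 / r)
    (K : ℂ → ℂ) (k₀ k₁ k₂ k₃ k₄ : ℂ)
    (hK : ∀ t, K t = k₄ * t ^ 4 + k₃ * t ^ 3 + k₂ * t ^ 2 + k₁ * t + k₀) :
    ∑ x ∈ (Finset.univ : Finset ℤˣ) ×ˢ I, K (node z x) / (node z x ^ 2 - 1) *
        ∏ j ∈ I.erase x.2, crossing r (node z x) (z j) =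
      k₄ * (∑ i ∈ I, (z i + 1 / z i - (r + 1 / r))) ^ 2
        + (k₃ + 2 * (r + 1 / r) * k₄) * (∑ i ∈ I, (z i + 1 / z i - (r + 1 / r)))
        - (K r * (1 / r ^ (2 * I.card) - 1) + K (1 / r) * (r ^ (2 * I.card) - 1))
          / (r - 1 / r) ^ 2 := by
  have hr2 : r ^ 2 - 1 ≠ 0 := sub_ne_zero.mpr hr1
  set s := (Finset.univ : Finset ℤˣ) ×ˢ I with hs
  set c : ℂ := (r + 1 / r) / 2 with hc
  set ρ : ℂ := (r - 1 / r) / 2 with hρ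
  set y : ℤˣ × κ → ℂ := fun x => node z x - c with hy
  have hinj : Set.InjOn y s := fun x hx x' hx' h => hz hx hx' (by simpa [hy] using h)
  have hcard : s.card = 2 * I.card := by
    rw [hs, Finset.card_product]; rfl
  have hρ0 : ρ ≠ 0 := by
    rw [hρ]; field_simp; simpa [hr0] using hr2
  have e1 : c + ρ = r := by rw [hc, hρ]; ring
  have e2 : c - ρ = 1 / r := by rw [hc, hρ]; ring
  have ev : ∀ a, (Lagrange.nodal s y).eval a = ∏ x ∈ s, (a + c - node z x) := by
    intro a
    rw [Lagrange.eval_nodal]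
    exact Finset.prod_congr rfl fun x _ => by rw [hy]; ring
  have hnode0 : ∀ x ∈ s, node z x ≠ 0 := fun x hx =>
    zpow_ne_zero _ (hz0 _ (Finset.mem_product.mp hx).2)
  have hnode1 : ∀ x ∈ s, node z x ^ 2 - 1 ≠ 0 := by
    intro x hx h
    have h3 : node z x = node z (-x.1, x.2) := by
      rw [node_neg]
      have := hnode0 x hx
      field_simp
      linear_combination h
    have h4 : x = (-x.1, x.2) := hz hx (Finset.mem_coe.mpr
      (Finset.mem_product.mpr ⟨Finset.mem_univ _, (Finset.mem_product.mp hx).2⟩)) h3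
    have h5 : ∀ σ : ℤˣ, σ ≠ -σ := by decide
    exact h5 x.1 (congrArg Prod.fst h4)
  have hκ : (Lagrange.nodal s y).eval (-ρ) =
      1 / r ^ (2 * I.card) * (Lagrange.nodal s y).eval ρ := by
    rw [ev, ev, hs, prod_nodes, prod_nodes, neg_add_eq_sub, e2, add_comm ρ c, e1, pow_mul,
      ← one_div_pow, Finset.card_eq_sum_ones, ← Finset.prod_pow_eq_pow_sum,
      ← Finset.prod_mul_distrib]
    refine Finset.prod_congr rfl fun i hi => ?_
    have := hz0 i hi
    rw [node_one, node_neg_one]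
    field_simp
    ring
  have main := sum_quartic_reflect hinj ⟨I.card, by omega⟩
    (by rw [hcard]; have := hI.card_pos; omega) hρ0 (by
      intro x hx h
      apply h0 x hx
      have : node z x = c := by simpa [hy, sub_eq_zero] using h
      rw [this, hc]; field_simp; ring) (by
      intro x hx h
      apply h1 x hx
      rw [← e1, ← h, hy]; ring) (by
      intro x hx h
      apply h2 x hx
      rw [← e2, ← neg_neg ρ, ← h, hy]; ring) hκ (fun t => K (t + c))
    (K c) (k₁ + 2 * c * k₂ + 3 * c ^ 2 * k₃ + 4 * c ^ 3 * k₄)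
    (k₂ + 3 * c * k₃ + 6 * c ^ 2 * k₄) (k₃ + 4 * c * k₄) k₄ (by
      intro t
      simp only [hK]
      ring)
  have hsum : ∑ x ∈ s, y x = ∑ i ∈ I, (z i + 1 / z i - (r + 1 / r)) := by
    rw [hs, sum_nodes]
    refine Finset.sum_congr rfl fun i _ => ?_
    simp only [hy, node_one, node_neg_one, hc]
    ring
  rw [hsum] at main
  have hrhs : K (ρ + c) = K r ∧ K (-ρ + c) = K (1 / r) := by
    rw [add_comm ρ c, e1, neg_add_eq_sub, e2]; exact ⟨rfl, rfl⟩
  simp only [hrhs.1, hrhs.2] at main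
  have hfin : (4 : ℂ) * ρ ^ 2 = (r - 1 / r) ^ 2 := by rw [hρ]; ring
  have hc4 : k₃ + 4 * c * k₄ = k₃ + 2 * (r + 1 / r) * k₄ := by rw [hc]; ring
  rw [hfin, hc4] at main
  have hinv : (1 / r ^ (2 * I.card))⁻¹ = r ^ (2 * I.card) := by simp
  rw [hinv] at main
  rw [← main]
  refine Finset.sum_congr rfl fun x hx => ?_
  have hx1 := (Finset.mem_product.mp hx).2
  have hyx : y x + c = node z x := by simp [hy]
  rw [hyx, ev, hs, prod_nodes_erase I hx, ← Finset.mul_prod_erase _ _ hx, prod_nodes_erase I hx]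
  simp only [hy, node_one, node_neg_one, node_neg, crossing]
  rw [Finset.prod_div_distrib]
  have hp1 : ∏ j ∈ I.erase x.2, (-(node z x - c) + c - z j) * (-(node z x - c) + c - 1 / z j) =
      ∏ j ∈ I.erase x.2, (node z x - (r + 1 / r) + z j) * (node z x - (r + 1 / r) + 1 / z j) :=
    Finset.prod_congr rfl fun j _ => by rw [hc]; ring
  have hp2 : ∏ j ∈ I.erase x.2, (node z x - c - (z j - c)) * (node z x - c - (1 / z j - c)) =
      ∏ j ∈ I.erase x.2, (node z x - z j) * (node z x - 1 / z j) :=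
    Finset.prod_congr rfl fun j _ => by ring
  have hp3 : ∏ j ∈ I.erase x.2, (node z x - z j) * (node z x - 1 / z j) ≠ 0 := by
    refine Finset.prod_ne_zero_iff.mpr fun j hj => ?_
    have hne : j ≠ x.2 := (Finset.mem_erase.mp hj).1
    have hjI : j ∈ I := (Finset.mem_erase.mp hj).2
    rw [← node_one z j, ← node_neg z (1, j)]
    refine mul_ne_zero (sub_ne_zero.mpr fun h => ?_) (sub_ne_zero.mpr fun h => ?_)
    · have := hz hx (by simpa [hs] using hjI) h
      exact hne (congrArg Prod.snd this).symm
    · have := hz hx (by simpa [hs] using hjI) h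
      exact hne (congrArg Prod.snd this).symm
  rw [hp1, hp2]
  generalize ∏ j ∈ I.erase x.2, (node z x - (r + 1 / r) + z j) *
    (node z x - (r + 1 / r) + 1 / z j) = A
  generalize ∏ j ∈ I.erase x.2, (node z x - z j) * (node z x - 1 / z j) = B at *
  have g0 := h0 x hx
  have g1 := sub_ne_zero.mpr (h1 x hx)
  have g2 : r * node z x - 1 ≠ 0 := by
    intro h
    apply h2 x hx
    field_simp
    linear_combination h
  have g3 := hnode0 x hx
  have g4 := hnode1 x hx
  have q1 : node z x - c - (1 / node z x - c) = (node z x ^ 2 - 1) / node z x := by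
    field_simp; ring
  have q2 : 2 * ((node z x - c) * (node z x - c - ρ) * (node z x - c + ρ)) =
      -(r ^ 2 - 2 * node z x * r + 1) * (node z x - r) * (r * node z x - 1) / r ^ 2 := by
    rw [show node z x - c - ρ = node z x - r by rw [← e1]; ring,
      show node z x - c + ρ = node z x - 1 / r by rw [← e2]; ring, hc]
    field_simp
    ring
  have q3 : (-(node z x - c) + c - node z x) * ((-(node z x - c) + c - 1 / node z x)) =
      -(r ^ 2 - 2 * node z x * r + 1) * (node z x - r) * (r * node z x - 1)
        / (r ^ 2 * node z x) := by
    rw [hc]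
    field_simp
    ring
  rw [q1, q2, ← mul_assoc, q3]
  generalize K (node z x) = k
  generalize node z x = w at *
  generalize r ^ 2 - 2 * w * r + 1 = G at *
  generalize r * w - 1 = H at *
  generalize w - r = J at *
  field_simp

/-- Sums over the nodes `z_i`, `1/z_i` of a quartic polynomial weighted by `crossing`. Both sides
are continuous in `r`, so that the finitely many `r` excluded in `sum_crossing_of_generic` do not
matter. -/
theorem sum_crossing [DecidableEq κ] {I : Finset κ} (hI : I.Nonempty) {z : κ → ℂ}
    (hz0 : ∀ i ∈ I, z i ≠ 0)
    (hz : Set.InjOn (node z) ((Finset.univ : Finset ℤˣ) ×ˢ I : Finset (ℤˣ × κ)))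
    {r : ℂ} (hr0 : r ≠ 0) (hr1 : r ^ 2 ≠ 1)
    (K : ℂ → ℂ) (k₀ k₁ k₂ k₃ k₄ : ℂ)
    (hK : ∀ t, K t = k₄ * t ^ 4 + k₃ * t ^ 3 + k₂ * t ^ 2 + k₁ * t + k₀) :
    ∑ x ∈ (Finset.univ : Finset ℤˣ) ×ˢ I, K (node z x) / (node z x ^ 2 - 1) *
        ∏ j ∈ I.erase x.2, crossing r (node z x) (z j) =
      k₄ * (∑ i ∈ I, (z i + 1 / z i - (r + 1 / r))) ^ 2
        + (k₃ + 2 * (r + 1 / r) * k₄) * (∑ i ∈ I, (z i + 1 / z i - (r + 1 / r)))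
        - (K r * (1 / r ^ (2 * I.card) - 1) + K (1 / r) * (r ^ (2 * I.card) - 1))
          / (r - 1 / r) ^ 2 := by
  have hKc : Continuous K := by
    have : K = fun t => k₄ * t ^ 4 + k₃ * t ^ 3 + k₂ * t ^ 2 + k₁ * t + k₀ := funext hK
    rw [this]; fun_prop
  have hr2 : r - 1 / r ≠ 0 := by
    intro h
    apply hr1
    field_simp at h
    linear_combination h
  have hcl : ContinuousAt (fun t : ℂ => ∑ x ∈ (Finset.univ : Finset ℤˣ) ×ˢ I,
      K (node z x) / (node z x ^ 2 - 1) * ∏ j ∈ I.erase x.2, crossing t (node z x) (z j)) r := by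
    unfold crossing
    fun_prop (disch := assumption)
  have hcr : ContinuousAt (fun t : ℂ => k₄ * (∑ i ∈ I, (z i + 1 / z i - (t + 1 / t))) ^ 2
        + (k₃ + 2 * (t + 1 / t) * k₄) * (∑ i ∈ I, (z i + 1 / z i - (t + 1 / t)))
        - (K t * (1 / t ^ (2 * I.card) - 1) + K (1 / t) * (t ^ (2 * I.card) - 1))
          / (t - 1 / t) ^ 2) r := by
    have h1 : ContinuousAt (fun t : ℂ => K (1 / t)) r :=
      ContinuousAt.comp (g := K) hKc.continuousAt (by fun_prop (disch := assumption))
    have h2 : r ^ (2 * I.card) ≠ 0 := pow_ne_zero _ hr0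
    have h3 : (r - 1 / r) ^ 2 ≠ 0 := pow_ne_zero _ hr2
    fun_prop (disch := assumption)
  refine tendsto_nhds_unique_of_eventuallyEq (l := nhdsWithin r {r}ᶜ)
    (hcl.tendsto.mono_left nhdsWithin_le_nhds) (hcr.tendsto.mono_left nhdsWithin_le_nhds) ?_
  have fin1 : ∀ a b c : ℂ, c ≠ 0 → {t : ℂ | a * t ^ 2 + b * t + c = 0}.Finite := by
    intro a b c hc
    have hp : Polynomial.C a * Polynomial.X ^ 2 + Polynomial.C b * Polynomial.X
        + Polynomial.C c ≠ 0 := by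
      intro h
      apply hc
      simpa using congrArg (Polynomial.eval 0) h
    refine (Polynomial.finite_setOfPred_isRoot hp).subset fun t ht => ?_
    simpa [Polynomial.IsRoot] using ht
  have ev1 : ∀ a b c : ℂ, c ≠ 0 →
      ∀ᶠ t in nhdsWithin r {r}ᶜ, a * t ^ 2 + b * t + c ≠ 0 := fun a b c hc =>
    nhdsNE_le_cofinite r ((fin1 a b c hc).eventually_cofinite_notMem)
  have hnode0 : ∀ x ∈ (Finset.univ : Finset ℤˣ) ×ˢ I, node z x ≠ 0 := fun x hx =>
    zpow_ne_zero _ (hz0 _ (Finset.mem_product.mp hx).2)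
  have a0 : ∀ᶠ t in nhdsWithin r {r}ᶜ, t ≠ 0 :=
    (continuousAt_id.eventually_ne hr0).filter_mono nhdsWithin_le_nhds
  have a1 := ev1 1 0 (-1) (by norm_num)
  have b0 : ∀ᶠ t in nhdsWithin r {r}ᶜ, ∀ x ∈ (Finset.univ : Finset ℤˣ) ×ˢ I,
      1 * t ^ 2 + (-(2 * node z x)) * t + 1 ≠ 0 :=
    (Finset.eventually_all _).mpr fun x _ => ev1 1 (-(2 * node z x)) 1 one_ne_zero
  have b1 : ∀ᶠ t in nhdsWithin r {r}ᶜ, ∀ x ∈ (Finset.univ : Finset ℤˣ) ×ˢ I,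
      0 * t ^ 2 + (-1) * t + node z x ≠ 0 :=
    (Finset.eventually_all _).mpr fun x hx => ev1 0 (-1) (node z x) (hnode0 x hx)
  have b2 : ∀ᶠ t in nhdsWithin r {r}ᶜ, ∀ x ∈ (Finset.univ : Finset ℤˣ) ×ˢ I,
      0 * t ^ 2 + (node z x) * t + (-1) ≠ 0 :=
    (Finset.eventually_all _).mpr fun x _ => ev1 0 (node z x) (-1) (by norm_num)
  filter_upwards [a0, a1, b0, b1, b2] with t a0 a1 b0 b1 b2
  refine sum_crossing_of_generic hI hz0 hz a0 ?_ ?_ ?_ ?_ K k₀ k₁ k₂ k₃ k₄ hK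
  · intro h; exact a1 (by rw [h]; ring)
  · intro x hx h; exact b0 x hx (by linear_combination h)
  · intro x hx h; exact b1 x hx (by rw [h]; ring)
  · intro x hx h
    apply b2 x hx
    rw [h]; field_simp; ring

end Nodes

/-! ### The two identities of the left boundary -/

section BoundarySums

variable {κ : Type*} [DecidableEq κ]

/-- The two sums needed on the left boundary, in reduced parameters: `A` and `G` are the boundary
rates rescaled by `u₁`, `ρ` and `ν` are the parameters of the columns of an empty and of an occupied
first site in units of `u₁`, and `C`, `D` are the amplitudes of entrance and exit. The polynomial
`F w` is `w p₁(w) V₁(w)`. -/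
theorem sum_boundary {I : Finset κ} (hI : I.Nonempty) {z : κ → ℂ}
    (hz0 : ∀ i ∈ I, z i ≠ 0)
    (hz : Set.InjOn (node z) ((Finset.univ : Finset ℤˣ) ×ˢ I : Finset (ℤˣ × κ)))
    {p r ρ ν A G C D : ℂ} (hr0 : r ≠ 0) (hr1 : r ^ 2 ≠ 1) (hρ : ρ = r ^ (2 * I.card))
    (hν : ν - ρ ≠ 0) (hC : C * (ν - ρ) = -(ρ - 1) * (A * ρ + G))
    (hD : D * (ν - ρ) = A * ν ^ 2 + (G - A + p - p * r ^ 2) * ν - G)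
    (F : ℂ → ℂ) (hF : ∀ w, F w = (w + (ρ - r ^ 2 * ν) / (r * (ν - ρ))) *
      (p * r * w ^ 2 + (A + G - p - p * r ^ 2) * w + p * r - G / r - A * r))
    (Λ : ℂ) (hΛ : Λ = p * r * ∑ i ∈ I, (z i + 1 / z i - (r + 1 / r))) :
    (∑ x ∈ (Finset.univ : Finset ℤˣ) ×ˢ I, F (node z x) / (node z x ^ 2 - 1) *
        ∏ j ∈ I.erase x.2, crossing r (node z x) (z j) = Λ - (A * ρ - A - C)) ∧
    (∑ x ∈ (Finset.univ : Finset ℤˣ) ×ˢ I, F (node z x) / (node z x ^ 2 - 1) *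
        (∏ j ∈ I.erase x.2, crossing r (node z x) (z j)) *
          (p * r * node z x - p * r ^ 2 + (A * ν - A - D) - Λ) + C * D = 0) := by
  have hr2 : r - 1 / r ≠ 0 := by
    intro h
    apply hr1
    field_simp at h
    linear_combination h
  have hρ0 : ρ ≠ 0 := by rw [hρ]; exact pow_ne_zero _ hr0
  have hC' : C = -(ρ - 1) * (A * ρ + G) / (ν - ρ) := by rw [← hC, mul_div_cancel_right₀ _ hν]
  have hD' : D = (A * ν ^ 2 + (G - A + p - p * r ^ 2) * ν - G) / (ν - ρ) := by
    rw [← hD, mul_div_cancel_right₀ _ hν]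
  have hFr : F r = -(G * ρ) * (r - 1 / r) ^ 2 / (ν - ρ) := by
    rw [hF]; field_simp; ring
  have hFr' : F (1 / r) = A * ν * (r - 1 / r) ^ 2 / (ν - ρ) := by
    rw [hF]; field_simp; ring
  set b := (ρ - r ^ 2 * ν) / (r * (ν - ρ)) with hb
  set e := ∑ i ∈ I, (z i + 1 / z i - (r + 1 / r)) with he
  set N₁ := A + G - p - p * r ^ 2 with hN₁
  set N₀ := p * r - G / r - A * r with hN₀
  have hF' : ∀ w, F w = (w + b) * (p * r * w ^ 2 + N₁ * w + N₀) := by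
    intro w; rw [hF]; ring
  constructor
  · rw [sum_crossing hI hz0 hz hr0 hr1 F (b * N₀) (N₀ + b * N₁) (N₁ + b * (p * r)) (p * r) 0
      (fun t => by rw [hF']; ring), ← he, ← hρ, hFr, hFr', hΛ, hC']
    field_simp
    ring
  · have h := sum_crossing hI hz0 hz hr0 hr1
      (fun w => F w * (p * r * w - p * r ^ 2 + (A * ν - A - D) - Λ))
      (b * N₀ * (-(p * r ^ 2) + (A * ν - A - D) - Λ))
      (b * N₀ * (p * r) + (N₀ + b * N₁) * (-(p * r ^ 2) + (A * ν - A - D) - Λ))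
      ((N₀ + b * N₁) * (p * r)
        + (N₁ + b * (p * r)) * (-(p * r ^ 2) + (A * ν - A - D) - Λ))
      ((N₁ + b * (p * r)) * (p * r) + (p * r) * (-(p * r ^ 2) + (A * ν - A - D) - Λ))
      (p * r * (p * r))
      (fun t => by rw [hF']; ring)
    rw [← he, ← hρ] at h
    have hsum : ∀ x ∈ (Finset.univ : Finset ℤˣ) ×ˢ I, F (node z x) / (node z x ^ 2 - 1) *
        (∏ j ∈ I.erase x.2, crossing r (node z x) (z j)) *
          (p * r * node z x - p * r ^ 2 + (A * ν - A - D) - Λ) =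
        F (node z x) * (p * r * node z x - p * r ^ 2 + (A * ν - A - D) - Λ)
          / (node z x ^ 2 - 1) * ∏ j ∈ I.erase x.2, crossing r (node z x) (z j) :=
      fun x _ => by ring
    rw [Finset.sum_congr rfl hsum, h, hFr, hFr', hΛ, hC', hD', hb, hN₁]
    field_simp
    ring

end BoundarySums

/-! ### The groups `BC_m` -/

section WeylGroup

variable {n : ℕ}

instance : Fintype (BC n) := Fintype.ofFinite _

theorem transp_apply (i j : Fin n) (a : ℤˣ × Fin n) :
    (transp i j).1 a = (a.1, Equiv.swap i j a.2) := rfl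

theorem reflect_apply (i : Fin n) (a : ℤˣ × Fin n) :
    (reflect i).1 a = (if a.2 = i then -a.1 else a.1, a.2) := by
  obtain ⟨s, l⟩ := a
  by_cases h : l = i
  · subst h
    rcases Int.units_eq_one_or s with rfl | rfl <;> simp [reflect]
  · simp only [reflect, h, if_false]
    rw [Equiv.swap_apply_of_ne_of_ne] <;> simp [h]

theorem BC_neg_apply (g : BC n) (s : ℤˣ) (j : Fin n) :
    g.1 (-s, j) = (-(g.1 (s, j)).1, (g.1 (s, j)).2) := g.2 (s, j)

theorem BC_ext {g h : BC n} (H : ∀ j, g.1 (1, j) = h.1 (1, j)) : g = h := by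
  apply Subtype.ext
  apply Equiv.ext
  rintro ⟨s, j⟩
  rcases Int.units_eq_one_or s with rfl | rfl
  · exact H j
  · rw [BC_neg_apply, BC_neg_apply, H]

theorem BC_mul_apply (g h : BC n) (a : ℤˣ × Fin n) : (g * h).1 a = g.1 (h.1 a) := rfl

theorem transp_mul_reflect_mul_transp (i j : Fin n) :
    transp i j * reflect i * transp i j = reflect j := by
  refine BC_ext fun l => ?_
  simp only [BC_mul_apply, transp_apply, reflect_apply, Equiv.swap_apply_self]
  by_cases h : l = j
  · subst h; simp
  · rw [if_neg h, if_neg]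
    rw [Equiv.swap_apply_eq_iff, Equiv.swap_apply_left]; exact h

/-- Transpositions of distant letters are conjugates of the generators. -/
theorem transp_mem_BCsub {m : ℕ} {i j : Fin n} (hi : (i : ℕ) < m) (hj : (j : ℕ) < m) :
    transp i j ∈ BCsub n m := by
  have main : ∀ d : ℕ, ∀ i j : Fin n, (j : ℕ) = i + d → (j : ℕ) < m →
      transp i j ∈ BCsub n m := by
    intro d
    induction d with
    | zero =>
      intro i j h _
      have : i = j := Fin.ext (by omega)
      subst this
      have : transp i i = 1 := BC_ext fun l => by simp [transp_apply]
      rw [this]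
      exact one_mem _
    | succ d ih =>
      intro i j h hj
      let l : Fin n := ⟨i + d, by omega⟩
      have hl : transp i l ∈ BCsub n m := ih i l rfl (by simp only [l]; omega)
      have hg : transp l j ∈ BCsub n m :=
        Subgroup.subset_closure (Or.inr ⟨l, j, by simp only [l]; omega, hj, rfl⟩)
      by_cases hd : d = 0
      · have : l = i := Fin.ext (by simp [l, hd])
        rwa [this] at hg
      · have h1 : i ≠ l := fun h' => hd (by have := congrArg Fin.val h'; simp [l] at this; omega)
        have h2 : i ≠ j := fun h' => by have := congrArg Fin.val h'; omega
        have : transp l j * transp i l * transp l j = transp i j := by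
          refine BC_ext fun x => ?_
          have h3 := Equiv.swap_mul_swap_mul_swap h1 h2
          have h4 := Equiv.congr_fun h3 x
          simp only [Equiv.Perm.mul_apply] at h4
          simp only [BC_mul_apply, transp_apply, h4, Equiv.swap_comm j i]
        rw [← this]
        exact mul_mem (mul_mem hg hl) hg
  rcases le_total (i : ℕ) j with h | h
  · exact main (j - i) i j (by omega) hj
  · have : transp i j = transp j i := by
      refine BC_ext fun x => ?_
      simp only [transp_apply, Equiv.swap_comm i j]
    rw [this]
    exact main (i - j) j i (by omega) hi

theorem reflect_mem_BCsub {m : ℕ} {i : Fin n} (hi : (i : ℕ) < m) : reflect i ∈ BCsub n m := by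
  let o : Fin n := ⟨0, by omega⟩
  have h0 : reflect o ∈ BCsub n m :=
    Subgroup.subset_closure (Or.inl ⟨o, rfl, by simp only [o]; omega, rfl⟩)
  have ht : transp o i ∈ BCsub n m := transp_mem_BCsub (by simp only [o]; omega) hi
  rw [← transp_mul_reflect_mul_transp o i]
  exact mul_mem (mul_mem ht h0) ht

theorem BCsub_le_succ (m : ℕ) : BCsub n m ≤ BCsub n (m + 1) := by
  refine Subgroup.closure_mono ?_
  rintro g (⟨i, h1, h2, h3⟩ | ⟨i, j, h1, h2, h3⟩)
  · exact Or.inl ⟨i, h1, by omega, h3⟩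
  · exact Or.inr ⟨i, j, h1, by omega, h3⟩

theorem BCsub_apply {m : ℕ} {g : BC n} (hg : g ∈ BCsub n m) {j : Fin n} (hj : m ≤ (j : ℕ)) :
    g.1 (1, j) = (1, j) := by
  induction hg using Subgroup.closure_induction with
  | mem g hg =>
    rcases hg with ⟨i, h1, h2, rfl⟩ | ⟨i, i', h1, h2, rfl⟩
    · rw [reflect_apply, if_neg]
      intro h
      have : j = i := h
      subst this
      omega
    · have e1 : j ≠ i := fun h => by subst h; omega
      have e2 : j ≠ i' := fun h => by subst h; omega
      rw [transp_apply, Equiv.swap_apply_of_ne_of_ne e1 e2]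
  | one => rfl
  | mul g h _ _ ihg ihh => rw [BC_mul_apply, ihh, ihg]
  | inv g _ ih =>
    have : g.1 ((g⁻¹).1 (1, j)) = g.1 (1, j) := by
      rw [← BC_mul_apply, mul_inv_cancel, ih]; rfl
    exact g.1.injective this

/-- A signed permutation that carries the letter `j` to the letter `b`. -/
def carry (j : Fin n) (b : ℤˣ × Fin n) : BC n :=
  transp b.2 j * (if b.1 = 1 then 1 else reflect j)

theorem carry_apply_self (j : Fin n) (b : ℤˣ × Fin n) : (carry j b).1 (1, j) = b := by
  obtain ⟨s, i⟩ := b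
  rcases Int.units_eq_one_or s with rfl | rfl
  · simp [carry, transp_apply]
  · have : ¬ ((-1 : ℤˣ) = 1) := by decide
    simp [carry, transp_apply, reflect_apply, this]

theorem carry_apply_of_ne {j l : Fin n} (h : l ≠ j) (b : ℤˣ × Fin n) :
    (carry j b).1 (1, l) = (1, Equiv.swap b.2 j l) := by
  rw [carry]
  split_ifs
  · rw [mul_one, transp_apply]
  · rw [BC_mul_apply, reflect_apply, if_neg h, transp_apply]

theorem carry_mem_BCsub {m : ℕ} {j : Fin n} (hj : (j : ℕ) < m) {b : ℤˣ × Fin n}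
    (hb : (b.2 : ℕ) < m) : carry j b ∈ BCsub n m := by
  refine mul_mem (transp_mem_BCsub hb hj) ?_
  split_ifs
  · exact one_mem _
  · exact reflect_mem_BCsub hj

/-- A permutation fixing the letters `j ≥ m` preserves the letters `±j` with `j < m`. -/
theorem BC_apply_lt {m : ℕ} {g : BC n} (hg : ∀ j : Fin n, m ≤ (j : ℕ) → g.1 (1, j) = (1, j))
    {j : Fin n} (hj : (j : ℕ) < m) : ((g.1 (1, j)).2 : ℕ) < m := by
  by_contra h
  push Not at h
  set b := g.1 (1, j) with hb
  have h1 := hg b.2 h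
  have h2 : g.1 b = b := by
    rcases Int.units_eq_one_or b.1 with h3 | h3
    · have : b = (1, b.2) := Prod.ext h3 rfl
      rw [this]; exact h1
    · have : b = (-1, b.2) := Prod.ext h3 rfl
      rw [this, BC_neg_apply, h1]
  have h3 : b = (1, j) := g.1.injective (h2.trans hb)
  rw [h3] at h
  simp at h
  omega

/-- `BC_m` is the pointwise stabilizer of the letters `m+1, …, n`. -/
theorem mem_BCsub_iff {m : ℕ} {g : BC n} :
    g ∈ BCsub n m ↔ ∀ j : Fin n, m ≤ (j : ℕ) → g.1 (1, j) = (1, j) := by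
  refine ⟨fun hg j hj => BCsub_apply hg hj, ?_⟩
  induction m generalizing g with
  | zero =>
    intro h
    have : g = 1 := BC_ext fun j => h j (Nat.zero_le _)
    rw [this]; exact one_mem _
  | succ m ih =>
    intro h
    by_cases hm : m < n
    · let j : Fin n := ⟨m, hm⟩
      have hb : ((g.1 (1, j)).2 : ℕ) < m + 1 := BC_apply_lt h (by simp [j])
      have hc := carry_mem_BCsub (m := m + 1) (j := j) (by simp [j]) hb
      set c := carry j (g.1 (1, j)) with hc'
      have hcg : c⁻¹ * g ∈ BCsub n m := by
        refine ih fun l hl => ?_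
        apply c.1.injective
        rw [← BC_mul_apply, mul_inv_cancel_left]
        by_cases hlj : l = j
        · subst hlj
          rw [hc', carry_apply_self]
        · have hl' : m + 1 ≤ (l : ℕ) := by
            have : (l : ℕ) ≠ m := fun h => hlj (Fin.ext h)
            omega
          rw [h l hl', BCsub_apply hc hl']
      have := mul_mem hc (BCsub_le_succ m hcg)
      rwa [mul_inv_cancel_left] at this
    · exact BCsub_le_succ m (ih fun j hj => absurd j.2 (by omega))

/-- With `j` the label `m + 1`, the elements `carry j b` for the `2 (m + 1)` letters `b` moved by
`BC_{m+1}` represent the cosets of `BC_m` in `BC_{m+1}`. -/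
theorem card_BCsub_succ {m : ℕ} (hm : m < n) :
    Nat.card (BCsub n (m + 1)) = 2 * (m + 1) * Nat.card (BCsub n m) := by
  let j : Fin n := ⟨m, hm⟩
  have hj : (j : ℕ) < m + 1 := Nat.lt_succ_self m
  have hjm : m ≤ (j : ℕ) := le_refl m
  let f : (ℤˣ × {i : Fin n // (i : ℕ) < m + 1}) × BCsub n m → BCsub n (m + 1) := fun x =>
    ⟨carry j (x.1.1, x.1.2.1) * x.2.1,
      mul_mem (carry_mem_BCsub hj x.1.2.2) (BCsub_le_succ m x.2.2)⟩
  have hf : Function.Bijective f := by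
    constructor
    · rintro ⟨⟨s, i⟩, h⟩ ⟨⟨s', i'⟩, h'⟩ heq
      have h1 : carry j (s, i.1) * h.1 = carry j (s', i'.1) * h'.1 := congrArg Subtype.val heq
      have h2 : (s, i.1) = (s', i'.1) := by
        have h3 := congrArg (fun g : BC n => g.1 (1, j)) h1
        simpa only [BC_mul_apply, BCsub_apply h.2 hjm,
          BCsub_apply h'.2 hjm, carry_apply_self] using h3
      rw [h2] at h1
      have h4 := Subtype.ext (mul_left_cancel h1)
      rw [Prod.mk.injEq] at h2
      ext1
      · exact Prod.ext h2.1 (Subtype.ext h2.2)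
      · exact h4
    · rintro ⟨g, hg⟩
      have hb := BC_apply_lt (mem_BCsub_iff.mp hg) hj
      set c := carry j (g.1 (1, j)) with hc
      have hcm : c ∈ BCsub n (m + 1) := carry_mem_BCsub hj hb
      refine ⟨⟨((g.1 (1, j)).1, ⟨(g.1 (1, j)).2, hb⟩), ⟨c⁻¹ * g, ?_⟩⟩, ?_⟩
      · refine mem_BCsub_iff.mpr fun l hl => ?_
        apply c.1.injective
        rw [← BC_mul_apply, mul_inv_cancel_left]
        by_cases hlj : l = j
        · subst hlj
          rw [hc, carry_apply_self]
        · have hl' : m + 1 ≤ (l : ℕ) := by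
            have : (l : ℕ) ≠ m := fun h => hlj (Fin.ext h)
            omega
          rw [BCsub_apply hg hl', BCsub_apply hcm hl']
      · apply Subtype.ext
        exact mul_inv_cancel_left c g
  rw [← Nat.card_congr (Equiv.ofBijective f hf), Nat.card_prod, Nat.card_prod]
  congr 2
  · simp
  · rw [Nat.card_eq_fintype_card, Fintype.card_subtype, Fin.card_filter_val_lt]
    omega

/-- A sum over representatives of the cosets is an average over the whole group. -/
theorem card_mul_sum_complement {m : ℕ} {G : Finset (BC n)}
    (hG : Subgroup.IsComplement (G : Set (BC n)) (BCsub n m)) (F : BC n → ℂ)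
    (hF : ∀ g, ∀ h ∈ BCsub n m, F (g * h) = F g) :
    (Nat.card (BCsub n m) : ℂ) * ∑ g ∈ G, F g = ∑ g, F g := by
  classical
  have : Fintype (BCsub n m) := Fintype.ofFinite _
  have h1 : ∑ x : ↥(G : Set (BC n)) × ↥(BCsub n m : Set (BC n)), F x.1.1 = ∑ g, F g := by
    refine Fintype.sum_bijective _ hG _ _ fun x => ?_
    exact (hF _ _ x.2.2).symm
  rw [← h1, Fintype.sum_prod_type]
  simp only [Finset.sum_const, Finset.card_univ, nsmul_eq_mul, ← Finset.mul_sum]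
  congr 1
  · simp
  · exact (Finset.sum_coe_sort G F).symm

end WeylGroup

namespace Params

/-! ### The sums over the pseudo-excitation that crosses the left boundary -/

section LeftBoundarySums

variable (P : Params)

theorem r_ne_zero {P : Params} (hp : P.p ≠ 0) (hq : P.q ≠ 0) (hr : P.r ^ 2 = P.q / P.p) :
    P.r ≠ 0 := by
  intro h
  rw [h] at hr
  exact div_ne_zero hq hp (by rw [← hr]; ring)

theorem r_sq_ne_one {P : Params} (hp : P.p ≠ 0) (hpq : P.p ≠ P.q) (hr : P.r ^ 2 = P.q / P.p) :
    P.r ^ 2 ≠ 1 := by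
  rw [hr]
  intro h
  rw [div_eq_one_iff_eq hp] at h
  exact hpq h.symm

theorem q_eq {P : Params} (hp : P.p ≠ 0) (hr : P.r ^ 2 = P.q / P.p) : P.q = P.p * P.r ^ 2 := by
  rw [hr]; field_simp

/-- The constants of `V_1` in terms of `u₁`: for both signs `ε`, the quantities `λ_{-ε} + α` and
`λ_{-ε} + γ` are the terms `α e^s u₁` and `γ e^{-s} / u₁` of the left boundary quadratic. -/
theorem lam_add {ε : ℤˣ} (hα : ε = 1 → P.α ≠ 0) (hu : P.u ε 1 ≠ 0) :
    lam (-ε) P.α P.γ + P.α = P.α * Complex.exp P.s * P.u ε 1 ∧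
      lam (-ε) P.α P.γ + P.γ = P.γ * Complex.exp (-P.s) / P.u ε 1 := by
  have he : Complex.exp P.s * Complex.exp (-P.s) = 1 := by rw [← Complex.exp_add]; simp
  have h1 : ¬ ((-1 : ℤˣ) = 1) := by decide
  rcases Int.units_eq_one_or ε with rfl | rfl
  · have ha := hα rfl
    rw [u_one] at hu ⊢
    have hg : P.γ ≠ 0 := by
      rintro h
      apply hu
      simp [c, h]
    have he' := Complex.exp_ne_zero (-P.s)
    simp only [lam, c, h1, if_true, if_false]
    constructor
    · field_simp
      linear_combination -(-P.γ) * he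
    · field_simp
      ring
  · have he' := Complex.exp_ne_zero (-P.s)
    rw [u_one]
    simp only [lam, c, h1, if_false, neg_neg, if_true]
    constructor
    · linear_combination -P.α * he
    · field_simp
      ring

/-- With all excitations in the lattice, the left boundary contributes `λ_{-ε}` to the energy. -/
theorem leftEmpty_zero {ε : ℤˣ} (n : ℕ) (hα : ε = 1 → P.α ≠ 0) (hu : P.u ε 1 ≠ 0) :
    P.leftEmpty ε n 0 = lam (-ε) P.α P.γ := by
  have h := (P.lam_add hα hu).1
  simp only [leftEmpty, entry, if_true, zero_add]
  linear_combination -h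

theorem Lam_eq {P : Params} (hp : P.p ≠ 0) (hr0 : P.r ≠ 0) (hr : P.r ^ 2 = P.q / P.p) (z : ℂ) :
    P.Lam z = P.p * P.r * (z + 1 / z - (P.r + 1 / P.r)) := by
  rw [Lam, sqrtpq, q_eq hp hr]
  field_simp
  ring

/-- The weight of the letter `x` in the sums over the excitation that crosses the left boundary:
the inverse of the factor of `T` other than `D_1`. -/
def leftWeight (ε : ℤˣ) {n : ℕ} (t : Fin n) (z : Fin n → ℂ) (x : ℤˣ × Fin n) : ℂ :=
  P.p₁ ε n (node z x) * P.Vone ε (node z x) / (node z x ^ 2 - 1) *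
    ∏ j ∈ (Finset.Iic t).erase x.2, crossing P.r (node z x) (z j)

/-- The sums over the letter `±i` with `i ≤ t` that crosses the left boundary. The first identity
balances an empty first site, the second one an occupied first site. -/
theorem sum_leftWeight {P : Params} {ε : ℤˣ} {n : ℕ} (hp : P.p ≠ 0) (hq : P.q ≠ 0)
    (hpq : P.p ≠ P.q)
    (hr : P.r ^ 2 = P.q / P.p) (hα : ε = 1 → P.α ≠ 0) (hu : P.u ε 1 ≠ 0)
    (hv0 : P.v n 1 ≠ 0) (hvu : P.v n 1 ≠ P.u ε 2) (t : Fin n) {z : Fin n → ℂ}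
    (hz0 : ∀ i, z i ≠ 0) (hz : Function.Injective (node z)) :
    (∑ x ∈ (Finset.univ : Finset ℤˣ) ×ˢ Finset.Iic t, P.leftWeight ε t z x * node z x =
      ∑ i ∈ Finset.Iic t, P.Lam (z i) + lam (-ε) P.α P.γ - P.leftEmpty ε n (t + 1)) ∧
    (∑ x ∈ (Finset.univ : Finset ℤˣ) ×ˢ Finset.Iic t, P.leftWeight ε t z x * node z x *
        (P.sqrtpq * node z x - P.q + P.leftFull ε n t - lam (-ε) P.α P.γ
          - ∑ i ∈ Finset.Iic t, P.Lam (z i)) + P.entry ε n (t + 1) * P.D₁ ε n t = 0) := by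
  have hr0 := r_ne_zero hp hq hr
  have hr1 := r_sq_ne_one hp hpq hr
  have hq' := q_eq hp hr
  obtain ⟨hA, hG⟩ := P.lam_add hα hu
  set lam0 := lam (-ε) P.α P.γ with hlam0
  have hα' : P.α = P.α * Complex.exp P.s * P.u ε 1 - lam0 := by rw [← hA]; ring
  have hγ' : P.γ = P.γ * Complex.exp (-P.s) / P.u ε 1 - lam0 := by rw [← hG]; ring
  set u₁ := P.u ε 1 with hu₁
  set A := P.α * Complex.exp P.s * u₁ with hAdef
  set G := P.γ * Complex.exp (-P.s) / u₁ with hGdef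
  have hGu : P.γ * Complex.exp (-P.s) = G * u₁ := by rw [hGdef]; field_simp
  have hAu : P.α * Complex.exp P.s = A / u₁ := by rw [hAdef]; field_simp
  set ρ := P.r ^ (2 * ((t : ℕ) + 1)) with hρ
  set ν := P.v n (t + 1) / u₁ with hνdef
  have hv : P.v n (t + 1) = ν * u₁ := by rw [hνdef]; field_simp
  have hut : P.u ε (t + 1 + 1) = ρ * u₁ := by
    rw [P.u_succ hp hq, ← hr, ← pow_mul, hρ]
  have hvut := P.v_ne_u hp hq hvu t
  have hνρ : ν - ρ ≠ 0 := by
    intro h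
    apply hvut
    rw [hv, hut]
    linear_combination u₁ * h
  have hν0 : ν ≠ 0 := div_ne_zero (P.v_ne_zero hp hq hv0 t) hu
  have hC : P.entry ε n (t + 1) * (ν - ρ) = -(ρ - 1) * (A * ρ + G) := by
    rw [entry, if_neg (Nat.succ_ne_zero _), hv, hut, hAu, hGu, hα', hγ']
    rw [show ν * u₁ - ρ * u₁ = (ν - ρ) * u₁ by ring]
    field_simp
    ring
  have hD : P.D₁ ε n t * (ν - ρ) = A * ν ^ 2 + (G - A + P.p - P.p * P.r ^ 2) * ν - G := by
    have he' : P.γ / (Complex.exp P.s * (ν * u₁)) = G / ν := by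
      rw [← div_div, ← div_div, div_eq_mul_inv P.γ, ← Complex.exp_neg, hGu]
      field_simp
    rw [D₁, hv, hut, he', hAu]
    rw [show ν * u₁ - ρ * u₁ = (ν - ρ) * u₁ by ring]
    rw [show A / u₁ * (ν * u₁) = A * ν by field_simp, ← hq', hα', hγ']
    field_simp
    ring
  have hp1 : ∀ w, P.p₁ ε n w = w + (ρ - P.r ^ 2 * ν) / (P.r * (ν - ρ)) := by
    intro w
    have hs : (P.q / P.p) ^ (t : ℕ) ≠ 0 := pow_ne_zero _ (div_ne_zero hq hp)
    have h1 : (P.q / P.p) ^ (t : ℕ) * P.v n 1 = ν * u₁ := by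
      rw [← hv]; exact (P.v_succ hp hq n t).symm
    have h2 : (P.q / P.p) ^ (t : ℕ) * P.u ε 2 = ρ * u₁ := by
      have h : P.u ε 2 = P.q / P.p * u₁ := by simpa using P.u_succ hp hq ε 1
      rw [← hut, P.u_succ hp hq ε (t + 1), pow_succ, h]; ring
    have h3 : (P.p * P.u ε 2 - P.q * P.v n 1) / (P.v n 1 - P.u ε 2) =
        (P.p * (ρ * u₁) - P.q * (ν * u₁)) / (ν * u₁ - ρ * u₁) := by
      rw [← h1, ← h2, ← mul_div_mul_left _ _ hs]
      congr 1 <;> ring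
    rw [p₁, h3, sqrtpq, hq', show ν * u₁ - ρ * u₁ = (ν - ρ) * u₁ by ring]
    field_simp
  have hV : ∀ w, w ≠ 0 → w * P.Vone ε w = P.p * P.r * w ^ 2
      + (A + G - P.p - P.p * P.r ^ 2) * w + P.p * P.r - G / P.r - A * P.r := by
    intro w hw
    rw [Vone, ← hlam0, hA, hG, Lam, sqrtpq, hq']
    field_simp
    ring
  have hΛ : ∑ i ∈ Finset.Iic t, P.Lam (z i) =
      P.p * P.r * ∑ i ∈ Finset.Iic t, (z i + 1 / z i - (P.r + 1 / P.r)) := by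
    rw [Finset.mul_sum]
    exact Finset.sum_congr rfl fun i _ => Lam_eq hp hr0 hr (z i)
  have hlE : P.leftEmpty ε n (t + 1) - lam0 = A * ρ - A - P.entry ε n (t + 1) := by
    rw [leftEmpty, hut, hAu]
    rw [show A / u₁ * (ρ * u₁) = A * ρ by field_simp]
    linear_combination -hA
  have hlF : P.leftFull ε n t - lam0 = A * ν - A - P.D₁ ε n t := by
    rw [leftFull, hv, hAu]
    rw [show A / u₁ * (ν * u₁) = A * ν by field_simp]
    linear_combination -hA
  have hnode0 : ∀ x, node z x ≠ 0 := fun x => zpow_ne_zero _ (hz0 _)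
  obtain ⟨m1, m2⟩ := sum_boundary (I := Finset.Iic t) ⟨t, Finset.mem_Iic.mpr le_rfl⟩
    (fun i _ => hz0 i) hz.injOn (p := P.p) hr0 hr1 (ρ := ρ) (by rw [Fin.card_Iic]) hνρ hC hD
    (fun w => (w + (ρ - P.r ^ 2 * ν) / (P.r * (ν - ρ))) *
      (P.p * P.r * w ^ 2 + (A + G - P.p - P.p * P.r ^ 2) * w + P.p * P.r - G / P.r - A * P.r))
    (fun w => rfl) _ hΛ
  have hw : ∀ x, P.leftWeight ε t z x * node z x =
      (node z x + (ρ - P.r ^ 2 * ν) / (P.r * (ν - ρ))) *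
      (P.p * P.r * node z x ^ 2 + (A + G - P.p - P.p * P.r ^ 2) * node z x + P.p * P.r
        - G / P.r - A * P.r) / (node z x ^ 2 - 1) *
      ∏ j ∈ (Finset.Iic t).erase x.2, crossing P.r (node z x) (z j) := by
    intro x
    rw [leftWeight, ← hp1, ← hV _ (hnode0 x)]
    ring
  constructor
  · simp only [hw]
    rw [m1, ← hlE]
    ring
  · rw [← m2]
    congr 1
    refine Finset.sum_congr rfl fun x _ => ?_
    rw [hw, ← hlF, ← hq', sqrtpq]
    ring

end LeftBoundarySums

end Params

/-! ### Letters and their exponentials -/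

section Letters

variable {n : ℕ} (k : Fin n → ℂ)

theorem ev_ne_zero (b : ℤˣ × Fin n) : ev k b ≠ 0 := Complex.exp_ne_zero _

theorem ev_neg (s : ℤˣ) (j : Fin n) : ev k (-s, j) = 1 / ev k (s, j) := by
  rw [ev, ev, one_div, ← Complex.exp_neg]
  congr 1
  push_cast
  ring

theorem ev_apply (g : BC n) (b : ℤˣ × Fin n) : ev k (g.1 b) = node (zg k g) b := by
  obtain ⟨s, j⟩ := b
  rcases Int.units_eq_one_or s with rfl | rfl
  · rw [node_one]; rfl
  · rw [node_neg_one, BC_neg_apply, ev_neg]; rfl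

theorem zg_mul (g h : BC n) (j : Fin n) : zg k (g * h) j = node (zg k g) (h.1 (1, j)) := by
  rw [zg, BC_mul_apply, ev_apply]

theorem zg_mul_transp (g : BC n) (i j l : Fin n) :
    zg k (g * transp i j) l = zg k g (Equiv.swap i j l) := by
  rw [zg_mul, transp_apply, node_one]

theorem zg_mul_reflect (g : BC n) (i l : Fin n) :
    zg k (g * reflect i) l = if l = i then 1 / zg k g l else zg k g l := by
  rw [zg_mul, reflect_apply]
  by_cases h : l = i
  · simp only [h, if_true, node_neg_one]
  · simp only [h, if_false, node_one]

theorem zg_mul_carry (g : BC n) (j l : Fin n) (b : ℤˣ × Fin n) :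
    zg k (g * carry j b) l = if l = j then node (zg k g) b else zg k g (Equiv.swap b.2 j l) := by
  rw [zg_mul]
  split_ifs with h
  · rw [h, carry_apply_self]
  · rw [carry_apply_of_ne h, node_one]

theorem zg_mul_of_mem {m : ℕ} (g : BC n) {h : BC n} (hh : h ∈ BCsub n m) {j : Fin n}
    (hj : m ≤ (j : ℕ)) : zg k (g * h) j = zg k g j := by
  rw [zg_mul, BCsub_apply hh hj, node_one]

theorem zg_ne_zero (g : BC n) (j : Fin n) : zg k g j ≠ 0 := ev_ne_zero k _

theorem BC_snd_ne (g : BC n) {b b' : ℤˣ × Fin n} (h : b.2 ≠ b'.2) : (g.1 b).2 ≠ (g.1 b').2 := by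
  intro h'
  obtain ⟨s, i⟩ := b
  obtain ⟨s', i'⟩ := b'
  change (g.1 (s, i)).2 = (g.1 (s', i')).2 at h'
  have h1 : g.1 (s, i) = g.1 (s', i') ∨ g.1 (s, i) = g.1 (-s', i') := by
    rw [BC_neg_apply]
    have h2 : ∀ σ σ' : ℤˣ, σ = σ' ∨ σ = -σ' := by decide
    rcases h2 (g.1 (s, i)).1 (g.1 (s', i')).1 with h3 | h3
    · exact Or.inl (Prod.ext h3 h')
    · exact Or.inr (Prod.ext h3 h')
  rcases h1 with h1 | h1
  · exact h (congrArg Prod.snd (g.1.injective h1) :)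
  · exact h (congrArg Prod.snd (g.1.injective h1) :)

end Letters

namespace Params

section Scattering

variable {P : Params}

theorem a_mul_a (hr0 : P.r ≠ 0) {z w : ℂ} (hz : z ≠ 0) (hw : w ≠ 0) (h1 : z * w ≠ 1)
    (h2 : z ≠ w) : P.a z w * P.a w (1 / z) = crossing P.r z w := by
  have e1 : z * w - 1 ≠ 0 := sub_ne_zero.mpr h1
  have e2 : w - z ≠ 0 := sub_ne_zero.mpr h2.symm
  have e3 : w * (1 / z) - 1 = (w - z) / z := by field_simp
  have e4 : (z - w) * (z - 1 / w) = -((w - z) * (z * w - 1)) / w := by field_simp; ring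
  rw [a, a, crossing, e3, e4]
  field_simp
  linear_combination ((P.r ^ 2 + 1) * w - P.r * (z * w + 1)) *
    ((P.r ^ 2 + 1) - P.r * (w + z)) * Complex.I_sq

theorem a_reverse {z w : ℂ} (hz : z ≠ 0) (hw : w ≠ 0) (h2 : z ≠ w) :
    P.a w (1 / z) = -P.a z (1 / w) := by
  have e2 : w - z ≠ 0 := sub_ne_zero.mpr h2.symm
  have e2' : z - w ≠ 0 := sub_ne_zero.mpr h2
  have e3 : w * (1 / z) - 1 = (w - z) / z := by field_simp
  have e4 : z * (1 / w) - 1 = -((w - z) / w) := by field_simp; ring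
  rw [a, a, e3, e4]
  generalize P.r + 1 / P.r = y
  field_simp
  ring

theorem crossing_inv (r z w : ℂ) : crossing r z (1 / w) = crossing r z w := by
  simp only [crossing, one_div_one_div]
  ring

end Scattering

/-- The quantities that are divided by in the scattering and boundary functions do not vanish at
the momenta. -/
structure Regular (P : Params) (ε : ℤˣ) {n : ℕ} (k : Fin n → ℂ) : Prop where
  sq_ne_one : ∀ b, ev k b ^ 2 ≠ 1
  p₁_ne_zero : ∀ b, P.p₁ ε n (ev k b) ≠ 0
  Vone_ne_zero : ∀ b, P.Vone ε (ev k b) ≠ 0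
  mul_ne_one : ∀ b b' : ℤˣ × Fin n, b.2 ≠ b'.2 → ev k b * ev k b' ≠ 1
  a_ne_zero : ∀ b b' : ℤˣ × Fin n, b.2 ≠ b'.2 → P.a (ev k b) (ev k b') ≠ 0

namespace Regular

variable {P : Params} {ε : ℤˣ} {n : ℕ} {k : Fin n → ℂ}

theorem node_mul_node_ne_one (R : P.Regular ε k) (g : BC n) {b b' : ℤˣ × Fin n} (h : b.2 ≠ b'.2) :
    node (zg k g) b * node (zg k g) b' ≠ 1 := by
  rw [← ev_apply, ← ev_apply]; exact R.mul_ne_one _ _ (BC_snd_ne g h)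

theorem a_node_ne_zero (R : P.Regular ε k) (g : BC n) {b b' : ℤˣ × Fin n} (h : b.2 ≠ b'.2) :
    P.a (node (zg k g) b) (node (zg k g) b') ≠ 0 := by
  rw [← ev_apply, ← ev_apply]; exact R.a_ne_zero _ _ (BC_snd_ne g h)

theorem node_ne_zero (g : BC n) (b : ℤˣ × Fin n) : node (zg k g) b ≠ 0 := by
  rw [← ev_apply]; exact ev_ne_zero k _

theorem node_sq_ne_one (R : P.Regular ε k) (g : BC n) (b : ℤˣ × Fin n) :
    node (zg k g) b ^ 2 ≠ 1 := by
  rw [← ev_apply]; exact R.sq_ne_one _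

theorem node_injective (R : P.Regular ε k) (g : BC n) : Function.Injective (node (zg k g)) := by
  intro b b' h
  by_contra hne
  by_cases h2 : b.2 = b'.2
  · have h1 : b = (b'.1, b'.2) ∨ b = (-b'.1, b'.2) := by
      have h3 : ∀ σ σ' : ℤˣ, σ = σ' ∨ σ = -σ' := by decide
      rcases h3 b.1 b'.1 with h4 | h4
      · exact Or.inl (Prod.ext h4 h2)
      · exact Or.inr (Prod.ext h4 h2)
    rcases h1 with h1 | h1
    · exact hne h1
    · rw [h1, node_neg] at h
      apply R.node_sq_ne_one g b'
      have h0 := node_ne_zero (k := k) g b'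
      field_simp at h
      exact h.symm
  · apply R.node_mul_node_ne_one g (b := b) (b' := (-b'.1, b'.2)) h2
    rw [node_neg, h]
    exact mul_one_div_cancel (node_ne_zero g b')

theorem crossing_node (R : P.Regular ε k) (hr0 : P.r ≠ 0) (g : BC n) {b b' : ℤˣ × Fin n}
    (h : b.2 ≠ b'.2) :
    P.a (node (zg k g) b) (node (zg k g) b') * P.a (node (zg k g) b') (1 / node (zg k g) b) =
      crossing P.r (node (zg k g) b) (node (zg k g) b') :=
  a_mul_a hr0 (node_ne_zero g b) (node_ne_zero g b') (R.node_mul_node_ne_one g h)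
    fun h' => h (congrArg Prod.snd (R.node_injective g h'))

theorem crossing_node_ne_zero (R : P.Regular ε k) (hr0 : P.r ≠ 0) (g : BC n) {b b' : ℤˣ × Fin n}
    (h : b.2 ≠ b'.2) : crossing P.r (node (zg k g) b) (node (zg k g) b') ≠ 0 := by
  rw [← R.crossing_node hr0 g h, ← node_neg]
  exact mul_ne_zero (R.a_node_ne_zero g h) (R.a_node_ne_zero g (b' := (-b.1, b.2)) h.symm)

/-- `S` is the ratio of the two `crossing` factors, which are exchanged by a transposition. -/
theorem crossing_mul_S (R : P.Regular ε k) (hr0 : P.r ≠ 0) (g : BC n) {i j : Fin n}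
    (h : i ≠ j) :
    crossing P.r (zg k g j) (zg k g i) * P.S (zg k g i) (zg k g j) =
      crossing P.r (zg k g i) (zg k g j) := by
  have h1 := R.crossing_node hr0 g (b := (1, j)) (b' := (1, i)) h.symm
  have h2 := R.crossing_node hr0 g (b := (1, i)) (b' := (1, j)) h
  have h3 := R.a_node_ne_zero g (b := (1, j)) (b' := (1, i)) h.symm
  have h4 : zg k g i ≠ zg k g j := fun h' => h (by
    have := R.node_injective g (a₁ := (1, i)) (a₂ := (1, j)) (by simpa only [node_one] using h')
    exact congrArg Prod.snd this)
  simp only [node_one] at h1 h2 h3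
  rw [← h1, ← h2, a_reverse (P := P) (zg_ne_zero k g i) (zg_ne_zero k g j) h4, S]
  field_simp

end Regular

end Params

namespace Params

/-! ### The reduced amplitudes and their invariance -/

section Amplitudes

variable (P : Params) {n : ℕ}

/-- The factor of `T^{(m)}` other than `D_1^{(m-1)}`. -/
def tau (ε : ℤˣ) (t : Fin n) (z : Fin n → ℂ) : ℂ :=
  (z t ^ 2 - 1) /
    (P.p₁ ε n (z t) * P.Vone ε (z t) * ∏ j ∈ Finset.Iio t, crossing P.r (z t) (z j))

/-- The amplitude `A^{(m)}` without the product of the `D_1`'s. Only `D_1^{(0)}` is known not to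
vanish, so the invariance of `A^{(m)}` under `BC_m` does not give the one of `redAmp`, which is
proved directly. -/
def redAmp (ε : ℤˣ) (k : Fin n → ℂ) (A₀ : BC n → ℂ) (m : ℕ) (g : BC n) : ℂ :=
  (∏ t ∈ Finset.univ.filter fun t : Fin n => (t : ℕ) < m, P.tau ε t (zg k g)) * A₀ g

variable {P} {ε : ℤˣ} {k : Fin n → ℂ}

theorem T_eq (R : P.Regular ε k) (hr0 : P.r ≠ 0) (t : Fin n) (g : BC n) :
    P.T ε t (zg k g) = P.D₁ ε n t * P.tau ε t (zg k g) := by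
  have h : ∏ j ∈ Finset.Iio t, P.a (zg k g t) (zg k g j) * P.a (zg k g j) (1 / zg k g t) =
      ∏ j ∈ Finset.Iio t, crossing P.r (zg k g t) (zg k g j) := by
    refine Finset.prod_congr rfl fun j hj => ?_
    have := R.crossing_node hr0 g (b := (1, t)) (b' := (1, j))
      (ne_of_gt (Finset.mem_Iio.mp hj))
    simpa only [node_one] using this
  rw [T, tau, h, div_mul_div_comm, mul_div_assoc]

theorem filter_lt_succ (t : Fin n) :
    (Finset.univ.filter fun i : Fin n => (i : ℕ) < (t : ℕ) + 1) =
      insert t (Finset.univ.filter fun i : Fin n => (i : ℕ) < t) := by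
  ext i
  simp only [Finset.mem_filter, Finset.mem_univ, true_and, Finset.mem_insert, Fin.ext_iff]
  omega

theorem prod_filter_lt_succ (t : Fin n) (f : Fin n → ℂ) :
    ∏ i ∈ Finset.univ.filter fun i : Fin n => (i : ℕ) < (t : ℕ) + 1, f i =
      f t * ∏ i ∈ Finset.univ.filter fun i : Fin n => (i : ℕ) < t, f i := by
  rw [filter_lt_succ, Finset.prod_insert (by simp)]

theorem redAmp_succ (A₀ : BC n → ℂ) (t : Fin n) (g : BC n) :
    P.redAmp ε k A₀ (t + 1) g = P.tau ε t (zg k g) * P.redAmp ε k A₀ t g := by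
  rw [redAmp, redAmp, prod_filter_lt_succ, mul_assoc]

theorem amp_eq_redAmp (R : P.Regular ε k) (hr0 : P.r ≠ 0) {A : ℕ → BC n → ℂ}
    (hT : ∀ g, ∀ t : Fin n, A (t + 1) g = P.T ε t (zg k g) * A t g) {m : ℕ} (hm : m ≤ n)
    (g : BC n) :
    A m g = (∏ t ∈ Finset.univ.filter fun t : Fin n => (t : ℕ) < m, P.D₁ ε n t) *
      P.redAmp ε k (A 0) m g := by
  induction m with
  | zero => simp [redAmp]
  | succ m ih =>
    have h1 := hT g ⟨m, hm⟩
    have h2 := redAmp_succ (P := P) (ε := ε) (k := k) (A 0) ⟨m, hm⟩ g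
    have h3 := prod_filter_lt_succ ⟨m, hm⟩ (fun t : Fin n => P.D₁ ε n t)
    simp only at h1 h2 h3
    rw [h1, h2, h3, ih (by omega), T_eq R hr0]
    ring

/-- A transposition of labels above `m` acts on the amplitude by scattering. -/
theorem redAmp_transp_of_le {A₀ : BC n → ℂ}
    (hS : ∀ g, ∀ i j : Fin n, (j : ℕ) = i + 1 →
      A₀ (g * transp i j) = P.S (zg k g i) (zg k g j) * A₀ g) {m : ℕ} (g : BC n) {i j : Fin n}
    (hij : (j : ℕ) = i + 1) (hm : m ≤ (i : ℕ)) :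
    P.redAmp ε k A₀ m (g * transp i j) =
      P.S (zg k g i) (zg k g j) * P.redAmp ε k A₀ m g := by
  have hz : ∀ l : Fin n, (l : ℕ) < m → zg k (g * transp i j) l = zg k g l := by
    intro l hl
    rw [zg_mul_transp, Equiv.swap_apply_of_ne_of_ne]
    · rintro rfl; omega
    · rintro rfl; omega
  have h : ∏ t ∈ Finset.univ.filter fun t : Fin n => (t : ℕ) < m,
        P.tau ε t (zg k (g * transp i j)) =
      ∏ t ∈ Finset.univ.filter fun t : Fin n => (t : ℕ) < m, P.tau ε t (zg k g) := by
    refine Finset.prod_congr rfl fun t ht => ?_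
    have ht' : (t : ℕ) < m := by simpa using ht
    have h2 : ∏ l ∈ Finset.Iio t, crossing P.r (zg k g t) (zg k (g * transp i j) l) =
        ∏ l ∈ Finset.Iio t, crossing P.r (zg k g t) (zg k g l) := by
      refine Finset.prod_congr rfl fun l hl => ?_
      have : (l : ℕ) < t := Fin.lt_def.mp (Finset.mem_Iio.mp hl)
      rw [hz l (by omega)]
    rw [tau, tau, hz t ht', h2]
  rw [redAmp, redAmp, h, hS g i j hij]
  ring

theorem tau_swap_of_ne (z : Fin n → ℂ) {i j t : Fin n} (hij : (j : ℕ) = i + 1) (hi : t ≠ i)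
    (hj : t ≠ j) : P.tau ε t (fun l => z (Equiv.swap i j l)) = P.tau ε t z := by
  have h : ∏ l ∈ Finset.Iio t, crossing P.r (z t) (z (Equiv.swap i j l)) =
      ∏ l ∈ Finset.Iio t, crossing P.r (z t) (z l) := by
    refine Finset.prod_equiv (Equiv.swap i j) (fun l => ?_) (fun l _ => rfl)
    have hi' : (t : ℕ) ≠ i := fun h => hi (Fin.ext h)
    have hj' : (t : ℕ) ≠ j := fun h => hj (Fin.ext h)
    rw [Finset.mem_Iio, Finset.mem_Iio, Equiv.swap_apply_def]
    split_ifs with h1 h2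
    · subst h1; simp only [Fin.lt_def]; omega
    · subst h2; simp only [Fin.lt_def]; omega
    · rfl
  simp only [tau, Equiv.swap_apply_of_ne_of_ne hi hj, h]

/-- A transposition of labels up to `m` does not change the amplitude: the scattering factor is
compensated by the `crossing` factors of the `tau`'s. -/
theorem redAmp_transp_of_lt (R : P.Regular ε k) (hr0 : P.r ≠ 0) {A₀ : BC n → ℂ}
    (hS : ∀ g, ∀ i j : Fin n, (j : ℕ) = i + 1 →
      A₀ (g * transp i j) = P.S (zg k g i) (zg k g j) * A₀ g) {m : ℕ} (g : BC n) {i j : Fin n}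
    (hij : (j : ℕ) = i + 1) (hm : (j : ℕ) < m) :
    P.redAmp ε k A₀ m (g * transp i j) = P.redAmp ε k A₀ m g := by
  have hne : i ≠ j := by rintro rfl; omega
  have hzf : zg k (g * transp i j) = fun l => zg k g (Equiv.swap i j l) :=
    funext fun l => zg_mul_transp k g i j l
  have hi : i ∈ Finset.univ.filter fun t : Fin n => (t : ℕ) < m := by simp; omega
  have hj : j ∈ (Finset.univ.filter fun t : Fin n => (t : ℕ) < m).erase i := by
    simp [hne.symm]; omega
  rw [redAmp, redAmp, hS g i j hij, hzf, ← Finset.mul_prod_erase _ _ hi,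
    ← Finset.mul_prod_erase _ _ hj, ← Finset.mul_prod_erase _ _ hi,
    ← Finset.mul_prod_erase _ _ hj]
  set z := zg k g with hz
  have hrest : ∏ t ∈ ((Finset.univ.filter fun t : Fin n => (t : ℕ) < m).erase i).erase j,
      P.tau ε t (fun l => z (Equiv.swap i j l)) =
      ∏ t ∈ ((Finset.univ.filter fun t : Fin n => (t : ℕ) < m).erase i).erase j,
        P.tau ε t z := by
    refine Finset.prod_congr rfl fun t ht => ?_
    simp only [Finset.mem_erase] at ht
    exact tau_swap_of_ne z hij ht.2.1 ht.1
  rw [hrest]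
  have hIio : Finset.Iio j = insert i (Finset.Iio i) := by
    ext l
    simp only [Finset.mem_Iio, Finset.mem_insert, Fin.lt_def, Fin.ext_iff]
    omega
  have hswap : ∀ y : ℂ, ∏ l ∈ Finset.Iio i, crossing P.r y (z (Equiv.swap i j l)) =
      ∏ l ∈ Finset.Iio i, crossing P.r y (z l) := by
    intro y
    refine Finset.prod_congr rfl fun l hl => ?_
    have hl' : (l : ℕ) < i := Fin.lt_def.mp (Finset.mem_Iio.mp hl)
    rw [Equiv.swap_apply_of_ne_of_ne]
    · rintro rfl; omega
    · rintro rfl; omega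
  have hcS := R.crossing_mul_S hr0 g hne
  have hc1 := R.crossing_node_ne_zero hr0 g (b := (1, i)) (b' := (1, j)) hne
  have hc2 := R.crossing_node_ne_zero hr0 g (b := (1, j)) (b' := (1, i)) hne.symm
  simp only [node_one] at hc1 hc2
  rw [← hz] at hcS hc1 hc2
  have hkey : P.tau ε i (fun l => z (Equiv.swap i j l)) * P.tau ε j (fun l => z (Equiv.swap i j l))
      * P.S (z i) (z j) = P.tau ε i z * P.tau ε j z := by
    have hS' : P.S (z i) (z j) = crossing P.r (z i) (z j) / crossing P.r (z j) (z i) := by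
      rw [← hcS, mul_div_cancel_left₀ _ hc2]
    simp only [tau, hIio, Finset.prod_insert (show i ∉ Finset.Iio i by simp),
      Equiv.swap_apply_left, Equiv.swap_apply_right, hswap, hS']
    generalize crossing P.r (z i) (z j) = c₁ at *
    generalize crossing P.r (z j) (z i) = c₂ at *
    field_simp
  linear_combination (∏ t ∈ ((Finset.univ.filter fun t : Fin n => (t : ℕ) < m).erase i).erase j,
        P.tau ε t z) * A₀ g * hkey

/-- A reflection of the first label changes only the first `tau`, since `crossing` does not
distinguish a momentum from its inverse. -/
theorem redAmp_reflect {A₀ : BC n → ℂ}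
    (hR : ∀ g, ∀ i : Fin n, (i : ℕ) = 0 →
      P.tau ε i (zg k (g * reflect i)) * A₀ (g * reflect i) = P.tau ε i (zg k g) * A₀ g)
    {m : ℕ} (g : BC n) {i : Fin n} (hi0 : (i : ℕ) = 0) (hm : 0 < m) :
    P.redAmp ε k A₀ m (g * reflect i) = P.redAmp ε k A₀ m g := by
  have hi : i ∈ Finset.univ.filter fun t : Fin n => (t : ℕ) < m := by simp; omega
  have hrest : ∏ t ∈ (Finset.univ.filter fun t : Fin n => (t : ℕ) < m).erase i,
      P.tau ε t (zg k (g * reflect i)) =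
      ∏ t ∈ (Finset.univ.filter fun t : Fin n => (t : ℕ) < m).erase i, P.tau ε t (zg k g) := by
    refine Finset.prod_congr rfl fun t ht => ?_
    have hti : t ≠ i := (Finset.mem_erase.mp ht).1
    have h1 : zg k (g * reflect i) t = zg k g t := by rw [zg_mul_reflect, if_neg hti]
    have h2 : ∀ l, crossing P.r (zg k g t) (zg k (g * reflect i) l) =
        crossing P.r (zg k g t) (zg k g l) := by
      intro l
      rw [zg_mul_reflect]
      split_ifs
      · rw [crossing_inv]
      · rfl
    simp only [tau, h1, h2]
  rw [redAmp, redAmp, ← Finset.mul_prod_erase _ _ hi, ← Finset.mul_prod_erase _ _ hi, hrest]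
  linear_combination (∏ t ∈ (Finset.univ.filter fun t : Fin n => (t : ℕ) < m).erase i,
    P.tau ε t (zg k g)) * hR g i hi0

/-- The reduced amplitudes are functions on `BC_n / BC_m`. -/
theorem redAmp_mul_of_mem (R : P.Regular ε k) (hr0 : P.r ≠ 0) {A₀ : BC n → ℂ}
    (hS : ∀ g, ∀ i j : Fin n, (j : ℕ) = i + 1 →
      A₀ (g * transp i j) = P.S (zg k g i) (zg k g j) * A₀ g)
    (hR : ∀ g, ∀ i : Fin n, (i : ℕ) = 0 →
      P.tau ε i (zg k (g * reflect i)) * A₀ (g * reflect i) = P.tau ε i (zg k g) * A₀ g)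
    {m : ℕ} (g : BC n) {h : BC n} (hh : h ∈ BCsub n m) :
    P.redAmp ε k A₀ m (g * h) = P.redAmp ε k A₀ m g := by
  induction hh using Subgroup.closure_induction generalizing g with
  | mem h hh =>
    rcases hh with ⟨i, h1, h2, rfl⟩ | ⟨i, j, h1, h2, rfl⟩
    · exact redAmp_reflect hR g h1 (by omega)
    · exact redAmp_transp_of_lt R hr0 hS g h1 h2
  | one => rw [mul_one]
  | mul x y _ _ ihx ihy => rw [← mul_assoc, ihy, ihx]
  | inv x _ ih =>
    have := ih (g * x⁻¹)
    rwa [inv_mul_cancel_right, eq_comm] at this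

/-- When the letter `x` has been carried to the label `t`, `tau` is the inverse of its weight. -/
theorem tau_carry_mul_leftWeight (R : P.Regular ε k) (hr0 : P.r ≠ 0) (t : Fin n) (g : BC n)
    {x : ℤˣ × Fin n} (hx : x.2 ≤ t) :
    P.tau ε t (zg k (g * carry t x)) * P.leftWeight ε t (zg k g) x = 1 := by
  have hzt : zg k (g * carry t x) t = node (zg k g) x := by rw [zg_mul_carry, if_pos rfl]
  have hprod : ∏ j ∈ Finset.Iio t, crossing P.r (node (zg k g) x) (zg k (g * carry t x) j) =
      ∏ j ∈ (Finset.Iic t).erase x.2, crossing P.r (node (zg k g) x) (zg k g j) := by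
    refine Finset.prod_equiv (Equiv.swap x.2 t) (fun j => ?_) (fun j hj => ?_)
    · rw [Finset.mem_Iio, Finset.mem_erase, Finset.mem_Iic]
      rw [Fin.le_def] at hx
      rw [Equiv.swap_apply_def]
      split_ifs with h1 h2
      · subst h1
        simp only [Fin.lt_def, le_refl, and_true, ne_eq, Fin.ext_iff]; omega
      · subst h2
        simp
      · simp only [Fin.lt_def, Fin.le_def, ne_eq, h1, not_false_eq_true, true_and]
        rw [Fin.ext_iff] at h2
        omega
    · rw [zg_mul_carry, if_neg (ne_of_lt (Finset.mem_Iio.mp hj))]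
  have h1 : node (zg k g) x ^ 2 - 1 ≠ 0 := sub_ne_zero.mpr (R.node_sq_ne_one g x)
  have h2 : P.p₁ ε n (node (zg k g) x) ≠ 0 := by rw [← ev_apply]; exact R.p₁_ne_zero _
  have h3 : P.Vone ε (node (zg k g) x) ≠ 0 := by rw [← ev_apply]; exact R.Vone_ne_zero _
  have h4 : ∏ j ∈ (Finset.Iic t).erase x.2, crossing P.r (node (zg k g) x) (zg k g j) ≠ 0 := by
    refine Finset.prod_ne_zero_iff.mpr fun j hj => ?_
    have := R.crossing_node_ne_zero hr0 g (b := x) (b' := (1, j)) (Finset.mem_erase.mp hj).1.symm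
    rwa [node_one] at this
  rw [tau, leftWeight, hzt, hprod]
  field_simp

/-- Summation over the letter that crosses the left boundary turns `A^{(m)}` into `A^{(m+1)}`. -/
theorem sum_redAmp_carry (R : P.Regular ε k) (hr0 : P.r ≠ 0) {A₀ : BC n → ℂ}
    (hS : ∀ g, ∀ i j : Fin n, (j : ℕ) = i + 1 →
      A₀ (g * transp i j) = P.S (zg k g i) (zg k g j) * A₀ g)
    (hR : ∀ g, ∀ i : Fin n, (i : ℕ) = 0 →
      P.tau ε i (zg k (g * reflect i)) * A₀ (g * reflect i) = P.tau ε i (zg k g) * A₀ g)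
    (t : Fin n) (g : BC n) (φ : ℤˣ × Fin n → ℂ) :
    ∑ x ∈ (Finset.univ : Finset ℤˣ) ×ˢ Finset.Iic t,
        P.redAmp ε k A₀ t (g * carry t x) * φ x =
      P.redAmp ε k A₀ (t + 1) g *
        ∑ x ∈ (Finset.univ : Finset ℤˣ) ×ˢ Finset.Iic t, P.leftWeight ε t (zg k g) x * φ x := by
  rw [Finset.mul_sum]
  refine Finset.sum_congr rfl fun x hx => ?_
  have hx' : x.2 ≤ t := Finset.mem_Iic.mp (Finset.mem_product.mp hx).2
  have h1 := tau_carry_mul_leftWeight R hr0 t g hx'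
  have h2 := redAmp_succ (P := P) (ε := ε) (k := k) A₀ t (g * carry t x)
  have h3 := redAmp_mul_of_mem R hr0 hS hR (m := t + 1) g
    (carry_mem_BCsub (j := t) (m := t + 1) (b := x) (Nat.lt_succ_self _)
      (Nat.lt_succ_of_le hx'))
  rw [← h3, h2]
  linear_combination (-(P.redAmp ε k A₀ t (g * carry t x) * φ x)) * h1

end Amplitudes

end Params

namespace Params

/-! ### Reflection on the right boundary and the Bethe equations -/

section RightBoundary

variable {P : Params} {n : ℕ} {ε : ℤˣ} {k : Fin n → ℂ}

/-- The amplitude ratio of a reflection on the left boundary. -/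
def reflFactor (P : Params) (ε : ℤˣ) (n : ℕ) (z : ℂ) : ℂ :=
  (z ^ 2 - 1) / (P.p₁ ε n z * P.Vone ε z)

theorem tau_of_val_eq_zero {i : Fin n} (hi : (i : ℕ) = 0) (z : Fin n → ℂ) :
    P.tau ε i z = P.reflFactor ε n (z i) := by
  have : Finset.Iio i = ∅ := by
    ext l
    simp only [Finset.mem_Iio, Fin.lt_def, Finset.notMem_empty, iff_false]
    omega
  rw [tau, reflFactor, this, Finset.prod_empty, mul_one]

/-- Reflection of the letter `j`: it scatters on the letters to its left, is reflected on the left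
boundary and scatters again. -/
theorem amp_reflect {A₀ : BC n → ℂ}
    (hS : ∀ g, ∀ i j : Fin n, (j : ℕ) = i + 1 →
      A₀ (g * transp i j) = P.S (zg k g i) (zg k g j) * A₀ g)
    (hR : ∀ g, ∀ i : Fin n, (i : ℕ) = 0 →
      P.tau ε i (zg k (g * reflect i)) * A₀ (g * reflect i) = P.tau ε i (zg k g) * A₀ g)
    (g : BC n) (j : Fin n) :
    P.reflFactor ε n (1 / zg k g j) * A₀ (g * reflect j) =
      P.reflFactor ε n (zg k g j) *
        (∏ i ∈ Finset.Iio j, P.S (zg k g i) (zg k g j) * P.S (1 / zg k g j) (zg k g i)) *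
          A₀ g := by
  obtain ⟨d, hd⟩ : ∃ d : ℕ, (j : ℕ) = d := ⟨j, rfl⟩
  induction d generalizing g j with
  | zero =>
    have h := hR g j hd
    rw [tau_of_val_eq_zero hd, tau_of_val_eq_zero hd, zg_mul_reflect, if_pos rfl] at h
    have : Finset.Iio j = ∅ := by
      ext l
      simp only [Finset.mem_Iio, Fin.lt_def, Finset.notMem_empty, iff_false]
      omega
    rw [this, Finset.prod_empty, mul_one, h]
  | succ d ih =>
    let l : Fin n := ⟨d, by omega⟩
    have hlj : (j : ℕ) = l + 1 := hd
    have hne : l ≠ j := fun h => by rw [h] at hlj; omega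
    have hIio : Finset.Iio j = insert l (Finset.Iio l) := by
      ext i
      simp only [Finset.mem_Iio, Finset.mem_insert, Fin.lt_def, Fin.ext_iff]
      omega
    have h1 := ih (g * transp l j) l rfl
    have h2 := hS (g * transp l j * reflect l) l j hlj
    have h3 := hS g l j hlj
    have e1 : g * transp l j * reflect l * transp l j = g * reflect j := by
      rw [mul_assoc, mul_assoc, ← mul_assoc (transp l j), transp_mul_reflect_mul_transp]
    have e2 : zg k (g * transp l j) l = zg k g j := by
      rw [zg_mul_transp, Equiv.swap_apply_left]
    have e3 : zg k (g * transp l j * reflect l) l = 1 / zg k g j := by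
      rw [zg_mul_reflect, if_pos rfl, e2]
    have e4 : zg k (g * transp l j * reflect l) j = zg k g l := by
      rw [zg_mul_reflect, if_neg hne.symm, zg_mul_transp, Equiv.swap_apply_right]
    have e5 : ∏ i ∈ Finset.Iio l, P.S (zg k (g * transp l j) i) (zg k g j) *
          P.S (1 / zg k g j) (zg k (g * transp l j) i) =
        ∏ i ∈ Finset.Iio l, P.S (zg k g i) (zg k g j) * P.S (1 / zg k g j) (zg k g i) := by
      refine Finset.prod_congr rfl fun i hi => ?_
      have hi' : (i : ℕ) < l := Fin.lt_def.mp (Finset.mem_Iio.mp hi)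
      rw [zg_mul_transp, Equiv.swap_apply_of_ne_of_ne]
      · rintro rfl; omega
      · rintro rfl; omega
    rw [e1, e3, e4] at h2
    rw [e2, e5, h3] at h1
    rw [hIio, Finset.prod_insert (by simp), h2]
    linear_combination P.S (1 / zg k g j) (zg k g l) * h1

/-- `amp_reflect` for the reduced amplitudes: the `tau`'s of the labels below `j` are unchanged. -/
theorem redAmp_reflect_of_le {A₀ : BC n → ℂ}
    (hS : ∀ g, ∀ i j : Fin n, (j : ℕ) = i + 1 →
      A₀ (g * transp i j) = P.S (zg k g i) (zg k g j) * A₀ g)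
    (hR : ∀ g, ∀ i : Fin n, (i : ℕ) = 0 →
      P.tau ε i (zg k (g * reflect i)) * A₀ (g * reflect i) = P.tau ε i (zg k g) * A₀ g)
    {m : ℕ} (g : BC n) {j : Fin n} (hm : m ≤ (j : ℕ)) :
    P.reflFactor ε n (1 / zg k g j) * P.redAmp ε k A₀ m (g * reflect j) =
      P.reflFactor ε n (zg k g j) *
        (∏ i ∈ Finset.Iio j, P.S (zg k g i) (zg k g j) * P.S (1 / zg k g j) (zg k g i)) *
          P.redAmp ε k A₀ m g := by
  have hz : ∀ l : Fin n, (l : ℕ) < m → zg k (g * reflect j) l = zg k g l := by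
    intro l hl
    rw [zg_mul_reflect, if_neg]
    rintro rfl; omega
  have h : ∏ t ∈ Finset.univ.filter fun t : Fin n => (t : ℕ) < m,
      P.tau ε t (zg k (g * reflect j)) =
      ∏ t ∈ Finset.univ.filter fun t : Fin n => (t : ℕ) < m, P.tau ε t (zg k g) := by
    refine Finset.prod_congr rfl fun t ht => ?_
    have ht' : (t : ℕ) < m := by simpa using ht
    have h2 : ∏ l ∈ Finset.Iio t, crossing P.r (zg k g t) (zg k (g * reflect j) l) =
        ∏ l ∈ Finset.Iio t, crossing P.r (zg k g t) (zg k g l) := by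
      refine Finset.prod_congr rfl fun l hl => ?_
      have : (l : ℕ) < t := Fin.lt_def.mp (Finset.mem_Iio.mp hl)
      rw [hz l (by omega)]
    rw [tau, tau, hz t ht', h2]
  have h1 := amp_reflect hS hR g j
  rw [redAmp, redAmp, h]
  linear_combination (∏ t ∈ Finset.univ.filter fun t : Fin n => (t : ℕ) < m,
    P.tau ε t (zg k g)) * h1

theorem Regular.crossing_ev (R : P.Regular ε k) (hr0 : P.r ≠ 0) {b b' : ℤˣ × Fin n}
    (h : b.2 ≠ b'.2) :
    P.a (ev k b) (ev k b') * P.a (ev k b') (1 / ev k b) = crossing P.r (ev k b) (ev k b') := by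
  have := R.crossing_node hr0 1 h
  rwa [← ev_apply, ← ev_apply] at this

/-- Going past a letter `b'` and coming back only depends on `b'` up to sign. -/
theorem Regular.S_mul_S_eq (R : P.Regular ε k) (hr0 : P.r ≠ 0) {b b' : ℤˣ × Fin n}
    (h : b.2 ≠ b'.2) :
    P.S (ev k b') (ev k b) * P.S (1 / ev k b) (ev k b') =
      crossing P.r (1 / ev k b) (ev k (1, b'.2)) / crossing P.r (ev k b) (ev k (1, b'.2)) := by
  have h1 : ∀ y, crossing P.r y (ev k (1, b'.2)) = crossing P.r y (ev k b') := by
    intro y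
    obtain ⟨s, j⟩ := b'
    rcases Int.units_eq_one_or s with rfl | rfl
    · rfl
    · rw [ev_neg, crossing_inv]
  have h2 := R.crossing_ev hr0 h
  have h3 := R.crossing_ev hr0 (b := (-b.1, b.2)) (b' := b') h
  have h4 := R.a_ne_zero b b' h
  have h5 := R.a_ne_zero b' (-b.1, b.2) (Ne.symm h)
  rw [ev_neg] at h3 h5
  rw [one_div_one_div] at h3
  rw [h1, h1, ← h2, ← h3, S, S]
  change P.a (ev k b') (1 / ev k b) ≠ 0 at h5
  change P.a (1 / ev k b) (ev k b') * P.a (ev k b') (ev k b) = _ at h3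
  change -(P.a (ev k b') (ev k b) / P.a (ev k b) (ev k b')) *
    -(P.a (1 / ev k b) (ev k b') / P.a (ev k b') (1 / ev k b)) =
    P.a (1 / ev k b) (ev k b') * P.a (ev k b') (ev k b) /
      (P.a (ev k b) (ev k b') * P.a (ev k b') (1 / ev k b))
  field_simp

/-- The Bethe equation of the letter `b`. -/
theorem bethe_letter (R : P.Regular ε k) (hr0 : P.r ≠ 0) {ε' : ℤˣ} {L : ℕ}
    (hBethe : ∀ j : Fin n,
      ∏ l ∈ Finset.univ.erase j, P.S (ev k (1, l)) (ev k (1, j)) *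
          P.S (ev k (-1, j)) (ev k (1, l)) =
        Complex.exp (2 * Complex.I * L * k j) *
          ((P.Vone ε (ev k (1, j)) * P.VL ε' (ev k (1, j))) /
            (P.Vone ε (ev k (-1, j)) * P.VL ε' (ev k (-1, j)))))
    (b : ℤˣ × Fin n) :
    ∏ l ∈ Finset.univ.erase b.2, crossing P.r (1 / ev k b) (ev k (1, l)) /
        crossing P.r (ev k b) (ev k (1, l)) =
      ev k b ^ (2 * L) * ((P.Vone ε (ev k b) * P.VL ε' (ev k b)) /
            (P.Vone ε (1 / ev k b) * P.VL ε' (1 / ev k b))) := by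
  obtain ⟨s, j⟩ := b
  have h1 : ∏ l ∈ Finset.univ.erase j, crossing P.r (1 / ev k (1, j)) (ev k (1, l)) /
        crossing P.r (ev k (1, j)) (ev k (1, l)) =
      ev k (1, j) ^ (2 * L) * ((P.Vone ε (ev k (1, j)) * P.VL ε' (ev k (1, j))) /
            (P.Vone ε (1 / ev k (1, j)) * P.VL ε' (1 / ev k (1, j)))) := by
    have hexp : Complex.exp (2 * Complex.I * L * k j) = ev k (1, j) ^ (2 * L) := by
      rw [ev, ← Complex.exp_nat_mul]
      congr 1
      push_cast
      ring
    rw [← hexp, ← ev_neg, ← hBethe j]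
    refine Finset.prod_congr rfl fun l hl => ?_
    have := R.S_mul_S_eq hr0 (b := (1, j)) (b' := (1, l)) (Finset.ne_of_mem_erase hl).symm
    rw [← ev_neg] at this
    exact this.symm
  rcases Int.units_eq_one_or s with rfl | rfl
  · exact h1
  · have h2 := congrArg (·⁻¹) h1
    simp only [← Finset.prod_inv_distrib, inv_div, mul_inv] at h2
    simpa only [ev_neg, one_div_one_div, one_div_pow, one_div (ev k (1, j) ^ (2 * L))] using h2

/-- The product of the scattering factors in a reflection on the left of the last letter, by the
Bethe equations. -/
theorem prod_S_eq_of_bethe (R : P.Regular ε k) (hr0 : P.r ≠ 0) {ε' : ℤˣ} {L : ℕ}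
    (hBethe : ∀ j : Fin n,
      ∏ l ∈ Finset.univ.erase j, P.S (ev k (1, l)) (ev k (1, j)) *
          P.S (ev k (-1, j)) (ev k (1, l)) =
        Complex.exp (2 * Complex.I * L * k j) *
          ((P.Vone ε (ev k (1, j)) * P.VL ε' (ev k (1, j))) /
            (P.Vone ε (ev k (-1, j)) * P.VL ε' (ev k (-1, j)))))
    (g : BC n) {j : Fin n} (hj : (j : ℕ) + 1 = n) :
    ∏ i ∈ Finset.Iio j, P.S (zg k g i) (zg k g j) * P.S (1 / zg k g j) (zg k g i) =
      zg k g j ^ (2 * L) * ((P.Vone ε (zg k g j) * P.VL ε' (zg k g j)) /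
            (P.Vone ε (1 / zg k g j) * P.VL ε' (1 / zg k g j))) := by
  have hIio : Finset.Iio j = Finset.univ.erase j := by
    ext l
    simp only [Finset.mem_Iio, Finset.mem_erase, Finset.mem_univ, and_true, Fin.lt_def, ne_eq,
      Fin.ext_iff]
    omega
  have hinj : Function.Injective fun i : Fin n => (g.1 (1, i)).2 := by
    intro i i' h
    by_contra hne
    exact BC_snd_ne g (b := (1, i)) (b' := (1, i')) hne h
  let e : Fin n ≃ Fin n := Equiv.ofBijective _ (Finite.injective_iff_bijective.mp hinj)
  have he : ∀ i, e i = (g.1 (1, i)).2 := fun i => rfl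
  change _ = ev k (g.1 (1, j)) ^ (2 * L) * ((P.Vone ε (ev k (g.1 (1, j)))
    * P.VL ε' (ev k (g.1 (1, j)))) / (P.Vone ε (1 / ev k (g.1 (1, j)))
    * P.VL ε' (1 / ev k (g.1 (1, j)))))
  rw [← bethe_letter R hr0 hBethe (g.1 (1, j)), hIio]
  refine Finset.prod_equiv e (fun i => ?_) (fun i hi => ?_)
  · simp only [Finset.mem_erase, Finset.mem_univ, and_true, ne_eq, ← he]
    rw [e.injective.eq_iff]
  · rw [he]
    exact R.S_mul_S_eq hr0 (BC_snd_ne g (b := (1, j)) (b' := (1, i))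
      (Finset.ne_of_mem_erase hi).symm)

/-- The function `V_L` factorizes: `p₁(z)` is one factor because `u_{n+1}` and `v_n` are roots of
the two right boundary quadratics, and the other factor is the coefficient of the right boundary
term. -/
theorem mul_VL_eq {ε' : ℤˣ} (hp : P.p ≠ 0) (hq : P.q ≠ 0) (hr : P.r ^ 2 = P.q / P.p)
    (hn : 0 < n) (hvu : P.v n 1 ≠ P.u ε 2)
    (hu : (1 - P.u ε (n + 1)) * (P.β + P.δ * P.u ε (n + 1)) = 0)
    (hv : P.δ * P.v n n ^ 2 + (P.β - P.δ + P.q - P.p) * P.v n n - P.β = 0)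
    (hlam : lam (-ε') P.β P.δ = P.δ * (P.u ε (n + 1) - 1)) {z : ℂ} (hz : z ≠ 0) :
    z * P.VL ε' z = P.p₁ ε n z *
      (P.sqrtpq * z - (P.q + P.δ * (P.v n n - 1) - P.δ * (P.u ε (n + 1) - 1))) := by
  obtain ⟨m, rfl⟩ : ∃ m, n = m + 1 := ⟨n - 1, by omega⟩
  have hr0 := r_ne_zero hp hq hr
  have hq' := q_eq hp hr
  have hvu' := sub_ne_zero.mpr (P.v_ne_u hp hq hvu m)
  have hs : (P.q / P.p) ^ m ≠ 0 := pow_ne_zero _ (div_ne_zero hq hp)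
  have h1 : (P.q / P.p) ^ m * P.v (m + 1) 1 = P.v (m + 1) (m + 1) :=
    (P.v_succ hp hq (m + 1) m).symm
  have h2 : (P.q / P.p) ^ m * P.u ε 2 = P.u ε (m + 1 + 1) := by
    have h : P.u ε 2 = P.q / P.p * P.u ε 1 := by simpa using P.u_succ hp hq ε 1
    rw [P.u_succ hp hq ε (m + 1), pow_succ, h]; ring
  have h3 : (P.p * P.u ε 2 - P.q * P.v (m + 1) 1) / (P.v (m + 1) 1 - P.u ε 2) =
      (P.p * P.u ε (m + 1 + 1) - P.q * P.v (m + 1) (m + 1)) /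
        (P.v (m + 1) (m + 1) - P.u ε (m + 1 + 1)) := by
    rw [← h1, ← h2, ← mul_div_mul_left _ _ hs]
    congr 1 <;> ring
  rw [p₁, h3, VL, hlam, Lam, sqrtpq]
  generalize P.v (m + 1) (m + 1) = v at *
  generalize P.u ε (m + 1 + 1) = u at *
  rw [hq'] at hv ⊢
  field_simp
  linear_combination (P.r * z - P.r ^ 2) * hv + (P.r * z - P.r ^ 2) * hu

/-- The two terms that a reflection on the right boundary exchanges cancel. -/
theorem right_cancel (R : P.Regular ε k) {ε' : ℤˣ} {L : ℕ} (hp : P.p ≠ 0) (hq : P.q ≠ 0)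
    (hr : P.r ^ 2 = P.q / P.p) (hvu : 0 < n → P.v n 1 ≠ P.u ε 2)
    (hu : (1 - P.u ε (n + 1)) * (P.β + P.δ * P.u ε (n + 1)) = 0)
    (hv : 0 < n → P.δ * P.v n n ^ 2 + (P.β - P.δ + P.q - P.p) * P.v n n - P.β = 0)
    (hlam : lam (-ε') P.β P.δ = P.δ * (P.u ε (n + 1) - 1))
    (hVL : ∀ b, P.VL ε' (ev k b) ≠ 0)
    (hBethe : ∀ j : Fin n,
      ∏ l ∈ Finset.univ.erase j, P.S (ev k (1, l)) (ev k (1, j)) *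
          P.S (ev k (-1, j)) (ev k (1, l)) =
        Complex.exp (2 * Complex.I * L * k j) *
          ((P.Vone ε (ev k (1, j)) * P.VL ε' (ev k (1, j))) /
            (P.Vone ε (ev k (-1, j)) * P.VL ε' (ev k (-1, j)))))
    {A₀ : BC n → ℂ}
    (hS : ∀ g, ∀ i j : Fin n, (j : ℕ) = i + 1 →
      A₀ (g * transp i j) = P.S (zg k g i) (zg k g j) * A₀ g)
    (hR : ∀ g, ∀ i : Fin n, (i : ℕ) = 0 →
      P.tau ε i (zg k (g * reflect i)) * A₀ (g * reflect i) = P.tau ε i (zg k g) * A₀ g)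
    {m : ℕ} (g : BC n) {j : Fin n} (hj : (j : ℕ) + 1 = n) (hm : m ≤ (j : ℕ)) (B : ℂ)
    (hB : B = P.q + P.δ * (P.v n n - 1) - P.δ * (P.u ε (n + 1) - 1)) :
    P.redAmp ε k A₀ m (g * reflect j) * (P.sqrtpq * (1 / zg k g j) - B) * (1 / zg k g j) ^ L
      + P.redAmp ε k A₀ m g * (P.sqrtpq * zg k g j - B) * zg k g j ^ L = 0 := by
  have hr0 := r_ne_zero hp hq hr
  have hn : 0 < n := by omega
  have h1 := redAmp_reflect_of_le hS hR (m := m) g hm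
  rw [prod_S_eq_of_bethe R hr0 hBethe g hj] at h1
  have hz0 := zg_ne_zero k g j
  have hfac := fun {w : ℂ} (hw : w ≠ 0) =>
    mul_VL_eq (ε := ε) (ε' := ε') hp hq hr hn (hvu hn) hu (hv hn) hlam hw
  have f1 := hfac hz0
  have f2 := hfac (one_div_ne_zero hz0)
  rw [← hB] at f1 f2
  have hinv : 1 / zg k g j = ev k (-(g.1 (1, j)).1, (g.1 (1, j)).2) := by
    rw [ev_neg]; rfl
  have n1 : P.p₁ ε n (zg k g j) ≠ 0 := R.p₁_ne_zero _
  have n2 : P.p₁ ε n (1 / zg k g j) ≠ 0 := by rw [hinv]; exact R.p₁_ne_zero _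
  have n3 : P.Vone ε (zg k g j) ≠ 0 := R.Vone_ne_zero _
  have n4 : P.Vone ε (1 / zg k g j) ≠ 0 := by rw [hinv]; exact R.Vone_ne_zero _
  have n6 : P.VL ε' (1 / zg k g j) ≠ 0 := by rw [hinv]; exact hVL _
  have n7 : zg k g j ^ 2 - 1 ≠ 0 := sub_ne_zero.mpr (R.sq_ne_one _)
  have f1' : P.sqrtpq * zg k g j - B = zg k g j * P.VL ε' (zg k g j) / P.p₁ ε n (zg k g j) := by
    rw [f1, mul_div_cancel_left₀ _ n1]
  have f2' : P.sqrtpq * (1 / zg k g j) - B =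
      1 / zg k g j * P.VL ε' (1 / zg k g j) / P.p₁ ε n (1 / zg k g j) := by
    rw [f2, mul_div_cancel_left₀ _ n2]
  have hsq : (1 / zg k g j) ^ 2 - 1 = -(zg k g j ^ 2 - 1) / zg k g j ^ 2 := by
    field_simp; ring
  rw [f1', f2']
  rw [reflFactor, reflFactor, hsq] at h1
  generalize P.p₁ ε n (zg k g j) = a₁ at *
  generalize P.p₁ ε n (1 / zg k g j) = a₂ at *
  generalize P.Vone ε (zg k g j) = b₁ at *
  generalize P.Vone ε (1 / zg k g j) = b₂ at *
  generalize P.VL ε' (zg k g j) = c₁ at *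
  generalize P.VL ε' (1 / zg k g j) = c₂ at *
  generalize P.redAmp ε k A₀ m (g * reflect j) = x at *
  generalize P.redAmp ε k A₀ m g = y at *
  generalize zg k g j ^ 2 - 1 = w at *
  generalize zg k g j = z at *
  have hx : x = -(z ^ 2 * z ^ (2 * L) * a₂ * c₁ / (a₁ * c₂)) * y := by
    field_simp at h1 ⊢
    linear_combination -h1
  have hzL : z ^ L ≠ 0 := pow_ne_zero _ hz0
  rw [hx, one_div_pow, two_mul, pow_add]
  generalize z ^ L = Z at *
  field_simp
  ring

end RightBoundary

end Params

/-! ### Plane waves -/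

section PlaneWave

variable {L : ℕ}

/-- The plane wave of the excitations that occupy `X`, where the excitation of label `j` has the
exponential `ζ j`, with the power of `r = √(q/p)` of the ansatz vectors. -/
def planeWave (r : ℂ) (n : ℕ) (ζ : ℕ → ℂ) (X : Finset (Fin L)) : ℂ :=
  ∏ l ∈ X, (ζ (lab n X l) ^ ((l : ℕ) + 1) * r ^ (l : ℕ))

theorem planeWave_hop (r : ℂ) (n : ℕ) (ζ : ℕ → ℂ) {X : Finset (Fin L)} {i j : Fin L}
    (hij : (j : ℕ) = i + 1) (hi : i ∈ X) (hj : j ∉ X) :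
    planeWave r n ζ (hop i j X) = r * ζ (lab n X i) * planeWave r n ζ X := by
  have hne : i ≠ j := by rintro rfl; omega
  have hmi : i ∉ hop i j X := by rwa [mem_hop, Equiv.swap_apply_left]
  have hmj : j ∈ hop i j X := by rwa [mem_hop, Equiv.swap_apply_right]
  have hY : (hop i j X).erase j = X.erase i := by
    ext l
    by_cases h1 : l = i
    · subst h1; simp [hmi]
    · by_cases h2 : l = j
      · subst h2; simp [hj]
      · simp [h1, h2, mem_hop, Equiv.swap_apply_of_ne_of_ne h1 h2]
  have hlab : lab n (hop i j X) j = lab n X i := by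
    rw [lab_succ n _ hij, if_neg hmi, add_zero, lab_hop n X hij hne]
  rw [planeWave, planeWave, ← Finset.mul_prod_erase _ _ hmj, ← Finset.mul_prod_erase _ _ hi, hY,
    hlab, hij]
  have : ∏ l ∈ X.erase i, (ζ (lab n (hop i j X) l) ^ ((l : ℕ) + 1) * r ^ (l : ℕ)) =
      ∏ l ∈ X.erase i, (ζ (lab n X l) ^ ((l : ℕ) + 1) * r ^ (l : ℕ)) := by
    refine Finset.prod_congr rfl fun l hl => ?_
    rw [lab_hop n X hij]
    rintro rfl
    exact hj (Finset.mem_of_mem_erase hl)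
  rw [this]
  ring

theorem planeWave_flip (r : ℂ) {n : ℕ} (ζ : ℕ → ℂ) {X : Finset (Fin L)} {i : Fin L}
    (hi : (i : ℕ) = 0) (hX : X.card ≤ n) (hX' : (flip i X).card ≤ n) (h : i ∉ X) :
    planeWave r n ζ (flip i X) = ζ (n - (flip i X).card) * planeWave r n ζ X := by
  have hm : i ∈ flip i X := mem_flip_self.mpr h
  have hY : (flip i X).erase i = X := by rw [flip, if_neg h, Finset.erase_insert h]
  rw [planeWave, ← Finset.mul_prod_erase _ _ hm, hY, lab_of_val_eq_zero n _ hi, hi, planeWave,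
    pow_zero, mul_one, zero_add, pow_one]
  congr 1
  refine Finset.prod_congr rfl fun l hl => ?_
  rw [lab_flip hX hX' hi]
  rintro rfl
  exact h hl

theorem planeWave_congr (r : ℂ) {n : ℕ} {ζ ζ' : ℕ → ℂ} {X : Finset (Fin L)}
    (h : ∀ j, n - X.card ≤ j → ζ j = ζ' j) : planeWave r n ζ X = planeWave r n ζ' X :=
  Finset.prod_congr rfl fun l _ => by rw [h _ (le_lab n X l)]

theorem sum_lab {n : ℕ} {X : Finset (Fin L)} (hX : X.card ≤ n) (f : ℕ → ℂ) :
    ∑ l ∈ X, f (lab n X l) = ∑ j ∈ Finset.Ico (n - X.card) n, f j := by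
  have hinj : Set.InjOn (lab n X) X := (lab_strictMonoOn n X).injOn
  have himg : X.image (lab n X) = Finset.Ico (n - X.card) n := by
    refine Finset.eq_of_subset_of_card_le ?_ ?_
    · intro j hj
      obtain ⟨l, hl, rfl⟩ := Finset.mem_image.mp hj
      exact Finset.mem_Ico.mpr ⟨le_lab n X l, lab_lt hX hl⟩
    · rw [Finset.card_image_of_injOn hinj, Nat.card_Ico]
      omega
  rw [← himg, Finset.sum_image hinj]

namespace Params

/-- The hops of a plane wave: its energy, except for the boundary and contact terms. -/
theorem sum_hop_planeWave {P : Params} (hp : P.p ≠ 0)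
    (hr : P.r ^ 2 = P.q / P.p) (n : ℕ) {ζ : ℕ → ℂ} (hζ : ∀ j, ζ j ≠ 0) (X : Finset (Fin L))
    {i₀ i₁ : Fin L} (hi₀ : (i₀ : ℕ) = 0) (hi₁ : (i₁ : ℕ) + 1 = L) :
    (∑ i : Fin L, ∑ j : Fin L, if (j : ℕ) = i + 1 then
        P.hopRate i j (hop i j X) * planeWave P.r n ζ (hop i j X)
          - P.hopRate i j X * planeWave P.r n ζ X else 0) =
      planeWave P.r n ζ X * (∑ l ∈ X, P.Lam (ζ (lab n X l))
        - (if i₁ ∈ X then P.sqrtpq * ζ (lab n X i₁) - P.q else 0)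
        - (if i₀ ∈ X then P.sqrtpq * (1 / ζ (lab n X i₀)) - P.p else 0))
      - ∑ i : Fin L, ∑ j : Fin L, if (j : ℕ) = i + 1 ∧ i ∈ X ∧ j ∈ X then
          planeWave P.r n ζ X * (P.sqrtpq * (ζ (lab n X i) + 1 / ζ (lab n X j)) - P.p - P.q)
          else 0 := by
  have hq' := q_eq hp hr
  set e := planeWave P.r n ζ X with he
  let fR : Fin L → ℂ := fun l => if l ∈ X then P.sqrtpq * ζ (lab n X l) - P.q else 0
  let fL : Fin L → ℂ := fun l => if l ∈ X then P.sqrtpq * (1 / ζ (lab n X l)) - P.p else 0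
  have hbond : ∀ i j : Fin L, (if (j : ℕ) = i + 1 then
        P.hopRate i j (hop i j X) * planeWave P.r n ζ (hop i j X)
          - P.hopRate i j X * e else 0) =
      e * (if (j : ℕ) = i + 1 then fR i + fL j else 0)
        - if (j : ℕ) = i + 1 ∧ i ∈ X ∧ j ∈ X then
          e * (P.sqrtpq * (ζ (lab n X i) + 1 / ζ (lab n X j)) - P.p - P.q) else 0 := by
    intro i j
    by_cases hij : (j : ℕ) = i + 1
    · have hmi : i ∈ hop i j X ↔ j ∈ X := by rw [mem_hop, Equiv.swap_apply_left]
      have hmj : j ∈ hop i j X ↔ i ∈ X := by rw [mem_hop, Equiv.swap_apply_right]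
      have hne : i ≠ j := by rintro rfl; omega
      by_cases hi : i ∈ X <;> by_cases hj : j ∈ X
      · simp only [hij, hopRate, hi, hj, hmi, hmj, fR, fL, if_true, and_self]
        ring
      · simp only [hij, hopRate, hi, hj, hmi, hmj, fR, fL, if_true, if_false, and_false,
          planeWave_hop P.r n ζ hij hi hj, sqrtpq]
        ring
      · have h1 := planeWave_hop P.r n ζ hij (hmi.mpr hj) (by rw [hmj]; exact hi)
        rw [hop_hop, lab_hop n X hij hne] at h1
        have h2 : lab n X j = lab n X i := by rw [lab_succ n X hij, if_neg hi, add_zero]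
        have h3 := hζ (lab n X i)
        simp only [hij, hopRate, hi, hj, hmi, hmj, fR, fL, if_true, if_false, false_and,
          and_false, h2, sqrtpq]
        rw [he, h1, hq']
        field_simp
        ring
      · simp [hij, hopRate, hi, hj, hmi, hmj, fR, fL]
    · simp [hij]
  have hR : ∑ i : Fin L, ∑ j : Fin L, (if (j : ℕ) = i + 1 then fR i else 0) =
      ∑ l, fR l - fR i₁ := by
    rw [eq_sub_iff_add_eq, ← Finset.sum_erase_add _ _ (Finset.mem_univ i₁),
      ← Finset.sum_erase_add (Finset.univ : Finset (Fin L)) fR (Finset.mem_univ i₁)]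
    congr 1
    rw [add_eq_left.mpr]
    · refine Finset.sum_congr rfl fun i hi => ?_
      have hi' : (i : ℕ) ≠ i₁ := fun h => Finset.ne_of_mem_erase hi (Fin.ext h)
      have := i.2
      rw [Finset.sum_eq_single ⟨i + 1, by omega⟩]
      · exact if_pos rfl
      · intro j _ hj
        exact if_neg fun h => hj (Fin.ext h)
      · simp
    · exact Finset.sum_eq_zero fun j _ => if_neg (by have := j.2; omega)
  have hL : ∑ i : Fin L, ∑ j : Fin L, (if (j : ℕ) = i + 1 then fL j else 0) =
      ∑ l, fL l - fL i₀ := by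
    rw [Finset.sum_comm, eq_sub_iff_add_eq, ← Finset.sum_erase_add _ _ (Finset.mem_univ i₀),
      ← Finset.sum_erase_add (Finset.univ : Finset (Fin L)) fL (Finset.mem_univ i₀)]
    congr 1
    rw [add_eq_left.mpr]
    · refine Finset.sum_congr rfl fun j hj => ?_
      have hj' : (j : ℕ) ≠ i₀ := fun h => Finset.ne_of_mem_erase hj (Fin.ext h)
      rw [Finset.sum_eq_single ⟨j - 1, by omega⟩]
      · exact if_pos (by simp; omega)
      · intro i _ hi
        exact if_neg fun h => hi (Fin.ext (by simp; omega))
      · simp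
    · exact Finset.sum_eq_zero fun j _ => if_neg (by omega)
  have hLam : ∑ l ∈ X, P.Lam (ζ (lab n X l)) = ∑ l, fR l + ∑ l, fL l := by
    simp only [fR, fL, ← Finset.sum_filter, Finset.filter_mem_eq_inter, Finset.univ_inter]
    rw [← Finset.sum_add_distrib]
    refine Finset.sum_congr rfl fun l _ => ?_
    rw [Lam]; ring
  have hsplit : ∀ i j : Fin L, (if (j : ℕ) = i + 1 then fR i + fL j else 0) =
      (if (j : ℕ) = i + 1 then fR i else 0) + if (j : ℕ) = i + 1 then fL j else 0 := by
    intro i j; split_ifs <;> simp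
  rw [Finset.sum_congr rfl fun i _ => Finset.sum_congr rfl fun j _ => hbond i j]
  simp only [Finset.sum_sub_distrib, ← Finset.mul_sum, hsplit, Finset.sum_add_distrib, hR,
    hL]
  rw [hLam]
  simp only [fR, fL]
  ring

end Params

end PlaneWave

/-! ### The coefficients of the ansatz -/

/-- The exponentials `e^{i k_{g j}}` as a function of the label `j`, counted from `0`. The value `1`
beyond the last label is irrelevant. -/
def zext {n : ℕ} (k : Fin n → ℂ) (g : BC n) (j : ℕ) : ℂ :=
  if h : j < n then zg k g ⟨j, h⟩ else 1

theorem zext_val {n : ℕ} (k : Fin n → ℂ) (g : BC n) (j : Fin n) : zext k g j = zg k g j := by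
  rw [zext, dif_pos j.2]

theorem zext_ne_zero {n : ℕ} (k : Fin n → ℂ) (g : BC n) (j : ℕ) : zext k g j ≠ 0 := by
  unfold zext
  split_ifs
  · exact zg_ne_zero k g _
  · exact one_ne_zero

theorem zext_congr {n : ℕ} {k : Fin n → ℂ} {g g' : BC n} {j : ℕ}
    (h : ∀ i : Fin n, (i : ℕ) = j → zg k g i = zg k g' i) : zext k g j = zext k g' j := by
  unfold zext
  split_ifs with hj
  · exact h _ rfl
  · rfl

theorem sum_eq_zero_of_mul_right {G : Type*} [Group G] [Fintype G] (σ : G) (F : G → ℂ)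
    (h : ∀ g, F (g * σ) + F g = 0) : ∑ g, F g = 0 := by
  have h1 : ∑ g, F (g * σ) = ∑ g, F g := Fintype.sum_equiv (Equiv.mulRight σ) _ _ fun g => rfl
  have h2 : ∑ g, F (g * σ) + ∑ g, F g = 0 := by
    rw [← Finset.sum_add_distrib]
    exact Finset.sum_eq_zero fun g _ => h g
  rw [h1] at h2
  exact add_self_eq_zero.mp h2

/-- A sum over the group, averaged over the letters that can be carried to the label `t`. -/
theorem card_mul_sum_eq_sum_carry {n : ℕ} (t : Fin n) (F : BC n → ℂ) :
    (2 * ((t : ℂ) + 1)) * ∑ g, F g =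
      ∑ g, ∑ x ∈ (Finset.univ : Finset ℤˣ) ×ˢ Finset.Iic t, F (g * carry t x) := by
  rw [Finset.sum_comm]
  have : ∀ x : ℤˣ × Fin n, ∑ g, F (g * carry t x) = ∑ g, F g := fun x =>
    Fintype.sum_equiv (Equiv.mulRight (carry t x)) _ _ fun g => rfl
  simp only [this, Finset.sum_const, Finset.card_product, Fin.card_Iic, nsmul_eq_mul,
    Finset.card_univ, Fintype.card_units_int]
  push_cast
  ring

namespace Params

section Coefficients

variable {P : Params} {ε : ℤˣ} {n L : ℕ} {k : Fin n → ℂ}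

/-- Two adjacent excitations: the scattering matrix cancels the contact terms. -/
theorem sum_contact (R : P.Regular ε k) (hp : P.p ≠ 0) (hq : P.q ≠ 0)
    (hr : P.r ^ 2 = P.q / P.p) {A₀ : BC n → ℂ}
    (hS : ∀ g, ∀ i j : Fin n, (j : ℕ) = i + 1 →
      A₀ (g * transp i j) = P.S (zg k g i) (zg k g j) * A₀ g)
    {X : Finset (Fin L)} (hX : X.card ≤ n) {i j : Fin L} (hij : (j : ℕ) = i + 1) (hi : i ∈ X)
    (hj : j ∈ X) :
    ∑ g, P.redAmp ε k A₀ (n - X.card) g * (planeWave P.r n (zext k g) X *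
      (P.sqrtpq * (zext k g (lab n X i) + 1 / zext k g (lab n X j)) - P.p - P.q)) = 0 := by
  have hr0 := r_ne_zero hp hq hr
  have hq' := q_eq hp hr
  have hlab : lab n X j = lab n X i + 1 := by rw [lab_succ n X hij, if_pos hi]
  obtain ⟨a, ha⟩ : ∃ a : Fin n, (a : ℕ) = lab n X i := ⟨⟨_, lab_lt hX hi⟩, rfl⟩
  obtain ⟨b, hb⟩ : ∃ b : Fin n, (b : ℕ) = lab n X j := ⟨⟨_, lab_lt hX hj⟩, rfl⟩
  have hab : (b : ℕ) = a + 1 := by omega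
  have hne : a ≠ b := by rintro rfl; omega
  have hijne : j ∈ X.erase i := Finset.mem_erase.mpr ⟨by rintro rfl; omega, hj⟩
  have hpw : ∀ g, planeWave P.r n (zext k g) X =
      zg k g a ^ ((i : ℕ) + 1) * P.r ^ (i : ℕ) * (zg k g b ^ ((j : ℕ) + 1) * P.r ^ (j : ℕ) *
        ∏ l ∈ (X.erase i).erase j, (zext k g (lab n X l) ^ ((l : ℕ) + 1) * P.r ^ (l : ℕ))) := by
    intro g
    rw [planeWave, ← Finset.mul_prod_erase _ _ hi, ← Finset.mul_prod_erase _ _ hijne, ← ha, ← hb,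
      zext_val, zext_val]
  refine sum_eq_zero_of_mul_right (transp a b) _ fun g => ?_
  have hrest : ∏ l ∈ (X.erase i).erase j,
        (zext k (g * transp a b) (lab n X l) ^ ((l : ℕ) + 1) * P.r ^ (l : ℕ)) =
      ∏ l ∈ (X.erase i).erase j, (zext k g (lab n X l) ^ ((l : ℕ) + 1) * P.r ^ (l : ℕ)) := by
    refine Finset.prod_congr rfl fun l hl => ?_
    simp only [Finset.mem_erase] at hl
    rw [zext_congr (g' := g)]
    intro c hc
    rw [zg_mul_transp, Equiv.swap_apply_of_ne_of_ne]
    · rintro rfl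
      exact hl.2.1 ((lab_strictMonoOn n X).injOn hl.2.2 hi (by omega))
    · rintro rfl
      exact hl.1 ((lab_strictMonoOn n X).injOn hl.2.2 hj (by omega))
  have hm : n - X.card ≤ (a : ℕ) := by rw [ha]; exact le_lab n X i
  rw [redAmp_transp_of_le hS g hab hm, hpw, hpw, hrest, ← ha, ← hb, zext_val, zext_val, zext_val,
    zext_val, zg_mul_transp, zg_mul_transp, Equiv.swap_apply_left, Equiv.swap_apply_right, S,
    Params.a, Params.a, hij]
  have h1 : P.a (zg k g b) (zg k g a) ≠ 0 := by
    have := R.a_node_ne_zero g (b := (1, b)) (b' := (1, a)) hne.symm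
    simpa only [node_one] using this
  have h2 : zg k g a * zg k g b - 1 ≠ 0 := by
    have := R.node_mul_node_ne_one g (b := (1, a)) (b' := (1, b)) hne
    rw [node_one, node_one] at this
    exact sub_ne_zero.mpr this
  have h2' : zg k g b * zg k g a - 1 ≠ 0 := by rwa [mul_comm]
  have h3 := zg_ne_zero k g a
  have h4 := zg_ne_zero k g b
  rw [Params.a] at h1
  have h5 : (P.r + 1 / P.r) * zg k g a - zg k g b * zg k g a - 1 ≠ 0 :=
    right_ne_zero_of_mul h1
  have h6 : Complex.I / (zg k g b * zg k g a - 1) ≠ 0 := left_ne_zero_of_mul h1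
  have h7 : ∀ x y : ℂ, y ≠ 0 → P.sqrtpq * (x + 1 / y) - P.p - P.q =
      -P.sqrtpq * ((P.r + 1 / P.r) * y - x * y - 1) / y := by
    intro x y hy
    rw [sqrtpq, hq']
    field_simp
    ring
  rw [h7 _ _ h3, h7 _ _ h4]
  rw [mul_comm (zg k g b) (zg k g a)] at h6 h5 ⊢
  rw [mul_div_mul_left _ _ h6]
  generalize (P.r + 1 / P.r) * zg k g a - zg k g a * zg k g b - 1 = N₁ at *
  generalize (P.r + 1 / P.r) * zg k g b - zg k g a * zg k g b - 1 = N₂ at *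
  generalize P.redAmp ε k A₀ (n - X.card) g = y
  field_simp
  ring

/-- The right boundary term, together with the missing hop of an excitation on the last site,
contributes `λ_{-ε'}` to the energy, thanks to the reflection of the last label. -/
theorem sum_right (R : P.Regular ε k) {ε' : ℤˣ} (hp : P.p ≠ 0) (hq : P.q ≠ 0)
    (hr : P.r ^ 2 = P.q / P.p) (hvu : 0 < n → P.v n 1 ≠ P.u ε 2)
    (hu : (1 - P.u ε (n + 1)) * (P.β + P.δ * P.u ε (n + 1)) = 0)
    (hv : 0 < n → P.δ * P.v n n ^ 2 + (P.β - P.δ + P.q - P.p) * P.v n n - P.β = 0)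
    (hlam : lam (-ε') P.β P.δ = P.δ * (P.u ε (n + 1) - 1))
    (hVL : ∀ b, P.VL ε' (ev k b) ≠ 0)
    (hBethe : ∀ j : Fin n,
      ∏ l ∈ Finset.univ.erase j, P.S (ev k (1, l)) (ev k (1, j)) *
          P.S (ev k (-1, j)) (ev k (1, l)) =
        Complex.exp (2 * Complex.I * L * k j) *
          ((P.Vone ε (ev k (1, j)) * P.VL ε' (ev k (1, j))) /
            (P.Vone ε (ev k (-1, j)) * P.VL ε' (ev k (-1, j)))))
    {A₀ : BC n → ℂ}
    (hS : ∀ g, ∀ i j : Fin n, (j : ℕ) = i + 1 →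
      A₀ (g * transp i j) = P.S (zg k g i) (zg k g j) * A₀ g)
    (hR : ∀ g, ∀ i : Fin n, (i : ℕ) = 0 →
      P.tau ε i (zg k (g * reflect i)) * A₀ (g * reflect i) = P.tau ε i (zg k g) * A₀ g)
    {X : Finset (Fin L)} (hX : X.card ≤ n) {i : Fin L} (hi : (i : ℕ) + 1 = L) :
    ∑ g, P.redAmp ε k A₀ (n - X.card) g * (planeWave P.r n (zext k g) X *
      (P.rightDiag ε n i X - (if i ∈ X then P.sqrtpq * zext k g (lab n X i) - P.q else 0)
        - lam (-ε') P.β P.δ)) = 0 := by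
  by_cases h : i ∈ X
  · obtain ⟨a, ha⟩ : ∃ a : Fin n, (a : ℕ) = lab n X i := ⟨⟨_, lab_lt hX h⟩, rfl⟩
    have hlast : (a : ℕ) + 1 = n := by
      have h1 := lab_of_last hX hi
      rw [if_pos h] at h1
      have := a.2
      omega
    have hm : n - X.card ≤ (a : ℕ) := by rw [ha]; exact le_lab n X i
    refine sum_eq_zero_of_mul_right (reflect a) _ fun g => ?_
    have hpw : ∀ g, planeWave P.r n (zext k g) X =
        zg k g a ^ L * P.r ^ (i : ℕ) *
          ∏ l ∈ X.erase i, (zext k g (lab n X l) ^ ((l : ℕ) + 1) * P.r ^ (l : ℕ)) := by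
      intro g
      rw [planeWave, ← Finset.mul_prod_erase _ _ h, ← ha, zext_val, hi]
    have hrest : ∏ l ∈ X.erase i,
          (zext k (g * reflect a) (lab n X l) ^ ((l : ℕ) + 1) * P.r ^ (l : ℕ)) =
        ∏ l ∈ X.erase i, (zext k g (lab n X l) ^ ((l : ℕ) + 1) * P.r ^ (l : ℕ)) := by
      refine Finset.prod_congr rfl fun l hl => ?_
      simp only [Finset.mem_erase] at hl
      rw [zext_congr (g' := g)]
      intro c hc
      rw [zg_mul_reflect, if_neg]
      rintro rfl
      exact hl.1 ((lab_strictMonoOn n X).injOn hl.2 h (by omega))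
    have key := right_cancel R hp hq hr hvu hu hv hlam hVL hBethe hS hR (m := n - X.card) g hlast
      hm _ rfl
    rw [hpw, hpw, hrest, if_pos h, if_pos h, ← ha, zext_val, zext_val, rightDiag, if_pos h, hlam,
      zg_mul_reflect, if_pos rfl]
    linear_combination (-(P.r ^ (i : ℕ) *
      ∏ l ∈ X.erase i, (zext k g (lab n X l) ^ ((l : ℕ) + 1) * P.r ^ (l : ℕ)))) * key
  · refine Finset.sum_eq_zero fun g _ => ?_
    rw [rightDiag, if_neg h, if_neg h, hlam]
    ring

end Coefficients

end Params

namespace Params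

/-! ### The left boundary -/

section LeftBoundary

variable {P : Params} {ε : ℤˣ} {n L : ℕ} {k : Fin n → ℂ}

theorem sum_Lam_carry (t : Fin n) (g : BC n) {x : ℤˣ × Fin n} (hx : x.2 ≤ t) :
    ∑ i ∈ Finset.Iic t, P.Lam (zg k (g * carry t x) i) = ∑ i ∈ Finset.Iic t, P.Lam (zg k g i) := by
  have hLam : ∀ z, P.Lam (1 / z) = P.Lam z := fun z => by
    rw [Lam, Lam, one_div_one_div]; ring
  have hnode : ∀ i, P.Lam (zg k (g * carry t x) i) = P.Lam (zg k g (Equiv.swap x.2 t i)) := by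
    intro i
    rw [zg_mul_carry]
    split_ifs with h
    · rw [h, Equiv.swap_apply_right]
      obtain ⟨s, l⟩ := x
      rcases Int.units_eq_one_or s with rfl | rfl
      · rw [node_one]
      · rw [node_neg_one, hLam]
    · rfl
  simp only [hnode]
  refine Finset.sum_equiv (Equiv.swap x.2 t) (fun i => ?_) (fun _ _ => rfl)
  rw [Finset.mem_Iic, Finset.mem_Iic, Equiv.swap_apply_def]
  split_ifs with h1 h2
  · subst h1; simp [hx]
  · subst h2; simp [hx]
  · rfl

/-- Balance for an empty first site, with `t + 1` excitations outside the lattice: the last of them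
may come from the first site. Here `f` stands for the plane wave of the other excitations. -/
theorem sum_left_empty
    (R : P.Regular ε k) (hp : P.p ≠ 0) (hq : P.q ≠ 0) (hpq : P.p ≠ P.q)
    (hr : P.r ^ 2 = P.q / P.p) (hα : ε = 1 → P.α ≠ 0) (hu : P.u ε 1 ≠ 0)
    (hv0 : P.v n 1 ≠ 0) (hvu : P.v n 1 ≠ P.u ε 2) {A₀ : BC n → ℂ}
    (hS : ∀ g, ∀ i j : Fin n, (j : ℕ) = i + 1 →
      A₀ (g * transp i j) = P.S (zg k g i) (zg k g j) * A₀ g)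
    (hR : ∀ g, ∀ i : Fin n, (i : ℕ) = 0 →
      P.tau ε i (zg k (g * reflect i)) * A₀ (g * reflect i) = P.tau ε i (zg k g) * A₀ g)
    (t : Fin n) (f : BC n → ℂ)
    (hf : ∀ g, ∀ x : ℤˣ × Fin n, x.2 ≤ t → f (g * carry t x) = f g) :
    ∑ g, P.redAmp ε k A₀ (t + 1) g * (f g * (P.leftEmpty ε n (t + 1) - lam (-ε) P.α P.γ
        - ∑ i ∈ Finset.Iic t, P.Lam (zg k g i)))
      + 2 * ((t : ℂ) + 1) * ∑ g, P.redAmp ε k A₀ t g * (zg k g t * f g) = 0 := by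
  have hr0 := r_ne_zero hp hq hr
  rw [card_mul_sum_eq_sum_carry, ← Finset.sum_add_distrib]
  refine Finset.sum_eq_zero fun g _ => ?_
  have h1 := sum_redAmp_carry R hr0 hS hR t g fun x => node (zg k g) x
  have h2 := (sum_leftWeight hp hq hpq hr hα hu hv0 hvu t (zg_ne_zero k g)
    (R.node_injective g)).1
  have h3 : ∑ x ∈ (Finset.univ : Finset ℤˣ) ×ˢ Finset.Iic t,
      P.redAmp ε k A₀ t (g * carry t x) * (zg k (g * carry t x) t * f (g * carry t x)) =
      f g * ∑ x ∈ (Finset.univ : Finset ℤˣ) ×ˢ Finset.Iic t,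
        P.redAmp ε k A₀ t (g * carry t x) * node (zg k g) x := by
    rw [Finset.mul_sum]
    refine Finset.sum_congr rfl fun x hx => ?_
    rw [hf g x (Finset.mem_Iic.mp (Finset.mem_product.mp hx).2), zg_mul_carry, if_pos rfl]
    ring
  rw [h3, h1, h2]
  ring

/-- Balance for an occupied first site, with `t` excitations outside the lattice: the excitation on
this site may come from outside. Here `f` stands for the plane wave of the other excitations. -/
theorem sum_left_full
    (R : P.Regular ε k) (hp : P.p ≠ 0) (hq : P.q ≠ 0) (hpq : P.p ≠ P.q)
    (hr : P.r ^ 2 = P.q / P.p) (hα : ε = 1 → P.α ≠ 0) (hu : P.u ε 1 ≠ 0)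
    (hv0 : P.v n 1 ≠ 0) (hvu : P.v n 1 ≠ P.u ε 2) {A₀ : BC n → ℂ}
    (hS : ∀ g, ∀ i j : Fin n, (j : ℕ) = i + 1 →
      A₀ (g * transp i j) = P.S (zg k g i) (zg k g j) * A₀ g)
    (hR : ∀ g, ∀ i : Fin n, (i : ℕ) = 0 →
      P.tau ε i (zg k (g * reflect i)) * A₀ (g * reflect i) = P.tau ε i (zg k g) * A₀ g)
    (t : Fin n) (f : BC n → ℂ)
    (hf : ∀ g, ∀ x : ℤˣ × Fin n, x.2 ≤ t → f (g * carry t x) = f g) :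
    2 * ((t : ℂ) + 1) * ∑ g, P.redAmp ε k A₀ t g * (zg k g t * f g *
        (P.leftFull ε n t - lam (-ε) P.α P.γ - ∑ i ∈ Finset.Iio t, P.Lam (zg k g i)
          - (P.sqrtpq * (1 / zg k g t) - P.p)))
      + P.entry ε n (t + 1) * P.D₁ ε n t * ∑ g, P.redAmp ε k A₀ (t + 1) g * f g = 0 := by
  have hr0 := r_ne_zero hp hq hr
  rw [card_mul_sum_eq_sum_carry, Finset.mul_sum, ← Finset.sum_add_distrib]
  refine Finset.sum_eq_zero fun g _ => ?_
  have h1 := sum_redAmp_carry R hr0 hS hR t g fun x => node (zg k g) x *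
    (P.sqrtpq * node (zg k g) x - P.q + P.leftFull ε n t - lam (-ε) P.α P.γ
          - ∑ i ∈ Finset.Iic t, P.Lam (zg k g i))
  have h2 := (sum_leftWeight hp hq hpq hr hα hu hv0 hvu t (zg_ne_zero k g)
    (R.node_injective g)).2
  have h3 : ∑ x ∈ (Finset.univ : Finset ℤˣ) ×ˢ Finset.Iic t,
      P.redAmp ε k A₀ t (g * carry t x) * (zg k (g * carry t x) t * f (g * carry t x) *
        (P.leftFull ε n t - lam (-ε) P.α P.γ
          - ∑ i ∈ Finset.Iio t, P.Lam (zg k (g * carry t x) i)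
          - (P.sqrtpq * (1 / zg k (g * carry t x) t) - P.p))) =
      f g * ∑ x ∈ (Finset.univ : Finset ℤˣ) ×ˢ Finset.Iic t,
        P.redAmp ε k A₀ t (g * carry t x) * (node (zg k g) x *
    (P.sqrtpq * node (zg k g) x - P.q + P.leftFull ε n t - lam (-ε) P.α P.γ
          - ∑ i ∈ Finset.Iic t, P.Lam (zg k g i))) := by
    rw [Finset.mul_sum]
    refine Finset.sum_congr rfl fun x hx => ?_
    have hx' : x.2 ≤ t := Finset.mem_Iic.mp (Finset.mem_product.mp hx).2
    have h4 : Finset.Iic t = insert t (Finset.Iio t) := (Finset.Iio_insert t).symm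
    have h5 := sum_Lam_carry (P := P) (k := k) t g hx'
    rw [← h5, h4, Finset.sum_insert (by simp), hf g x hx', zg_mul_carry, if_pos rfl, Lam]
    ring
  simp only [← mul_assoc] at h1 h2 h3 ⊢
  rw [h3, h1, Finset.mul_sum]
  simp only [mul_assoc] at h2 ⊢
  rw [← Finset.mul_sum]
  linear_combination f g * P.redAmp ε k A₀ (t + 1) g * h2

end LeftBoundary

end Params

namespace Params

section CoefficientEquation

variable {P : Params} {ε : ℤˣ} {n L : ℕ} {k : Fin n → ℂ}

/-- The coefficient of the ansatz vector whose excitations occupy `X`, as an average over the whole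
group `BC_n` instead of a sum over representatives of `BC_n / BC_m`. -/
def coef (P : Params) {n L : ℕ} (k : Fin n → ℂ) (A : ℕ → BC n → ℂ) (X : Finset (Fin L)) : ℂ :=
  (∑ g, A (n - X.card) g * planeWave P.r n (zext k g) X) / Nat.card (BCsub n (n - X.card))

theorem card_BCsub_ne_zero (n m : ℕ) : (Nat.card (BCsub n m) : ℂ) ≠ 0 :=
  Nat.cast_ne_zero.mpr Nat.card_pos.ne'

theorem card_mul_coef (A : ℕ → BC n → ℂ) (X : Finset (Fin L)) :
    (Nat.card (BCsub n (n - X.card)) : ℂ) * P.coef k A X =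
      ∑ g, A (n - X.card) g * planeWave P.r n (zext k g) X :=
  mul_div_cancel₀ _ (card_BCsub_ne_zero _ _)

theorem sum_Iio_zext (g : BC n) (t : Fin n) (f : ℂ → ℂ) :
    ∑ i ∈ Finset.Iio t, f (zg k g i) = ∑ j ∈ Finset.range t, f (zext k g j) := by
  rw [← Nat.Iio_eq_range, ← Fin.map_valEmbedding_Iio, Finset.sum_map]
  simp [zext_val]

theorem sum_Iic_zext (g : BC n) (t : Fin n) (f : ℂ → ℂ) :
    ∑ i ∈ Finset.Iic t, f (zg k g i) = ∑ j ∈ Finset.range (t + 1), f (zext k g j) := by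
  rw [← Finset.Iio_insert, Finset.sum_insert (by simp), sum_Iio_zext, Finset.sum_range_succ,
    zext_val, add_comm]

theorem zext_mul_carry (t : Fin n) (g : BC n) {x : ℤˣ × Fin n} (hx : x.2 ≤ t) {j : ℕ}
    (hj : (t : ℕ) + 1 ≤ j) : zext k (g * carry t x) j = zext k g j := by
  refine zext_congr fun i hi => zg_mul_of_mem k g
    (carry_mem_BCsub (m := t + 1) (Nat.lt_succ_self _) (Nat.lt_succ_of_le hx)) ?_
  omega

/-- The left boundary term, the missing hop of an excitation on the first site and the creation and
annihilation of an excitation contribute `λ_{-ε}` and the energies of the excitations outside the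
lattice. -/
theorem sum_left (R : P.Regular ε k) (hp : P.p ≠ 0) (hq : P.q ≠ 0) (hpq : P.p ≠ P.q)
    (hr : P.r ^ 2 = P.q / P.p) (hα : ε = 1 → P.α ≠ 0) (hu : P.u ε 1 ≠ 0)
    (hv : 0 < n → P.v n 1 ≠ 0 ∧ P.v n 1 ≠ P.u ε 2) {A : ℕ → BC n → ℂ}
    (hS : ∀ g, ∀ i j : Fin n, (j : ℕ) = i + 1 →
      A 0 (g * transp i j) = P.S (zg k g i) (zg k g j) * A 0 g)
    (hR : ∀ g, ∀ i : Fin n, (i : ℕ) = 0 →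
      P.tau ε i (zg k (g * reflect i)) * A 0 (g * reflect i) = P.tau ε i (zg k g) * A 0 g)
    (hT : ∀ g, ∀ t : Fin n, A (t + 1) g = P.T ε t (zg k g) * A t g)
    {X : Finset (Fin L)} (hX : X.card ≤ n) {i₀ : Fin L} (hi₀ : (i₀ : ℕ) = 0) :
    ∑ g, A (n - X.card) g * (planeWave P.r n (zext k g) X *
      (P.leftDiag ε n i₀ X - lam (-ε) P.α P.γ
        - ∑ j ∈ Finset.range (n - X.card), P.Lam (zext k g j)
        - if i₀ ∈ X then P.sqrtpq * (1 / zext k g (lab n X i₀)) - P.p else 0))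
      + (Nat.card (BCsub n (n - X.card)) : ℂ) *
        (if (flip i₀ X).card ≤ n then P.flipRate ε n i₀ (flip i₀ X) * P.coef k A (flip i₀ X)
          else 0) = 0 := by
  have hr0 := r_ne_zero hp hq hr
  have hamp : ∀ {m : ℕ}, m ≤ n → ∀ g, A m g = _ := fun hm g => amp_eq_redAmp R hr0 hT hm g
  by_cases h : i₀ ∈ X
  · have hc := card_flip_of_mem h
    have hc' : (flip i₀ X).card ≤ n := by omega
    have hX0 : 0 < X.card := by omega
    obtain ⟨t, ht⟩ : ∃ t : Fin n, (t : ℕ) = n - X.card := ⟨⟨n - X.card, by omega⟩, rfl⟩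
    have ht' : n - (flip i₀ X).card = (t : ℕ) + 1 := by omega
    obtain ⟨hv0, hvu⟩ := hv (by omega)
    have hmem : i₀ ∉ flip i₀ X := by rw [mem_flip_self]; simpa using h
    have hpw : ∀ g, planeWave P.r n (zext k g) X =
        zg k g t * planeWave P.r n (zext k g) (flip i₀ X) := by
      intro g
      have := planeWave_flip P.r (zext k g) hi₀ hc' (by rwa [flip_flip]) hmem
      rwa [flip_flip, ← ht, zext_val] at this
    have key := sum_left_full R hp hq hpq hr hα hu hv0 hvu hS hR t
      (fun g => planeWave P.r n (zext k g) (flip i₀ X)) fun g x hx =>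
        planeWave_congr _ fun j hj => zext_mul_carry t g hx (by omega)
    have hN := card_BCsub_succ (n := n) (m := t) t.2
    have hN' := card_BCsub_ne_zero n t
    have hN2 := card_BCsub_ne_zero n (t + 1)
    have hprod := prod_filter_lt_succ t fun s : Fin n => P.D₁ ε n s
    rw [if_pos hc', coef, ht', ← ht]
    simp only [hamp t.2.le, hamp (Nat.succ_le_of_lt t.2), hprod, leftDiag, h, if_true, flipRate,
      hmem, if_false, ht', ← ht, lab_of_val_eq_zero n X hi₀, zext_val, hpw, ← sum_Iio_zext]
    simp only [mul_assoc, ← Finset.mul_sum] at key ⊢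
    rw [hN] at hN2 ⊢
    push_cast at hN2 ⊢
    have ht2 : ((t : ℕ) : ℂ) + 1 ≠ 0 := Nat.cast_add_one_ne_zero _
    field_simp
    field_simp at key
    linear_combination (∏ s ∈ Finset.univ.filter fun s : Fin n => (s : ℕ) < t, P.D₁ ε n s) * key
  · have hc := card_flip_of_notMem h
    by_cases hc' : (flip i₀ X).card ≤ n
    · obtain ⟨t, ht⟩ : ∃ t : Fin n, (t : ℕ) = n - (flip i₀ X).card :=
        ⟨⟨n - (flip i₀ X).card, by omega⟩, rfl⟩
      have ht' : n - X.card = (t : ℕ) + 1 := by omega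
      obtain ⟨hv0, hvu⟩ := hv (by omega)
      have hmem : i₀ ∈ flip i₀ X := mem_flip_self.mpr h
      have hpw : ∀ g, planeWave P.r n (zext k g) (flip i₀ X) =
          zg k g t * planeWave P.r n (zext k g) X := by
        intro g
        rw [planeWave_flip P.r (zext k g) hi₀ hX hc' h, ← ht, zext_val]
      have key := sum_left_empty R hp hq hpq hr hα hu hv0 hvu hS hR t
        (fun g => planeWave P.r n (zext k g) X) fun g x hx =>
          planeWave_congr _ fun j hj => zext_mul_carry t g hx (by omega)
      have hN := card_BCsub_succ (n := n) (m := t) t.2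
      have hN' := card_BCsub_ne_zero n t
      have hprod := prod_filter_lt_succ t fun s : Fin n => P.D₁ ε n s
      rw [if_pos hc', coef, ht', ← ht]
      simp only [hamp t.2.le, hamp (Nat.succ_le_of_lt t.2), hprod, leftDiag, h, if_true, flipRate,
        hmem, if_false, ht', ← ht, hpw, ← sum_Iic_zext, sub_zero]
      simp only [mul_assoc, ← Finset.mul_sum] at key ⊢
      rw [hN]
      push_cast
      field_simp
      field_simp at key
      linear_combination (P.D₁ ε n t *
        ∏ s ∈ Finset.univ.filter fun s : Fin n => (s : ℕ) < t, P.D₁ ε n s) * key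
    · have hm : n - X.card = 0 := by omega
      rw [if_neg hc', mul_zero, add_zero]
      refine Finset.sum_eq_zero fun g _ => ?_
      rw [leftDiag, if_neg h, if_neg h, hm, P.leftEmpty_zero n hα hu]
      simp

end CoefficientEquation

end Params

namespace Params

/-! ### The eigenvalue equation of the coefficients -/

section Energy

variable {P : Params} {ε : ℤˣ} {n L : ℕ} {k : Fin n → ℂ}

theorem sum_Lam_zg (g : BC n) : ∑ i, P.Lam (zg k g i) = ∑ j, P.Lam (ev k (1, j)) := by
  have hinj : Function.Injective fun i : Fin n => (g.1 (1, i)).2 := by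
    intro i i' h
    by_contra hne
    exact BC_snd_ne g (b := (1, i)) (b' := (1, i')) hne h
  let e : Fin n ≃ Fin n := Equiv.ofBijective _ (Finite.injective_iff_bijective.mp hinj)
  refine Fintype.sum_equiv e _ _ fun i => ?_
  change P.Lam (ev k (g.1 (1, i))) = P.Lam (ev k (1, (g.1 (1, i)).2))
  generalize g.1 (1, i) = b
  obtain ⟨s, j⟩ := b
  rcases Int.units_eq_one_or s with rfl | rfl
  · rfl
  · rw [ev_neg, Lam, Lam, one_div_one_div, add_comm (1 / _)]

theorem energy_eq (ε ε' : ℤˣ) {X : Finset (Fin L)} (hX : X.card ≤ n) (g : BC n) :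
    P.energy ε ε' k = lam (-ε) P.α P.γ + lam (-ε') P.β P.δ
      + (∑ j ∈ Finset.range (n - X.card), P.Lam (zext k g j)
        + ∑ l ∈ X, P.Lam (zext k g (lab n X l))) := by
  have h1 : ∀ j, P.Lam (Complex.exp (Complex.I * k j)) = P.Lam (ev k (1, j)) := fun j => by
    simp [ev]
  have h2 : ∑ i, P.Lam (zg k g i) = ∑ j ∈ Finset.range n, P.Lam (zext k g j) := by
    rw [Finset.sum_range]
    exact Finset.sum_congr rfl fun i _ => by rw [zext_val]
  rw [energy, sum_lab hX fun j => P.Lam (zext k g j), Finset.sum_range_add_sum_Ico _ (by omega),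
    ← h2, sum_Lam_zg]
  simp only [h1]

/-- The coefficients of the ansatz satisfy the eigenvalue equation of the hopping matrix. -/
theorem coef_equation (R : P.Regular ε k) {ε' : ℤˣ} (hp : P.p ≠ 0) (hq : P.q ≠ 0)
    (hpq : P.p ≠ P.q) (hr : P.r ^ 2 = P.q / P.p) (hα : ε = 1 → P.α ≠ 0) (hu₁ : P.u ε 1 ≠ 0)
    (hvu : 0 < n → P.v n 1 ≠ 0 ∧ P.v n 1 ≠ P.u ε 2)
    (hu : (1 - P.u ε (n + 1)) * (P.β + P.δ * P.u ε (n + 1)) = 0)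
    (hv : 0 < n → P.δ * P.v n n ^ 2 + (P.β - P.δ + P.q - P.p) * P.v n n - P.β = 0)
    (hlam : lam (-ε') P.β P.δ = P.δ * (P.u ε (n + 1) - 1))
    (hVL : ∀ b, P.VL ε' (ev k b) ≠ 0)
    (hBethe : ∀ j : Fin n,
      ∏ l ∈ Finset.univ.erase j, P.S (ev k (1, l)) (ev k (1, j)) *
          P.S (ev k (-1, j)) (ev k (1, l)) =
        Complex.exp (2 * Complex.I * L * k j) *
          ((P.Vone ε (ev k (1, j)) * P.VL ε' (ev k (1, j))) /
            (P.Vone ε (ev k (-1, j)) * P.VL ε' (ev k (-1, j)))))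
    {A : ℕ → BC n → ℂ}
    (hS : ∀ g, ∀ i j : Fin n, (j : ℕ) = i + 1 →
      A 0 (g * transp i j) = P.S (zg k g i) (zg k g j) * A 0 g)
    (hR : ∀ g, ∀ i : Fin n, (i : ℕ) = 0 →
      P.tau ε i (zg k (g * reflect i)) * A 0 (g * reflect i) = P.tau ε i (zg k g) * A 0 g)
    (hT : ∀ g, ∀ t : Fin n, A (t + 1) g = P.T ε t (zg k g) * A t g)
    {X : Finset (Fin L)} (hX : X.card ≤ n) {i₀ i₁ : Fin L} (hi₀ : (i₀ : ℕ) = 0)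
    (hi₁ : (i₁ : ℕ) + 1 = L) :
    (P.leftDiag ε n i₀ X + P.rightDiag ε n i₁ X) * P.coef k A X
      + (if (flip i₀ X).card ≤ n then P.flipRate ε n i₀ (flip i₀ X) * P.coef k A (flip i₀ X)
          else 0)
      + (∑ i : Fin L, ∑ j : Fin L, if (j : ℕ) = i + 1 then
          P.hopRate i j (hop i j X) * P.coef k A (hop i j X) - P.hopRate i j X * P.coef k A X
          else 0) = P.energy ε ε' k * P.coef k A X := by
  have hr0 := r_ne_zero hp hq hr
  have hamp : ∀ {m : ℕ}, m ≤ n → ∀ g, A m g = _ := fun hm g => amp_eq_redAmp R hr0 hT hm g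
  set m := n - X.card with hm
  have hmn : m ≤ n := Nat.sub_le _ _
  have hN := card_BCsub_ne_zero n m
  have hleft := sum_left R hp hq hpq hr hα hu₁ hvu hS hR hT hX hi₀
  have hright : ∑ g, A m g * (planeWave P.r n (zext k g) X *
      (P.rightDiag ε n i₁ X - (if i₁ ∈ X then P.sqrtpq * zext k g (lab n X i₁) - P.q else 0)
        - lam (-ε') P.β P.δ)) = 0 := by
    have h := sum_right R hp hq hr (fun h => (hvu h).2) hu hv hlam hVL hBethe hS hR hX hi₁
    simp only [hamp hmn, mul_assoc, ← Finset.mul_sum]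
    rw [← hm] at h
    rw [h, mul_zero]
  have hcontact : ∑ g, A m g * ∑ i : Fin L, ∑ j : Fin L, (if (j : ℕ) = i + 1 ∧ i ∈ X ∧ j ∈ X then
      planeWave P.r n (zext k g) X *
        (P.sqrtpq * (zext k g (lab n X i) + 1 / zext k g (lab n X j)) - P.p - P.q)
      else 0) = 0 := by
    simp only [Finset.mul_sum]
    rw [Finset.sum_comm]
    refine Finset.sum_eq_zero fun i _ => ?_
    rw [Finset.sum_comm]
    refine Finset.sum_eq_zero fun j _ => ?_
    by_cases h : (j : ℕ) = i + 1 ∧ i ∈ X ∧ j ∈ X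
    · have h1 := sum_contact R hp hq hr hS hX h.1 h.2.1 h.2.2
      simp only [if_pos h, hamp hmn, mul_assoc, ← Finset.mul_sum]
      rw [← hm] at h1
      rw [h1, mul_zero]
    · simp only [if_neg h, mul_zero, Finset.sum_const_zero]
  have hbond : (Nat.card (BCsub n m) : ℂ) * (∑ i : Fin L, ∑ j : Fin L, if (j : ℕ) = i + 1 then
          P.hopRate i j (hop i j X) * P.coef k A (hop i j X) - P.hopRate i j X * P.coef k A X
          else 0) =
      ∑ g, A m g * ∑ i : Fin L, ∑ j : Fin L, (if (j : ℕ) = i + 1 then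
        P.hopRate i j (hop i j X) * planeWave P.r n (zext k g) (hop i j X)
          - P.hopRate i j X * planeWave P.r n (zext k g) X else 0) := by
    simp only [Finset.mul_sum]
    rw [Finset.sum_comm (s := (Finset.univ : Finset (BC n)))]
    refine Finset.sum_congr rfl fun i _ => ?_
    rw [Finset.sum_comm (s := (Finset.univ : Finset (BC n)))]
    refine Finset.sum_congr rfl fun j _ => ?_
    split_ifs with h
    · have h1 := card_mul_coef (P := P) (k := k) A X
      have h2 := card_mul_coef (P := P) (k := k) A (hop i j X)
      rw [card_hop] at h2
      rw [← hm] at h1 h2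
      rw [mul_sub, mul_left_comm, h2, mul_left_comm, h1, Finset.mul_sum, Finset.mul_sum,
        ← Finset.sum_sub_distrib]
      exact Finset.sum_congr rfl fun g _ => by ring
    · simp
  have hself := card_mul_coef (P := P) (k := k) A X
  rw [← hm] at hself hleft
  refine mul_left_cancel₀ hN ?_
  have hsum : (P.leftDiag ε n i₀ X + P.rightDiag ε n i₁ X - P.energy ε ε' k) *
        (∑ g, A m g * planeWave P.r n (zext k g) X)
      + ∑ g, A m g * ∑ i : Fin L, ∑ j : Fin L, (if (j : ℕ) = i + 1 then
        P.hopRate i j (hop i j X) * planeWave P.r n (zext k g) (hop i j X)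
          - P.hopRate i j X * planeWave P.r n (zext k g) X else 0) =
      ∑ g, A m g * (planeWave P.r n (zext k g) X *
        (P.leftDiag ε n i₀ X - lam (-ε) P.α P.γ
          - ∑ j ∈ Finset.range m, P.Lam (zext k g j)
          - if i₀ ∈ X then P.sqrtpq * (1 / zext k g (lab n X i₀)) - P.p else 0))
      + ∑ g, A m g * (planeWave P.r n (zext k g) X *
        (P.rightDiag ε n i₁ X - (if i₁ ∈ X then P.sqrtpq * zext k g (lab n X i₁) - P.q else 0)
          - lam (-ε') P.β P.δ))
      - ∑ g, A m g * ∑ i : Fin L, ∑ j : Fin L, (if (j : ℕ) = i + 1 ∧ i ∈ X ∧ j ∈ X then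
          planeWave P.r n (zext k g) X *
            (P.sqrtpq * (zext k g (lab n X i) + 1 / zext k g (lab n X j)) - P.p - P.q)
          else 0) := by
    rw [Finset.mul_sum, ← Finset.sum_add_distrib, ← Finset.sum_add_distrib,
      ← Finset.sum_sub_distrib]
    refine Finset.sum_congr rfl fun g _ => ?_
    rw [sum_hop_planeWave hp hr n (zext_ne_zero k g) X hi₀ hi₁, energy_eq ε ε' hX g]
    ring
  rw [mul_add, mul_add, hbond, mul_left_comm, hself, mul_left_comm, hself]
  linear_combination hsum + hleft + hright - hcontact

end Energy
end Params

/-! ### Ordered positions and occupied sets -/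

section Positions

variable {L n m : ℕ}

theorem card_Lab (n m : ℕ) : Fintype.card (Lab n m) = n - m := by
  have h : Finset.image (fun i : Lab n m => (i.1 : ℕ)) Finset.univ = Finset.Ico m n := by
    ext j
    simp only [Finset.mem_image, Finset.mem_univ, true_and, Finset.mem_Ico]
    constructor
    · rintro ⟨i, rfl⟩
      exact ⟨i.2, i.1.2⟩
    · rintro ⟨h1, h2⟩
      exact ⟨⟨⟨j, h2⟩, h1⟩, rfl⟩
  rw [← Finset.card_univ, ← Nat.card_Ico, ← h, Finset.card_image_of_injective]
  intro i i' h
  exact Subtype.ext (Fin.ext h)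

theorem card_Lab_lt (i : Lab n m) : (Finset.univ.filter fun i' : Lab n m => i' < i).card + m =
    (i.1 : ℕ) := by
  have h : Finset.image (fun i : Lab n m => (i.1 : ℕ)) (Finset.univ.filter (· < i)) =
      Finset.Ico m (i.1 : ℕ) := by
    ext j
    simp only [Finset.mem_image, Finset.mem_filter, Finset.mem_univ, true_and, Finset.mem_Ico]
    constructor
    · rintro ⟨i', h, rfl⟩
      exact ⟨i'.2, h⟩
    · rintro ⟨h1, h2⟩
      exact ⟨⟨⟨j, h2.trans i.1.2⟩, h1⟩, h2, rfl⟩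
  rw [← Finset.card_image_of_injective (f := fun i : Lab n m => (i.1 : ℕ)), h, Nat.card_Ico]
  · exact Nat.sub_add_cancel i.2
  · intro i i' h
    exact Subtype.ext (Fin.ext h)

theorem lab_image (hm : m ≤ n) {x : Lab n m → Fin L} (hx : StrictMono x) (l : Fin L) :
    lab n (Finset.univ.image x) l = m + (Finset.univ.filter fun i => x i < l).card := by
  rw [lab, Finset.card_image_of_injective _ hx.injective, Finset.card_univ, card_Lab,
    Nat.sub_sub_self hm, Finset.filter_image, Finset.card_image_of_injective _ hx.injective]

theorem lab_image_self (hm : m ≤ n) {x : Lab n m → Fin L} (hx : StrictMono x) (i : Lab n m) :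
    lab n (Finset.univ.image x) (x i) = (i.1 : ℕ) := by
  rw [lab_image hm hx, ← card_Lab_lt i, add_comm]
  simp only [hx.lt_iff_lt]

theorem planeWave_image (r : ℂ) (ζ : ℕ → ℂ) (hm : m ≤ n) {x : Lab n m → Fin L}
    (hx : StrictMono x) :
    planeWave r n ζ (Finset.univ.image x) =
      (∏ i : Lab n m, ζ i.1 ^ ((x i : ℕ) + 1)) * r ^ ∑ i, (x i : ℕ) := by
  rw [planeWave, Finset.prod_image fun i _ i' _ h => hx.injective h, Finset.prod_mul_distrib,
    Finset.prod_pow_eq_pow_sum]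
  simp only [lab_image_self hm hx]

/-- Increasing positions are the same as occupied sets of sites. -/
theorem sum_strictMono {M : Type*} [AddCommMonoid M] (hm : m ≤ n)
    [DecidablePred fun x : Lab n m → Fin L => StrictMono x] (f : Finset (Fin L) → M) :
    ∑ x : Lab n m → Fin L with StrictMono x, f (Finset.univ.image x) =
      ∑ X : Finset (Fin L) with n - X.card = m ∧ X.card ≤ n, f X := by
  refine Finset.sum_bij (fun x _ => Finset.univ.image x) ?_ ?_ ?_ ?_
  · intro x hx
    have hx' : StrictMono x := (Finset.mem_filter.mp hx).2
    simp only [Finset.mem_filter, Finset.mem_univ, true_and]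
    rw [Finset.card_image_of_injective _ hx'.injective, Finset.card_univ, card_Lab]
    omega
  · intro x hx y hy h
    refine ((Finset.mem_filter.mp hx).2.range_inj (Finset.mem_filter.mp hy).2).mp ?_
    have := congrArg (fun X : Finset (Fin L) => (X : Set (Fin L))) h
    simpa using this
  · intro X hX
    obtain ⟨h1, h2⟩ := (Finset.mem_filter.mp hX).2
    have hcard : X.card = n - m := by omega
    let e := Fintype.orderIsoFinOfCardEq (Lab n m) (card_Lab n m)
    refine ⟨fun i => X.orderEmbOfFin hcard (e.symm i), ?_, ?_⟩
    · simp only [Finset.mem_filter, Finset.mem_univ, true_and]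
      exact (X.orderEmbOfFin hcard).strictMono.comp e.symm.strictMono
    · have : Set.range (fun i => X.orderEmbOfFin hcard (e.symm i)) = X := by
        rw [← Finset.range_orderEmbOfFin X hcard]
        exact e.symm.surjective.range_comp _
      rw [← Finset.coe_inj, Finset.coe_image, Finset.coe_univ, Set.image_univ, this]
  · intro x _
    rfl

end Positions

namespace Params

variable {P : Params} {ε : ℤˣ} {n L : ℕ} {V : Type*} [AddCommGroup V] [Module ℂ V]

theorem ket_eq (E D : Module.End ℂ V) (V₁ : Module.Dual ℂ V) (V₂ : V) {m : ℕ} (hm : m ≤ n)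
    {x : Lab n m → Fin L} (hx : StrictMono x) :
    P.ket ε E D V₁ V₂ x =
      P.r ^ (∑ i, (x i : ℕ)) • P.siteKet ε n E D V₁ V₂ (Finset.univ.image x) := by
  have hcol : P.siteColumn ε E D x = P.col ε n E D (Finset.univ.image x) := by
    funext l
    have hmem : l ∈ Finset.univ.image x ↔ ∃ i, x i = l := by simp
    have hl : m + 1 + (Finset.univ.filter fun i => x i < l).card =
        lab n (Finset.univ.image x) l + 1 := by
      rw [lab_image hm hx]; ring
    simp only [siteColumn, col, hmem, ← hl]
  funext τ
  simp only [ket, hcol, Pi.smul_apply, smul_eq_mul, siteKet, mpVec]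

/-- The Bethe vector as a sum over occupied sets, with amplitudes averaged over the whole group. -/
theorem Phi_eq (E D : Module.End ℂ V) (V₁ : Module.Dual ℂ V) (V₂ : V) (k : Fin n → ℂ)
    {G : ℕ → Finset (BC n)}
    (hG : ∀ m ≤ n, Subgroup.IsComplement (G m : Set (BC n)) (BCsub n m)) {A : ℕ → BC n → ℂ}
    (hA : ∀ m ≤ n, ∀ g, ∀ h ∈ BCsub n m, A m (g * h) = A m g) :
    (P.Phi ε E D V₁ V₂ k G A : Phys L) =
      ∑ X : Finset (Fin L) with X.card ≤ n, P.coef k A X • P.siteKet ε n E D V₁ V₂ X := by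
  classical
  have hterm : ∀ m ≤ n, ∀ x : Lab n m → Fin L, StrictMono x →
      ∑ g ∈ G m, (A m g * ∏ i : Lab n m, zg k g i ^ ((x i : ℕ) + 1)) • P.ket ε E D V₁ V₂ x =
      P.coef k A (Finset.univ.image x) • P.siteKet ε n E D V₁ V₂ (Finset.univ.image x) := by
    intro m hm x hx
    have hcard : n - (Finset.univ.image x).card = m := by
      rw [Finset.card_image_of_injective _ hx.injective, Finset.card_univ, card_Lab]
      omega
    rw [← Finset.sum_smul, ket_eq E D V₁ V₂ hm hx, smul_smul, Finset.sum_mul]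
    congr 1
    have h := card_mul_sum_complement (hG m hm)
      (fun g => A m g * (∏ i : Lab n m, zg k g i ^ ((x i : ℕ) + 1)) * P.r ^ ∑ i, (x i : ℕ)) (by
        intro g h hh
        have : ∀ i : Lab n m, zg k (g * h) i = zg k g i := fun i => zg_mul_of_mem k g hh i.2
        simp only [hA m hm g h hh, this])
    rw [coef, hcard, eq_div_iff (card_BCsub_ne_zero n m), mul_comm, h]
    refine Finset.sum_congr rfl fun g _ => ?_
    rw [planeWave_image P.r (zext k g) hm hx, mul_assoc]
    simp only [zext_val]
  rw [Phi, ← Finset.sum_fiberwise_of_maps_to (s := Finset.univ.filter fun X : Finset (Fin L) =>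
    X.card ≤ n) (t := Finset.range (n + 1)) (g := fun X => n - X.card)
    (fun X _ => Finset.mem_range.mpr (by omega))]
  refine Finset.sum_congr rfl fun m hm => ?_
  have hm' : m ≤ n := by have := Finset.mem_range.mp hm; omega
  have h1 := sum_strictMono (L := L) hm' fun X => P.coef k A X • P.siteKet ε n E D V₁ V₂ X
  rw [Finset.filter_filter]
  simp only [and_comm (a := (_ : Finset (Fin L)).card ≤ n)]
  rw [← h1]
  refine Finset.sum_congr (by congr) fun x hx => ?_
  exact hterm m hm' x (Finset.mem_filter.mp hx).2

end Params

namespace Params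

/-! ### Consequences of the boundary constraint -/

section Constraint

variable {P : Params} {ε ε' : ℤˣ} {n : ℕ}

theorem u_one_ne_zero (hp : P.p ≠ 0) (hq : P.q ≠ 0)
    (hc : c ε P.α P.γ * c ε' P.β P.δ = Complex.exp P.s * (P.p / P.q) ^ n) : P.u ε 1 ≠ 0 := by
  have h : c ε P.α P.γ * c ε' P.β P.δ ≠ 0 := by
    rw [hc]
    exact mul_ne_zero (Complex.exp_ne_zero _) (pow_ne_zero _ (div_ne_zero hp hq))
  rw [u_one]
  exact neg_ne_zero.mpr (mul_ne_zero (Complex.exp_ne_zero _) (left_ne_zero_of_mul h))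

/-- The constraint says that `u_{n+1} = -1 / c_{ε'}(β,δ)`. -/
theorem u_mul_c (hp : P.p ≠ 0) (hq : P.q ≠ 0)
    (hc : c ε P.α P.γ * c ε' P.β P.δ = Complex.exp P.s * (P.p / P.q) ^ n) :
    P.u ε (n + 1) * c ε' P.β P.δ = -1 := by
  have h1 : (P.q / P.p) ^ n * (P.p / P.q) ^ n = 1 := by
    rw [← mul_pow, div_mul_div_cancel₀ hp, div_self hq, one_pow]
  have h2 : Complex.exp (-P.s) * Complex.exp P.s = 1 := by rw [← Complex.exp_add]; simp
  rw [u_succ P hp hq, u_one]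
  linear_combination -((P.q / P.p) ^ n * Complex.exp (-P.s)) * hc
    - (P.q / P.p) ^ n * (P.p / P.q) ^ n * h2 - h1

/-- Both signs of `ε'` lead to the same data: `u_{n+1}` is a root of the right boundary quadratic,
and it determines `λ_{-ε'}`. -/
theorem u_last_root (hp : P.p ≠ 0) (hq : P.q ≠ 0) (hβ : ε' = 1 → P.β ≠ 0)
    (hc : c ε P.α P.γ * c ε' P.β P.δ = Complex.exp P.s * (P.p / P.q) ^ n) :
    (1 - P.u ε (n + 1)) * (P.β + P.δ * P.u ε (n + 1)) = 0 ∧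
      lam (-ε') P.β P.δ = P.δ * (P.u ε (n + 1) - 1) := by
  have h := u_mul_c hp hq hc
  rcases Int.units_eq_one_or ε' with rfl | rfl
  · have hβ' := hβ rfl
    have h1 : P.δ * P.u ε (n + 1) = -P.β := by
      rw [c, if_pos rfl] at h
      field_simp at h
      linear_combination h
    have h2 : lam (-1) P.β P.δ = -P.β - P.δ := by
      rw [lam, if_neg (by decide)]
    exact ⟨by rw [h1]; ring, by rw [h2]; linear_combination -h1⟩
  · have h1 : P.u ε (n + 1) = 1 := by
      rw [c, if_neg (by decide)] at h
      linear_combination -h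
    have h2 : lam (- -1) P.β P.δ = 0 := by
      rw [lam, if_pos (by decide)]
    exact ⟨by rw [h1]; ring, by rw [h2, h1]; ring⟩

theorem v_last_root (hp : P.p ≠ 0) (hq : P.q ≠ 0) (hδ : P.δ ≠ 0)
    (hd : P.d ^ 2 = (P.β - P.δ + P.q - P.p) ^ 2 + 4 * P.β * P.δ) :
    P.δ * P.v n n ^ 2 + (P.β - P.δ + P.q - P.p) * P.v n n - P.β = 0 := by
  have h1 : (P.q / P.p) ^ ((n : ℤ) - 1) * (P.p / P.q) ^ ((n : ℤ) - 1) = 1 := by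
    rw [← mul_zpow, div_mul_div_cancel₀ hp, div_self hq, one_zpow]
  have h2 : P.v n n = (P.p - P.q + P.δ - P.β + P.d) / (2 * P.δ) := by
    rw [v, v₁]
    linear_combination (1 / (2 * P.δ)) * (P.p - P.q + P.δ - P.β + P.d) * h1
  rw [h2]
  field_simp
  linear_combination hd

end Constraint

/-- The rule for a reflection of the first letter, which is not among the assumptions on `A^{(0)}`,
follows from the invariance of `A^{(1)}` under `r_1` because `D_1^{(0)}` does not vanish. -/
theorem tau_reflect {P : Params} {ε : ℤˣ} {n : ℕ} {k : Fin n → ℂ} (R : P.Regular ε k)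
    (hr0 : P.r ≠ 0) (hD : 0 < n → P.D₁ ε n 0 ≠ 0) {A : ℕ → BC n → ℂ}
    (hA : ∀ m ≤ n, ∀ g, ∀ h ∈ BCsub n m, A m (g * h) = A m g)
    (hT : ∀ g, ∀ t : Fin n, A (t + 1) g = P.T ε t (zg k g) * A t g) (g : BC n) (i : Fin n)
    (hi : (i : ℕ) = 0) :
    P.tau ε i (zg k (g * reflect i)) * A 0 (g * reflect i) = P.tau ε i (zg k g) * A 0 g := by
  have hn : 0 < n := by have := i.2; omega
  have h1 := hA 1 hn g (reflect i) (reflect_mem_BCsub (by omega))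
  have h2 := hT g i
  have h3 := hT (g * reflect i) i
  rw [T_eq R hr0] at h2 h3
  simp only [hi, zero_add] at h2 h3
  rw [h2, h3, mul_assoc, mul_assoc] at h1
  exact mul_left_cancel₀ (hD hn) h1

end Params

end

end MCBA

theorem theorem1 (P : MCBA.Params) (ε ε' : ℤˣ) (L n : ℕ) (hn : n < L)
    (hp : P.p ≠ 0) (hq : P.q ≠ 0) (hpq : P.p ≠ P.q)
    (hr : P.r ^ 2 = P.q / P.p)
    (hd : P.d ^ 2 = (P.β - P.δ + P.q - P.p) ^ 2 + 4 * P.β * P.δ)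
    -- the boundary constraint
    (hα : ε = 1 → P.α ≠ 0) (hβ : ε' = 1 → P.β ≠ 0)
    (hc : MCBA.c ε P.α P.γ * MCBA.c ε' P.β P.δ = Complex.exp P.s * (P.p / P.q) ^ n)
    -- the auxiliary operators and boundary vectors
    {V : Type*} [AddCommGroup V] [Module ℂ V]
    (E D : Module.End ℂ V) (V₁ : Module.Dual ℂ V) (V₂ : V)
    (hbulk : P.q • (E * D) - P.p • (D * E) = E + D)
    (hright : (P.β • D - P.δ • E + 1) V₂ = 0)
    (hleft : V₁ ∘ₗ ((P.α * Complex.exp P.s) • (E - P.br (P.u ε 1) • (1 : Module.End ℂ V))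
        - (P.γ * Complex.exp (-P.s)) • (D - P.br (1 / P.u ε 1) • (1 : Module.End ℂ V)) + 1) = 0)
    -- the pseudo-momenta, and the non-vanishing of the quantities that are divided by
    (k : Fin n → ℂ)
    (hv : 0 < n → P.δ ≠ 0 ∧ P.v n 1 ≠ 0 ∧ P.v n 1 ≠ P.u ε 2 ∧ P.D₁ ε n 0 ≠ 0)
    (hz : ∀ b : ℤˣ × Fin n, MCBA.ev k b ^ 2 ≠ 1 ∧ P.p₁ ε n (MCBA.ev k b) ≠ 0 ∧
      P.Vone ε (MCBA.ev k b) ≠ 0 ∧ P.VL ε' (MCBA.ev k b) ≠ 0)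
    (hzz : ∀ b b' : ℤˣ × Fin n, b.2 ≠ b'.2 →
      MCBA.ev k b * MCBA.ev k b' ≠ 1 ∧ P.a (MCBA.ev k b) (MCBA.ev k b') ≠ 0)
    -- the coset representatives `G_m` of `BC_n / BC_m`
    (G : ℕ → Finset (MCBA.BC n))
    (hG : ∀ m ≤ n, Subgroup.IsComplement (G m : Set (MCBA.BC n)) (MCBA.BCsub n m))
    -- the amplitudes: functions on `BC_n / BC_m` with the two recursions
    (A : ℕ → MCBA.BC n → ℂ)
    (hA : ∀ m ≤ n, ∀ g, ∀ h ∈ MCBA.BCsub n m, A m (g * h) = A m g)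
    (hS : ∀ g, ∀ i j : Fin n, (j : ℕ) = i + 1 →
      A 0 (g * MCBA.transp i j) = P.S (MCBA.zg k g i) (MCBA.zg k g j) * A 0 g)
    (hT : ∀ g, ∀ t : Fin n, A (t + 1) g = P.T ε t (MCBA.zg k g) * A t g)
    -- the Bethe equations
    (hBethe : ∀ j : Fin n,
      ∏ l ∈ Finset.univ.erase j, P.S (MCBA.ev k (1, l)) (MCBA.ev k (1, j)) *
          P.S (MCBA.ev k (-1, j)) (MCBA.ev k (1, l)) =
        Complex.exp (2 * Complex.I * L * k j) *
          ((P.Vone ε (MCBA.ev k (1, j)) * P.VL ε' (MCBA.ev k (1, j))) /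
            (P.Vone ε (MCBA.ev k (-1, j)) * P.VL ε' (MCBA.ev k (-1, j))))) :
    P.W L *ᵥ P.Phi ε E D V₁ V₂ k G A = P.energy ε ε' k • P.Phi ε E D V₁ V₂ k G A ∧
      ((P.Phi ε E D V₁ V₂ k G A : MCBA.Phys L) ≠ 0 →
        Module.End.HasEigenvector (Matrix.toLin' (P.W L)) (P.energy ε ε' k)
          (P.Phi ε E D V₁ V₂ k G A)) := by
  have R : P.Regular ε k :=
    { sq_ne_one := fun b => (hz b).1
      p₁_ne_zero := fun b => (hz b).2.1
      Vone_ne_zero := fun b => (hz b).2.2.1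
      mul_ne_one := fun b b' h => (hzz b b' h).1
      a_ne_zero := fun b b' h => (hzz b b' h).2 }
  have hr0 := MCBA.Params.r_ne_zero hp hq hr
  have hu₁ := MCBA.Params.u_one_ne_zero hp hq hc
  obtain ⟨hu, hlam⟩ := MCBA.Params.u_last_root hp hq hβ hc
  have hvn := fun h : 0 < n => MCBA.Params.v_last_root (n := n) hp hq (hv h).1 hd
  have hvu : 0 < n → P.v n 1 ≠ 0 ∧ P.v n 1 ≠ P.u ε 2 := fun h => ⟨(hv h).2.1, (hv h).2.2.1⟩
  have hR := MCBA.Params.tau_reflect R hr0 (fun h => (hv h).2.2.2) hA hT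
  have hL : 0 < L := by omega
  have hi₁ : ((⟨L - 1, by omega⟩ : Fin L) : ℕ) + 1 = L := Nat.sub_add_cancel hL
  have heq : P.W L *ᵥ P.Phi ε E D V₁ V₂ k G A = P.energy ε ε' k • P.Phi ε E D V₁ V₂ k G A := by
    rw [MCBA.Params.Phi_eq E D V₁ V₂ k hG hA]
    exact MCBA.Params.W_mulVec_sum_siteKet hp hq hpq hbulk hα hu₁ hleft hvu hright hu hvn
      (i₀ := ⟨0, hL⟩) rfl hi₁ _ _ fun X hX =>
        MCBA.Params.coef_equation R hp hq hpq hr hα hu₁ hvu hu hvn hlam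
          (fun b => (hz b).2.2.2) hBethe hS hR hT hX rfl hi₁
  refine ⟨heq, fun h0 => Module.End.hasEigenvector_iff.mpr
    ⟨Module.End.mem_eigenspace_iff.mpr ?_, h0⟩⟩
  rw [Matrix.toLin'_apply]
  exact heq
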